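/- **Setting.** Let $G=(V,E)$ be a finite simple connected graph and let $n\ge 1$ agents have the same utility function $u:2^V\to\mathbb R_{\ge 0}$ with $u(\emptyset)\le u(X)$ for all $X\subseteq V$ (for instance $u(\emptyset)=0$, or $u$ monotone). A bundle $X\subseteq V$ is connected if $G[X]$ is connected or $X=\emptyset$. A connected allocation of $S\subseteq V$ to a set $N$ of agents is a family $(A_i)_{i\in N}$ of pairwise disjoint connected bundles with union $S$. For connected $X$ and $k\ge1$ let $\mu^k(X)$ be the maximum of $\min_{j} u(B_j)$ over all connected allocations $(B_1,\dots,B_k)$ of $X$. A connected allocation $A$ of a connected set $S$ to $N$ is *MMS* if $u(A_i)\ge \mu^{|N|}(S)$ for all $i\in N$; its *losers* are the agents with $u(A_i)=\mu^{|N|}(S)$; it is *SMMS* if it is MMS and has the least number of losers among all connected MMS allocations of $S$ to $N$. It is *PMMS* if $u(A_i)\ge \mu^2(A_i\cup A_j)$ for all agents $i\ne j$ such that $A_i=\emptyset$ or some edge of $G$ joins $A_i$ to $A_j$. **Recursive algorithm.** On a connected graph with a non-empty set of agents: choose some SMMS connected allocation $A$; every loser $i$ keeps $A_i$; delete the losers'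 bundles; on each connected component $C$ of the remaining graph, run the algorithm with the non-losers $i$ with $A_i\subseteq C$, and give them the bundles obtained there. **Machine model.** Programs are finite while-programs on a random access machine whose memory has arrays of natural numbers and arrays of real numbers. The arithmetic operations are addition, subtraction (truncated for natural numbers) and comparison; each executed assignment, test or oracle call is one step. Vertices are numbered $0,\dots,|V|-1$, the input is $|V|$, $n$, the adjacency matrix and, for additive $u$, the values $u(\{v\})$; the output is the agent of every vertex. **Theorem.** 1. For every $G$, $n$, $u$ as above the recursive algorithm has a result, and every result (whatever SMMS allocations were chosen) is a connected allocation that is simultaneously PMMS and SMMS, hence MMS. 2. There are a program with two oracles and a polynomial $p$ such that for all $G$, $n$, $u$ as above the program halts after at most $p(|V|+n)$ steps with a result of the recursive algorithm, provided that one oracle returns $u(X)$ for $X\subseteq V$, and the other one returns an SMMS connected allocation of $X$ to $k$ agents for every non-empty connected $X\subseteq V$ and $k\ge 1$. In other words, the algorithm runs in polynomial time relative to computing $u$ and finding SMMS connected allocations. 3. There are a program without oracles and a polynomial $p$ such that for every tree $G$, every $n\ge1$ and every additive $u:2^V\to\mathbb R_{\ge0}$ (that is, $u(X)=\sum_{v\in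 X}u(\{v\})$) the program halts after at most $p(|V|+n)$ steps with a result of the recursive algorithm, which is a connected allocation that is simultaneously PMMS and SMMS, hence MMS. -/

import Mathlib

/-! ### Connected allocations and fairness notions (identical utilities) -/

namespace FairDivision

variable {V ι : Type*} [DecidableEq V]

/-- A bundle is connected if it induces a connected subgraph; the empty bundle counts as
connected (agents may receive nothing). -/
def ConnBundle (G : SimpleGraph V) (X : Finset V) : Prop :=
  (G.induce (X : Set V)).Preconnected

/-- `A` splits the vertex set `S` into pairwise disjoint connected bundles `A i`, one for each
agent `i ∈ N` (bundles may be empty). -/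
structure IsConnAlloc (G : SimpleGraph V) (S : Finset V) (N : Finset ι) (A : ι → Finset V) :
    Prop where
  conn : ∀ i ∈ N, ConnBundle G (A i)
  disj : ∀ i ∈ N, ∀ j ∈ N, i ≠ j → Disjoint (A i) (A j)
  cover : N.biUnion A = S

/-- The `k`-maximin share `μ^k(X)`: the maximum, over all partitions of `X` into `k` connected
bundles, of the smallest utility of a bundle. For `k ≥ 1` and `X` connected, the set below is
finite and non-empty, so that its supremum is a maximum. -/
noncomputable def maximinShare (G : SimpleGraph V) (u : Finset V → ℝ) (k : ℕ) (X : Finset V) : ℝ :=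
  sSup {r : ℝ | ∃ A : Fin k → Finset V,
    IsConnAlloc G X (Finset.univ : Finset (Fin k)) A ∧ r = ⨅ j, u (A j)}

/-- Every agent receives at least the maximin share of the whole vertex set `S`. -/
def IsMMS (G : SimpleGraph V) (u : Finset V → ℝ) (S : Finset V) (N : Finset ι)
    (A : ι → Finset V) : Prop :=
  ∀ i ∈ N, maximinShare G u N.card S ≤ u (A i)

/-- The agents that receive exactly the maximin share. -/
noncomputable def losers (G : SimpleGraph V) (u : Finset V → ℝ) (S : Finset V) (N : Finset ι)
    (A : ι → Finset V) : Finset ι :=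
  N.filter fun i => u (A i) = maximinShare G u N.card S

/-- A connected allocation is SMMS if it is MMS and, among all connected MMS allocations, has the
least number of losers. -/
structure IsSMMS (G : SimpleGraph V) (u : Finset V → ℝ) (S : Finset V) (N : Finset ι)
    (A : ι → Finset V) : Prop where
  alloc : IsConnAlloc G S N A
  mms : IsMMS G u S N A
  minimal : ∀ B : ι → Finset V, IsConnAlloc G S N B → IsMMS G u S N B →
    (losers G u S N A).card ≤ (losers G u S N B).card

/-- Pairwise maximin share: agents with an empty bundle compare with everybody, the others with
their neighbours. -/
def IsPMMS (G : SimpleGraph V) (u : Finset V → ℝ) (N : Finset ι) (A : ι → Finset V) : Prop :=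
  ∀ i ∈ N, ∀ j ∈ N, i ≠ j →
    (A i = ∅ ∨ ∃ v ∈ A i, ∃ w ∈ A j, G.Adj v w) →
    maximinShare G u 2 (A i ∪ A j) ≤ u (A i)

/-- `C` is (the vertex set of) a connected component of the induced subgraph `G[T]`. -/
def IsComponent (G : SimpleGraph V) (T C : Finset V) : Prop :=
  C ⊆ T ∧ C.Nonempty ∧ ConnBundle G C ∧
    ∀ D : Finset V, C ⊆ D → D ⊆ T → ConnBundle G D → D = C

/-- `LoserRecursion G u S N B`: the allocation `B` is a possible result of the recursive algorithm
on the graph `G[S]` with the set `N` of agents. The algorithm picks some SMMS connected allocation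
`A`, gives every loser `i` the bundle `A i` for good, deletes the losers' bundles, and calls itself
on every connected component `C` of the remaining graph with the non-losers `i` with `A i ⊆ C`.
(Only the values `B i` with `i ∈ N` matter.) -/
inductive LoserRecursion [DecidableEq ι] (G : SimpleGraph V) (u : Finset V → ℝ) :
    Finset V → Finset ι → (ι → Finset V) → Prop
  | step {S : Finset V} {N : Finset ι} {A B : ι → Finset V}
      (smms : IsSMMS G u S N A)
      (fixed : ∀ i ∈ losers G u S N A, B i = A i)
      (recurse : ∀ C : Finset V, IsComponent G (S \ (losers G u S N A).biUnion A) C →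
        LoserRecursion G u C (N.filter fun i => i ∉ losers G u S N A ∧ A i ⊆ C) B) :
      LoserRecursion G u S N B

/-- A utility function on bundles is additive. -/
def IsAdditive (u : Finset V → ℝ) : Prop :=
  ∀ X : Finset V, u X = ∑ v ∈ X, u {v}

end FairDivision

/-! ### A random access machine with step count

The memory consists of two-dimensional arrays of natural numbers and two-dimensional arrays of real
numbers, named by numerals; a program is a finite structured text. Arithmetic is restricted to
addition, subtraction and comparison, in particular there is no multiplication and no rounding.
Every executed assignment, test or oracle call counts as one step. -/

namespace RAM

/-- The memory: `nat a i j` and `real a i j` are the cells `(i, j)` of the arrays named `a`. -/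
structure Mem where
  nat : ℕ → ℕ → ℕ → ℕ
  real : ℕ → ℕ → ℕ → ℝ

/-- Overwrite one natural-number cell. -/
def Mem.setNat (s : Mem) (a i j x : ℕ) : Mem where
  nat := fun a' i' j' => if a' = a ∧ i' = i ∧ j' = j then x else s.nat a' i' j'
  real := s.real

/-- Overwrite one real cell. -/
noncomputable def Mem.setReal (s : Mem) (a i j : ℕ) (x : ℝ) : Mem where
  nat := s.nat
  real := fun a' i' j' => if a' = a ∧ i' = i ∧ j' = j then x else s.real a' i' j'

/-- Expressions for natural numbers; `sub` is truncated subtraction. -/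
inductive NExpr where
  | const (k : ℕ)
  | cell (a : ℕ) (i j : NExpr)
  | add (e f : NExpr)
  | sub (e f : NExpr)

def NExpr.eval (s : Mem) : NExpr → ℕ
  | .const k => k
  | .cell a i j => s.nat a (i.eval s) (j.eval s)
  | .add e f => e.eval s + f.eval s
  | .sub e f => e.eval s - f.eval s

/-- Expressions for real numbers. -/
inductive RExpr where
  | zero
  | cell (a : ℕ) (i j : NExpr)
  | add (e f : RExpr)
  | sub (e f : RExpr)

noncomputable def RExpr.eval (s : Mem) : RExpr → ℝ
  | .zero => 0
  | .cell a i j => s.real a (i.eval s) (j.eval s)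
  | .add e f => e.eval s + f.eval s
  | .sub e f => e.eval s - f.eval s

/-- Tests. -/
inductive Test where
  | nlt (e f : NExpr)
  | rlt (e f : RExpr)
  | not (b : Test)
  | and (b c : Test)

def Test.Holds (s : Mem) : Test → Prop
  | .nlt e f => e.eval s < f.eval s
  | .rlt e f => e.eval s < f.eval s
  | .not b => ¬ b.Holds s
  | .and b c => b.Holds s ∧ c.Holds s

/-- Programs with oracle instructions named by `Q`; a `Program Empty` has no oracle. -/
inductive Program (Q : Type) where
  | skip
  | setNat (a : ℕ) (i j e : NExpr)
  | setReal (a : ℕ) (i j : NExpr) (e : RExpr)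
  | seq (c d : Program Q)
  | cond (b : Test) (c d : Program Q)
  | loop (b : Test) (c : Program Q)
  | call (q : Q)

/-- `Runs O c s t s'`: started with memory `s`, the program `c` halts after exactly `t` steps with
memory `s'`, where the oracle instruction `q` transforms the memory by `O q`. -/
inductive Runs {Q : Type} (O : Q → Mem → Mem) : Program Q → Mem → ℕ → Mem → Prop
  | skip (s : Mem) : Runs O .skip s 1 s
  | setNat (a : ℕ) (i j e : NExpr) (s : Mem) :
      Runs O (.setNat a i j e) s 1 (s.setNat a (i.eval s) (j.eval s) (e.eval s))
  | setReal (a : ℕ) (i j : NExpr) (e : RExpr) (s : Mem) :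
      Runs O (.setReal a i j e) s 1 (s.setReal a (i.eval s) (j.eval s) (e.eval s))
  | seq {c d : Program Q} {s s' s'' : Mem} {t t' : ℕ} :
      Runs O c s t s' → Runs O d s' t' s'' → Runs O (.seq c d) s (t + t') s''
  | condTrue {b : Test} {c d : Program Q} {s s' : Mem} {t : ℕ} :
      b.Holds s → Runs O c s t s' → Runs O (.cond b c d) s (t + 1) s'
  | condFalse {b : Test} {c d : Program Q} {s s' : Mem} {t : ℕ} :
      ¬ b.Holds s → Runs O d s t s' → Runs O (.cond b c d) s (t + 1) s'
  | loopStop {b : Test} {c : Program Q} {s : Mem} :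
      ¬ b.Holds s → Runs O (.loop b c) s 1 s
  | loopStep {b : Test} {c : Program Q} {s s' s'' : Mem} {t t' : ℕ} :
      b.Holds s → Runs O c s t s' → Runs O (.loop b c) s' t' s'' →
      Runs O (.loop b c) s (t + t' + 1) s''
  | call (q : Q) (s : Mem) : Runs O (.call q) s 1 (O q s)

end RAM

/-! ### Input, output and oracles -/

namespace FairDivision

open RAM

open Classical in
/-- The input: the numbers of vertices and of agents in the natural-number cells `(0, 0)` and
`(0, 1)` of array `0`, the adjacency matrix of the graph in array `1`, and the numbers `w v` in row
`0` of the real array `0`. All other cells are zero. -/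
noncomputable def inputMem {m : ℕ} (G : SimpleGraph (Fin m)) (n : ℕ) (w : Fin m → ℝ) : Mem where
  nat := fun a i j =>
    if a = 0 ∧ i = 0 ∧ j = 0 then m
    else if a = 0 ∧ i = 0 ∧ j = 1 then n
    else if a = 1 ∧ ∃ v w : Fin m, (v : ℕ) = i ∧ (w : ℕ) = j ∧ G.Adj v w then 1
    else 0
  real := fun a i j => if h : a = 0 ∧ i = 0 ∧ j < m then w ⟨j, h.2.2⟩ else 0

/-- The output: row `0` of the natural-number array `2` holds, for every vertex, the agent that
receives it. -/
def OutputsAlloc {m n : ℕ} (s : Mem) (A : Fin n → Finset (Fin m)) : Prop :=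
  (∀ v : Fin m, s.nat 2 0 v < n) ∧ ∀ (i : Fin n) (v : Fin m), v ∈ A i ↔ s.nat 2 0 v = i

/-- The two oracle instructions: evaluate the utility of a bundle; find an SMMS allocation. -/
inductive OracleName where
  | utility
  | smms

/-- The vertex set whose indicator vector stands in row `0` of the natural-number array `3`. -/
def querySet (m : ℕ) (s : Mem) : Finset (Fin m) :=
  Finset.univ.filter fun v => s.nat 3 0 v = 1

/-- The oracle `utility` puts the utility of the query set into cell `(0, 0)` of the real array `1`.
The oracle `smms` reads a number `k` of agents from cell `(0, 0)` of the natural-number array `4`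
and puts, for every vertex `v`, the agent `f X k v` into cell `(0, v)` of the natural-number array
`5`, where `X` is the query set. -/
noncomputable def oracles {m : ℕ} (u : Finset (Fin m) → ℝ)
    (f : Finset (Fin m) → ℕ → Fin m → ℕ) : OracleName → Mem → Mem
  | .utility, s => s.setReal 1 0 0 (u (querySet m s))
  | .smms, s =>
      { nat := fun a i j =>
          if h : a = 5 ∧ i = 0 ∧ j < m then f (querySet m s) (s.nat 4 0 0) ⟨j, h.2.2⟩
          else s.nat a i j
        real := s.real }

/-- `f` solves the SMMS problem on the connected induced subgraphs of `G`: for every non-empty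
connected `X` and every `k ≥ 1`, the map `f X k` assigns the vertices of `X` to the agents
`0, …, k - 1`, and this is an SMMS connected allocation of `G[X]`. -/
def SolvesSMMS {m : ℕ} (G : SimpleGraph (Fin m)) (u : Finset (Fin m) → ℝ)
    (f : Finset (Fin m) → ℕ → Fin m → ℕ) : Prop :=
  ∀ (X : Finset (Fin m)) (k : ℕ), X.Nonempty → ConnBundle G X → 0 < k →
    IsSMMS G u X (Finset.univ : Finset (Fin k)) fun i => X.filter fun v => f X k v = i

end FairDivision

-- Correctness. Let `A` be an SMMS allocation with maximin share μ. In a component `C` of the graph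
-- without the losers' bundles, the bundles of the non-losers inside `C` form a connected allocation
-- of `C`, and all of them exceed μ; so the share of `C` for these agents exceeds μ as well. By
-- induction every non-loser finally receives more than μ. The result therefore has exactly the
-- losers of `A`, and it is MMS and SMMS. For PMMS, suppose that the union of two bundles, one of
-- them a loser's, could be split into two pieces that both exceed the bundle of one of the two
-- agents. Both pieces would then exceed μ, and there would be fewer losers (`IsSMMS.pair_le`).
-- Adjacent bundles of two non-losers lie in one component, where induction applies, and an agent
-- with an empty bundle is a loser because `u ∅` is least. This is `LoserRecursion.correct`. Some
-- agent is always a loser, so the recursion ends.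
--
-- Running time. Programs are written in a language `Stm` of bounded loops with the common bound `m
-- + n + 1`. Its semantics `Stm.den` is a total function on memories, and `Stm.comp_spec` translates
-- every statement into a machine program with a polynomial step bound. The recursion is turned into
-- a loop without a stack: `LoopInv` says that whatever completes the components of the unfinished
-- vertices completes the whole run. A round handles one component and finishes at least one agent,
-- so more than `n` rounds are never needed. The loop is parametrised by a subroutine that finds
-- SMMS allocations (`SolvesQueries`), which either calls the oracles or treats trees.
--
-- Trees. Eliminating leaves one by one roots the tree. A family of disjoint connected bundles
-- becomes a set of cuts, the tops of the bundles. For a threshold μ and a bound `l` on the number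
-- of parts of weight exactly μ (the light parts), the dynamic program `Rooted.dp` keeps the
-- lexicographically largest pair of a number of closed parts and an open weight. Lexicographic
-- order is right because an open weight is worth at most one further part (`LexLE.close`). At the
-- sink the table holds the maximal number of parts (`Rooted.card_le_dp`,
-- `Rooted.exists_card_eq_dp`).
--
-- The share is approached from below. Starting with μ = 0, as long as `k` parts strictly heavier
-- than μ exist, μ is raised to the least weight above μ that the greedy run closes;
-- `Rooted.potential_lt` bounds the number of raises by a square. If the final μ is positive, the
-- least number of losers is the least `l` that admits `k` parts; if μ = 0, one maximises the number
-- of parts of positive weight. An inclusion-minimal set of allowed cuts with the required table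
-- value is itself an optimal set of cuts (`Rooted.minimal_cuts`), and labelling its parts gives an
-- SMMS allocation (`Describes.isSMMS`).

set_option linter.unusedSectionVars false

/-! ### A language of bounded loops and its compilation -/

namespace RAM

/-- The least `i < N` with `p i`, or `N` if there is none. -/
noncomputable def firstIdx (p : ℕ → Prop) : ℕ → ℕ
  | 0 => 0
  | N + 1 => open Classical in
      if firstIdx p N = N ∧ ¬ p N then N + 1 else firstIdx p N

theorem firstIdx_le (p : ℕ → Prop) (N : ℕ) : firstIdx p N ≤ N := by
  induction N with
  | zero => simp [firstIdx]
  | succ N ih => simp only [firstIdx]; split_ifs <;> omega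

theorem firstIdx_spec {p : ℕ → Prop} {N : ℕ} (h : firstIdx p N < N) : p (firstIdx p N) := by
  induction N with
  | zero => omega
  | succ N ih =>
    simp only [firstIdx] at h ⊢
    split_ifs at h ⊢ with h'
    · omega
    · rcases lt_or_eq_of_le (firstIdx_le p N) with h1 | h1
      · exact ih h1
      · rw [h1] at h' ⊢; simpa using h'

theorem not_of_lt_firstIdx {p : ℕ → Prop} {N i : ℕ} (h : i < firstIdx p N) : ¬ p i := by
  induction N with
  | zero => simp [firstIdx] at h
  | succ N ih =>
    simp only [firstIdx] at h
    split_ifs at h with h'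
    · rcases Nat.lt_succ_iff_lt_or_eq.1 h with h1 | rfl
      · exact ih (by omega)
      · exact h'.2
    · exact ih h

theorem firstIdx_lt_iff {p : ℕ → Prop} {N : ℕ} : firstIdx p N < N ↔ ∃ i < N, p i := by
  constructor
  · exact fun h => ⟨_, h, firstIdx_spec h⟩
  · rintro ⟨i, hi, hp⟩
    by_contra h
    exact not_of_lt_firstIdx (show i < firstIdx p N by omega) hp

mutual
/-- Expressions for natural numbers with named variables; `bound` is the common bound of all
loops. -/
inductive NEx where
  | const (k : ℕ)
  | bound
  | var (x : ℕ)
  | cell (a : ℕ) (i j : NEx)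
  | add (e f : NEx)
  | sub (e f : NEx)
  | ite (b : BEx) (e f : NEx)
  | sum (x : ℕ) (e : NEx)
  | first (x : ℕ) (b : BEx)

/-- Expressions for real numbers. -/
inductive REx where
  | zero
  | cell (a : ℕ) (i j : NEx)
  | add (e f : REx)
  | sub (e f : REx)
  | ite (b : BEx) (e f : REx)
  | sum (x : ℕ) (e : REx)

/-- Conditions. -/
inductive BEx where
  | nlt (e f : NEx)
  | rlt (e f : REx)
  | not (b : BEx)
  | and (b c : BEx)
end

open Classical in
mutual
noncomputable def NEx.val (N : ℕ) (σ : Mem) : (ℕ → ℕ) → NEx → ℕ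
  | _, .const k => k
  | _, .bound => N
  | ε, .var x => ε x
  | ε, .cell a i j => σ.nat a (i.val N σ ε) (j.val N σ ε)
  | ε, .add e f => e.val N σ ε + f.val N σ ε
  | ε, .sub e f => e.val N σ ε - f.val N σ ε
  | ε, .ite b e f => if b.Holds N σ ε then e.val N σ ε else f.val N σ ε
  | ε, .sum x e => ∑ i ∈ Finset.range N, e.val N σ (Function.update ε x i)
  | ε, .first x b => firstIdx (fun i => b.Holds N σ (Function.update ε x i)) N

noncomputable def REx.val (N : ℕ) (σ : Mem) : (ℕ → ℕ) → REx → ℝ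
  | _, .zero => 0
  | ε, .cell a i j => σ.real a (i.val N σ ε) (j.val N σ ε)
  | ε, .add e f => e.val N σ ε + f.val N σ ε
  | ε, .sub e f => e.val N σ ε - f.val N σ ε
  | ε, .ite b e f => if b.Holds N σ ε then e.val N σ ε else f.val N σ ε
  | ε, .sum x e => ∑ i ∈ Finset.range N, e.val N σ (Function.update ε x i)

noncomputable def BEx.Holds (N : ℕ) (σ : Mem) : (ℕ → ℕ) → BEx → Prop
  | ε, .nlt e f => e.val N σ ε < f.val N σ ε
  | ε, .rlt e f => e.val N σ ε < f.val N σ ε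
  | ε, .not b => ¬ b.Holds N σ ε
  | ε, .and b c => b.Holds N σ ε ∧ c.Holds N σ ε
end

/-- Array `a` of an abstract memory is stored in array `arr a`. The arrays `6, …, 9` hold the loop
bound, the variables, the intermediate results and a buffer. -/
def arr (a : ℕ) : ℕ := if a < 6 then a else a + 4

theorem arr_ne (a : ℕ) : arr a ≠ 6 ∧ arr a ≠ 7 ∧ arr a ≠ 8 ∧ arr a ≠ 9 := by
  unfold arr; split_ifs <;> omega

theorem arr_inj {a b : ℕ} : arr a = arr b ↔ a = b := by
  unfold arr; split_ifs <;> omega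

variable {Q : Type}

/-- The `k`-th intermediate result. -/
def tmp (k : ℕ) : NExpr := .cell 8 (.const k) (.const 0)
def rtmp (k : ℕ) : RExpr := .cell 8 (.const k) (.const 0)
def vcell (x : ℕ) : NExpr := .cell 7 (.const x) (.const 0)
def setTmp (k : ℕ) (e : NExpr) : Program Q := .setNat 8 (.const k) (.const 0) e
def setRTmp (k : ℕ) (e : RExpr) : Program Q := .setReal 8 (.const k) (.const 0) e
def setVar (x : ℕ) (e : NExpr) : Program Q := .setNat 7 (.const x) (.const 0) e

/-- Counting loop over the cell `(r, 0)` of array `a`. -/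
def countLoop (a r : ℕ) (c : Program Q) : Program Q :=
  .loop (.nlt (.cell a (.const r) (.const 0)) (.cell 6 (.const 0) (.const 0)))
    (.seq c (.setNat a (.const r) (.const 0)
      (.add (.cell a (.const r) (.const 0)) (.const 1))))

/-- Loop over the variable `x`, whose old value is saved in `tmp k`. -/
def varLoop (x k : ℕ) (c : Program Q) : Program Q :=
  .seq (setTmp k (vcell x)) (.seq (setVar x (.const 0))
    (.seq (countLoop 7 x c) (setVar x (tmp k))))

mutual
-- Stack discipline: the result goes to `tmp k`, and only the slots from `k` on may be destroyed. A
-- second operand is therefore compiled at `k + 1`; in a loop, slot `k` is the accumulator, slot `k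
-- + 1` saves the loop variable, and the body works from `k + 2`.
def NEx.comp (k : ℕ) : NEx → Program Q
  | .const c => setTmp k (.const c)
  | .bound => setTmp k (.cell 6 (.const 0) (.const 0))
  | .var x => setTmp k (vcell x)
  | .cell a i j => .seq (i.comp k) (.seq (j.comp (k + 1))
      (setTmp k (.cell (arr a) (tmp k) (tmp (k + 1)))))
  | .add e f => .seq (e.comp k) (.seq (f.comp (k + 1)) (setTmp k (.add (tmp k) (tmp (k + 1)))))
  | .sub e f => .seq (e.comp k) (.seq (f.comp (k + 1)) (setTmp k (.sub (tmp k) (tmp (k + 1)))))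
  | .ite b e f => .seq (b.comp k) (.cond (.nlt (.const 0) (tmp k)) (e.comp k) (f.comp k))
  | .sum x e => .seq (setTmp k (.const 0)) (varLoop x (k + 1)
      (.seq (e.comp (k + 2)) (setTmp k (.add (tmp k) (tmp (k + 2))))))
  | .first x b => .seq (setTmp k (.const 0)) (varLoop x (k + 1)
      (.seq (b.comp (k + 2))
        -- Before the first hit the accumulator equals the loop variable, and a failed test moves it
        -- one further. After a hit it stays below the variable and is never changed again.
        (.cond (.and (.not (.nlt (.const 0) (tmp (k + 2)))) (.not (.nlt (tmp k) (vcell x))))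
          (setTmp k (.add (vcell x) (.const 1))) .skip)))

def REx.comp (k : ℕ) : REx → Program Q
  | .zero => setRTmp k .zero
  | .cell a i j => .seq (i.comp k) (.seq (j.comp (k + 1))
      (setRTmp k (.cell (arr a) (tmp k) (tmp (k + 1)))))
  | .add e f => .seq (e.comp k) (.seq (f.comp (k + 1)) (setRTmp k (.add (rtmp k) (rtmp (k + 1)))))
  | .sub e f => .seq (e.comp k) (.seq (f.comp (k + 1)) (setRTmp k (.sub (rtmp k) (rtmp (k + 1)))))
  | .ite b e f => .seq (b.comp k) (.cond (.nlt (.const 0) (tmp k)) (e.comp k) (f.comp k))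
  | .sum x e => .seq (setRTmp k .zero) (varLoop x (k + 1)
      (.seq (e.comp (k + 2)) (setRTmp k (.add (rtmp k) (rtmp (k + 2))))))

def BEx.comp (k : ℕ) : BEx → Program Q
  | .nlt e f => .seq (e.comp k) (.seq (f.comp (k + 1))
      (.cond (.nlt (tmp k) (tmp (k + 1))) (setTmp k (.const 1)) (setTmp k (.const 0))))
  | .rlt e f => .seq (e.comp k) (.seq (f.comp (k + 1))
      (.cond (.rlt (rtmp k) (rtmp (k + 1))) (setTmp k (.const 1)) (setTmp k (.const 0))))
  | .not b => .seq (b.comp k) (setTmp k (.sub (.const 1) (tmp k)))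
  | .and b c => .seq (b.comp k) (.seq (c.comp (k + 1))
      (.cond (.nlt (.const 0) (tmp k)) (setTmp k (tmp (k + 1))) .skip))
end

/-- `s'` agrees with `s` except for intermediate results from the `k`-th on. -/
structure Frame (k : ℕ) (s s' : Mem) : Prop where
  nat : ∀ a i j, (a = 8 → i < k) → s'.nat a i j = s.nat a i j
  real : ∀ a i j, (a = 8 → i < k) → s'.real a i j = s.real a i j

theorem Frame.refl (k : ℕ) (s : Mem) : Frame k s s := ⟨fun _ _ _ _ => rfl, fun _ _ _ _ => rfl⟩

theorem Frame.trans {k l : ℕ} {s s' s'' : Mem} (hkl : k ≤ l) (h : Frame k s s')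
    (h' : Frame l s' s'') : Frame k s s'' where
  nat a i j hi := by rw [h'.nat a i j (by omega), h.nat a i j hi]
  real a i j hi := by rw [h'.real a i j (by omega), h.real a i j hi]

theorem Frame.weaken {k l : ℕ} {s s' : Mem} (h : Frame l s s') (hkl : k ≤ l) : Frame k s s' :=
  ⟨fun _ _ _ hi => h.nat _ _ _ (by omega), fun _ _ _ hi => h.real _ _ _ (by omega)⟩

/-- The memory `s` represents the abstract memory `σ`, the loop bound `N` and the variables `ε`. -/
structure Rep (N : ℕ) (σ : Mem) (ε : ℕ → ℕ) (s : Mem) : Prop where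
  bound : s.nat 6 0 0 = N
  var : ∀ x, s.nat 7 x 0 = ε x
  nat : ∀ a i j, s.nat (arr a) i j = σ.nat a i j
  real : ∀ a i j, s.real (arr a) i j = σ.real a i j

theorem Rep.frame {N k : ℕ} {σ s s' : Mem} {ε : ℕ → ℕ} (h : Rep N σ ε s) (hf : Frame k s s') :
    Rep N σ ε s' where
  bound := by rw [hf.nat _ _ _ (by omega), h.bound]
  var x := by rw [hf.nat _ _ _ (by omega), h.var]
  nat a i j := by rw [hf.nat _ _ _ (fun h => absurd h (arr_ne a).2.2.1), h.nat]
  real a i j := by rw [hf.real _ _ _ (fun h => absurd h (arr_ne a).2.2.1), h.real]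

-- Correctness and running time of compiled expressions

section

variable {O : Q → Mem → Mem}

/-- Each pass costs the body, one increment and one test; the final `1` is the failing test. The
invariant is required after the increment, so it may speak about the counter itself. -/
theorem runs_countLoop {a r N T : ℕ} {c : Program Q} (I : ℕ → Mem → Prop)
    (hc : ∀ i s, I i s → s.nat a r 0 = i ∧ s.nat 6 0 0 = N)
    (step : ∀ i < N, ∀ s, I i s → ∃ t s', Runs O c s t s' ∧ t ≤ T ∧
      I (i + 1) (s'.setNat a r 0 (s'.nat a r 0 + 1)))
    {s : Mem} (h0 : I 0 s) :
    ∃ t s', Runs O (countLoop a r c) s t s' ∧ t ≤ N * (T + 2) + 1 ∧ I N s' := by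
  have key : ∀ d i s, i + d = N → I i s →
      ∃ t s', Runs O (countLoop a r c) s t s' ∧ t ≤ d * (T + 2) + 1 ∧ I N s' := by
    intro d
    induction d with
    | zero =>
      intro i s hi h
      obtain ⟨h1, h2⟩ := hc i s h
      refine ⟨1, s, .loopStop ?_, by omega, ?_⟩
      · simp only [Test.Holds, NExpr.eval, h1, h2]; omega
      · rwa [← hi]
    | succ d ih =>
      intro i s hi h
      obtain ⟨h1, h2⟩ := hc i s h
      obtain ⟨t, s', hr, ht, h'⟩ := step i (by omega) s h
      obtain ⟨t', s'', hr', ht', h''⟩ := ih (i + 1) _ (by omega) h'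
      refine ⟨(t + 1) + t' + 1, s'', .loopStep ?_ (.seq hr (.setNat _ _ _ _ _)) hr', ?_, h''⟩
      · simp only [Test.Holds, NExpr.eval, h1, h2]; omega
      · rw [Nat.add_mul]; omega
  exact key N 0 s (by omega) h0

/-- Nested loops may use the same variable, so the old value of `x` is saved in slot `k` and
restored. This is why `J` must ignore `x` and the body must preserve slot `k`. -/
theorem runs_varLoop {x k N T : ℕ} {c : Program Q} {s : Mem} (hN : s.nat 6 0 0 = N)
    (J : ℕ → Mem → Prop) (hJ : ∀ i s v, J i s → J i (s.setNat 7 x 0 v))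
    (h0 : J 0 (s.setNat 8 k 0 (s.nat 7 x 0)))
    (step : ∀ i < N, ∀ s', J i s' → s'.nat 7 x 0 = i → s'.nat 6 0 0 = N →
      ∃ t s'', Runs O c s' t s'' ∧ t ≤ T ∧ J (i + 1) s'' ∧ s''.nat 7 x 0 = i ∧
        s''.nat 6 0 0 = N ∧ s''.nat 8 k 0 = s'.nat 8 k 0) :
    ∃ t s', Runs O (varLoop x k c) s t s' ∧ t ≤ N * (T + 2) + 4 ∧ J N s' ∧
      s'.nat 7 x 0 = s.nat 7 x 0 := by
  obtain ⟨t, s', hr, ht, h1, h2, h3, h4⟩ := runs_countLoop (O := O) (a := 7) (r := x) (N := N)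
    (T := T) (c := c)
    (fun i s' => J i s' ∧ s'.nat 7 x 0 = i ∧ s'.nat 6 0 0 = N ∧ s'.nat 8 k 0 = s.nat 7 x 0)
    (fun i s h => ⟨h.2.1, h.2.2.1⟩)
    (by
      rintro i hi s' ⟨h1, h2, h3, h4⟩
      obtain ⟨t, s'', hr, ht, h1', h2', h3', h4'⟩ := step i hi s' h1 h2 h3
      exact ⟨t, s'', hr, ht, hJ _ _ _ h1', by simp [Mem.setNat, h2'], by simp [Mem.setNat, h3'],
        by simp [Mem.setNat, h4', h4]⟩)
    (s := (s.setNat 8 k 0 (s.nat 7 x 0)).setNat 7 x 0 0)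
    ⟨hJ _ _ _ h0, by simp [Mem.setNat], by simp [Mem.setNat, hN], by simp [Mem.setNat]⟩
  refine ⟨1 + (1 + (t + 1)), s'.setNat 7 x 0 (s'.nat 8 k 0), ?_, by omega, hJ _ _ _ h1,
    by simp [Mem.setNat, h4]⟩
  exact .seq (.setNat _ _ _ _ _) (.seq (.setNat _ _ _ _ _) (.seq hr (.setNat _ _ _ _ _)))

/-- `s'` agrees with `s` except for the variable `x` and for intermediate results from the `k`-th
on. -/
structure VFrame (k x : ℕ) (s s' : Mem) : Prop where
  nat : ∀ a i j, (a = 8 → i < k) → (a = 7 → i = x → j ≠ 0) → s'.nat a i j = s.nat a i j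
  real : ∀ a i j, (a = 8 → i < k) → s'.real a i j = s.real a i j

theorem Frame.vframe {k l x : ℕ} {s s' : Mem} (h : Frame l s s') (hkl : k ≤ l) : VFrame k x s s' :=
  ⟨fun _ _ _ hi _ => h.nat _ _ _ (by omega), fun _ _ _ hi => h.real _ _ _ (by omega)⟩

theorem VFrame.trans {k x : ℕ} {s s' s'' : Mem} (h : VFrame k x s s') (h' : VFrame k x s' s'') :
    VFrame k x s s'' where
  nat a i j hi hx := by rw [h'.nat a i j hi hx, h.nat a i j hi hx]
  real a i j hi := by rw [h'.real a i j hi, h.real a i j hi]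

theorem VFrame.setVar {k x v : ℕ} {s s' : Mem} (h : VFrame k x s s') :
    VFrame k x s (s'.setNat 7 x 0 v) where
  nat a i j hi hx := by
    rw [← h.nat a i j hi hx]
    simp only [Mem.setNat]
    rw [if_neg]; rintro ⟨rfl, rfl, rfl⟩; simp at hx
  real a i j hi := h.real a i j hi

theorem VFrame.frame {k x : ℕ} {s s' : Mem} (h : VFrame k x s s')
    (hx : s'.nat 7 x 0 = s.nat 7 x 0) : Frame k s s' where
  nat a i j hi := by
    by_cases h' : a = 7 ∧ i = x ∧ j = 0
    · obtain ⟨rfl, rfl, rfl⟩ := h'; exact hx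
    · exact h.nat a i j hi (by tauto)
  real := h.real

theorem frame_setNat {k l j v : ℕ} {s : Mem} (hl : k ≤ l) : Frame k s (s.setNat 8 l j v) where
  nat a i j hi := by
    simp only [Mem.setNat]; rw [if_neg]; rintro ⟨rfl, rfl, rfl⟩; have := hi rfl; omega
  real _ _ _ _ := rfl

theorem frame_setReal {k l j : ℕ} {v : ℝ} {s : Mem} (hl : k ≤ l) :
    Frame k s (s.setReal 8 l j v) where
  real a i j hi := by
    simp only [Mem.setReal]; rw [if_neg]; rintro ⟨rfl, rfl, rfl⟩; have := hi rfl; omega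
  nat _ _ _ _ := rfl

theorem Rep.vframe {N k x i : ℕ} {σ s s' : Mem} {ε : ℕ → ℕ} (h : Rep N σ ε s)
    (hf : VFrame k x s s') (hi : s'.nat 7 x 0 = i) : Rep N σ (Function.update ε x i) s' where
  bound := by rw [hf.nat _ _ _ (by omega) (by omega), h.bound]
  var y := by
    by_cases hy : y = x
    · subst hy; simp [hi]
    · rw [hf.nat _ _ _ (by omega) (by tauto), h.var, Function.update_of_ne hy]
  nat a i j := by
    rw [hf.nat _ _ _ (fun h => absurd h (arr_ne a).2.2.1) (fun h => absurd h (arr_ne a).2.1), h.nat]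
  real a i j := by rw [hf.real _ _ _ (fun h => absurd h (arr_ne a).2.2.1), h.real]

/-- The loop of a sum or a search: the accumulator is described by `Acc`, which depends on the
`k`-th intermediate results only. -/
theorem runs_accLoop {N T k x : ℕ} {σ s : Mem} {ε : ℕ → ℕ} {c : Program Q} (h : Rep N σ ε s)
    (Acc : ℕ → ℕ → ℝ → Prop) (h0 : Acc 0 (s.nat 8 k 0) (s.real 8 k 0))
    (step : ∀ i < N, ∀ s', Rep N σ (Function.update ε x i) s' →
      Acc i (s'.nat 8 k 0) (s'.real 8 k 0) →
      ∃ t s'', Runs O c s' t s'' ∧ t ≤ T ∧ Frame k s' s'' ∧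
        s''.nat 8 (k + 1) 0 = s'.nat 8 (k + 1) 0 ∧ Acc (i + 1) (s''.nat 8 k 0) (s''.real 8 k 0)) :
    ∃ t s', Runs O (varLoop x (k + 1) c) s t s' ∧ t ≤ N * (T + 2) + 4 ∧ Frame k s s' ∧
      Acc N (s'.nat 8 k 0) (s'.real 8 k 0) := by
  obtain ⟨t, s', hr, ht, ⟨h1, h2⟩, h3⟩ := runs_varLoop (O := O) (x := x) (k := k + 1) (c := c)
    (T := T) h.bound
    (fun i s' => VFrame k x s s' ∧ Acc i (s'.nat 8 k 0) (s'.real 8 k 0))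
    (fun i s' v h' => ⟨h'.1.setVar, by simpa [Mem.setNat] using h'.2⟩)
    ⟨(frame_setNat (by omega)).vframe le_rfl, by simpa [Mem.setNat] using h0⟩
    (by
      rintro i hi s' ⟨h1, h2⟩ h3 h4
      obtain ⟨t, s'', hr, ht, hf, hk, ha⟩ := step i hi s' (h.vframe h1 h3) h2
      exact ⟨t, s'', hr, ht, ⟨h1.trans (hf.vframe le_rfl), ha⟩,
        by rw [hf.nat _ _ _ (by omega), h3], by rw [hf.nat _ _ _ (by omega), h4], hk⟩)
  exact ⟨t, s', hr, ht, h1.frame h3, h2⟩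

theorem runs_ite {k t t' : ℕ} {s s' s'' : Mem} {b c d : Program Q} (p : Prop) [Decidable p]
    (hb : Runs O b s t s') (hv : s'.nat 8 k 0 = if p then 1 else 0)
    (hc : p → Runs O c s' t' s'') (hd : ¬ p → Runs O d s' t' s'') :
    Runs O (.seq b (.cond (.nlt (.const 0) (tmp k)) c d)) s (t + (t' + 1)) s'' := by
  refine .seq hb ?_
  by_cases hp : p
  · exact .condTrue (by simp [Test.Holds, NExpr.eval, tmp, hv, hp]) (hc hp)
  · exact .condFalse (by simp [Test.Holds, NExpr.eval, tmp, hv, hp]) (hd hp)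

open Polynomial

/-- A piece of code that computes the value `v` from the represented memory. -/
def Computes (cmp : ℕ → Program Q) (p : ℕ[X]) (O : Q → Mem → Mem) (N : ℕ) (σ : Mem) (ε : ℕ → ℕ)
    (post : ℕ → ℝ → Prop) : Prop :=
  ∀ k s, Rep N σ ε s → ∃ t s', Runs O (cmp k) s t s' ∧ t ≤ p.eval N ∧ Frame k s s' ∧
    post (s'.nat 8 k 0) (s'.real 8 k 0)

/-- The first value survives the second computation, since that one only touches the slots from `k +
1` on. The `2` covers both ways to finish: a single assignment, or a test followed by an
instruction. -/
theorem Computes.two {N : ℕ} {σ : Mem} {ε : ℕ → ℕ} {c d : ℕ → Program Q} {p q : ℕ[X]}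
    {P R : ℕ → ℝ → Prop} (hc : Computes c p O N σ ε P) (hd : Computes d q O N σ ε R)
    {fin : ℕ → Program Q} {post : ℕ → ℝ → Prop}
    (hf : ∀ k s, P (s.nat 8 k 0) (s.real 8 k 0) → R (s.nat 8 (k + 1) 0) (s.real 8 (k + 1) 0) →
      Rep N σ ε s →
      ∃ t s', Runs O (fin k) s t s' ∧ t ≤ 2 ∧ Frame k s s' ∧ post (s'.nat 8 k 0) (s'.real 8 k 0)) :
    Computes (fun k => .seq (c k) (.seq (d (k + 1)) (fin k))) (p + q + 2) O N σ ε post := by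
  intro k s h
  obtain ⟨t1, s1, r1, l1, f1, v1⟩ := hc k s h
  obtain ⟨t2, s2, r2, l2, f2, v2⟩ := hd (k + 1) s1 (h.frame f1)
  obtain ⟨t3, s3, r3, l3, f3, v3⟩ := hf k s2
    (by rwa [f2.nat _ _ _ (by omega), f2.real _ _ _ (by omega)]) v2
    ((h.frame f1).frame f2)
  refine ⟨t1 + (t2 + t3), s3, .seq r1 (.seq r2 r3), ?_,
    (f1.trans (Nat.le_succ k) f2).trans le_rfl f3, v3⟩
  simp only [Polynomial.eval_add, Polynomial.eval_ofNat]; omega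

open Classical in
mutual
-- The polynomial depends on the expression alone: a loop multiplies the cost by the bound `N`, and
-- the nesting depth of loops is fixed by the text.
theorem NEx.comp_spec : ∀ e : NEx, ∃ p : ℕ[X], ∀ (Q : Type) (O : Q → Mem → Mem) N σ ε,
    Computes (Q := Q) (fun k => e.comp k) p O N σ ε fun x _ => x = e.val N σ ε
  | .const c => ⟨1, fun Q O N σ ε k s h => ⟨1, _, .setNat _ _ _ _ _, by simp,
      frame_setNat le_rfl, by simp [Mem.setNat, NExpr.eval, NEx.val]⟩⟩
  | .bound => ⟨1, fun Q O N σ ε k s h => ⟨1, _, .setNat _ _ _ _ _, by simp,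
      frame_setNat le_rfl, by simp [Mem.setNat, NExpr.eval, NEx.val, h.bound]⟩⟩
  | .var x => ⟨1, fun Q O N σ ε k s h => ⟨1, _, .setNat _ _ _ _ _, by simp,
      frame_setNat le_rfl, by simp [Mem.setNat, NExpr.eval, NEx.val, h.var, vcell]⟩⟩
  | .cell a i j => by
    obtain ⟨p, hp⟩ := i.comp_spec
    obtain ⟨q, hq⟩ := j.comp_spec
    refine ⟨p + q + 2, fun Q O N σ ε => (hp Q O N σ ε).two (hq Q O N σ ε) ?_⟩
    exact fun k s h1 h2 h => ⟨1, _, .setNat _ _ _ _ _, by omega, frame_setNat le_rfl,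
      by simp [Mem.setNat, NExpr.eval, NEx.val, tmp, h1, h2, h.nat]⟩
  | .add e f => by
    obtain ⟨p, hp⟩ := e.comp_spec
    obtain ⟨q, hq⟩ := f.comp_spec
    refine ⟨p + q + 2, fun Q O N σ ε => (hp Q O N σ ε).two (hq Q O N σ ε) ?_⟩
    exact fun k s h1 h2 h => ⟨1, _, .setNat _ _ _ _ _, by omega, frame_setNat le_rfl,
      by simp [Mem.setNat, NExpr.eval, NEx.val, tmp, h1, h2]⟩
  | .sub e f => by
    obtain ⟨p, hp⟩ := e.comp_spec
    obtain ⟨q, hq⟩ := f.comp_spec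
    refine ⟨p + q + 2, fun Q O N σ ε => (hp Q O N σ ε).two (hq Q O N σ ε) ?_⟩
    exact fun k s h1 h2 h => ⟨1, _, .setNat _ _ _ _ _, by omega, frame_setNat le_rfl,
      by simp [Mem.setNat, NExpr.eval, NEx.val, tmp, h1, h2]⟩
  | .ite b e f => by
    obtain ⟨r, hr⟩ := b.comp_spec
    obtain ⟨p, hp⟩ := e.comp_spec
    obtain ⟨q, hq⟩ := f.comp_spec
    refine ⟨r + p + q + 1, fun Q O N σ ε k s h => ?_⟩
    obtain ⟨t, s1, r1, l1, f1, v1⟩ := hr Q O N σ ε k s h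
    by_cases hb : b.Holds N σ ε
    · obtain ⟨t2, s2, r2, l2, f2, v2⟩ := hp Q O N σ ε k s1 (h.frame f1)
      refine ⟨_, s2, runs_ite _ r1 v1 (fun _ => r2) (fun h => absurd hb h), ?_,
        f1.trans le_rfl f2, by simp [NEx.val, hb, v2]⟩
      simp only [eval_add, eval_one]; omega
    · obtain ⟨t2, s2, r2, l2, f2, v2⟩ := hq Q O N σ ε k s1 (h.frame f1)
      refine ⟨_, s2, runs_ite _ r1 v1 (fun h => absurd h hb) (fun _ => r2), ?_,
        f1.trans le_rfl f2, by simp [NEx.val, hb, v2]⟩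
      simp only [eval_add, eval_one]; omega
  | .sum x e => by
    obtain ⟨p, hp⟩ := e.comp_spec
    -- Per pass: the body, one accumulation, and an increment with its test. The `5` consists of the
    -- overhead of `varLoop` and the initialisation of the accumulator.
    refine ⟨X * (p + 1 + 2) + 5, fun Q O N σ ε k s h => ?_⟩
    obtain ⟨t, s', hr, ht, hf, hv⟩ := runs_accLoop (O := O) (x := x) (k := k)
      (c := .seq (e.comp (k + 2)) (setTmp k (.add (tmp k) (tmp (k + 2))))) (T := p.eval N + 1)
      (h.frame (frame_setNat (k := k) (l := k) (j := 0) (v := 0) le_rfl))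
      (fun i a _ => a = ∑ i ∈ Finset.range i, e.val N σ (Function.update ε x i))
      (by simp [Mem.setNat])
      (by
        intro i hi s' h' ha
        obtain ⟨t, s'', r1, l1, f1, v1⟩ := hp Q O N σ _ (k + 2) s' h'
        refine ⟨t + 1, _, .seq r1 (.setNat _ _ _ _ _), by omega,
          (f1.weaken (by omega)).trans le_rfl (frame_setNat le_rfl), ?_, ?_⟩
        · simp [Mem.setNat, NExpr.eval, f1.nat 8 (k + 1) 0 (by omega)]
        · simp [Mem.setNat, NExpr.eval, tmp, v1, f1.nat 8 k 0 (by omega), ha,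
            Finset.sum_range_succ])
    refine ⟨1 + t, s', .seq (.setNat _ _ _ _ _) hr, ?_, (frame_setNat le_rfl).trans le_rfl hf, ?_⟩
    · simp only [eval_add, eval_mul, eval_X, eval_one, eval_ofNat]; omega
    · simp [NEx.val, hv]
  | .first x b => by
    obtain ⟨p, hp⟩ := b.comp_spec
    refine ⟨X * (p + 2 + 2) + 5, fun Q O N σ ε k s h => ?_⟩
    obtain ⟨t, s', hr, ht, hf, hv⟩ := runs_accLoop (O := O) (x := x) (k := k)
      (c := .seq (b.comp (k + 2))
        (.cond (.and (.not (.nlt (.const 0) (tmp (k + 2)))) (.not (.nlt (tmp k) (vcell x))))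
          (setTmp k (.add (vcell x) (.const 1))) .skip)) (T := p.eval N + 2)
      (h.frame (frame_setNat (k := k) (l := k) (j := 0) (v := 0) le_rfl))
      (fun i a _ => a = firstIdx (fun i => b.Holds N σ (Function.update ε x i)) i)
      (by simp [Mem.setNat, firstIdx])
      (by
        intro i hi s' h' ha
        obtain ⟨t, s'', r1, l1, f1, v1⟩ := hp Q O N σ _ (k + 2) s' h'
        have hk : s''.nat 8 k 0 = _ := (f1.nat 8 k 0 (by omega)).trans ha
        have hx : s''.nat 7 x 0 = i := by rw [(h'.frame f1).var]; simp
        have hle := firstIdx_le (fun i => b.Holds N σ (Function.update ε x i)) i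
        have f2 : Frame k s' s'' := f1.weaken (by omega)
        by_cases hb : ¬ b.Holds N σ (Function.update ε x i) ∧ i ≤ s''.nat 8 k 0
        · refine ⟨t + (1 + 1), _, .seq r1 (.condTrue ?_ (.setNat _ _ _ _ _)), by omega,
            f2.trans le_rfl (frame_setNat le_rfl), ?_, ?_⟩
          · simp [Test.Holds, NExpr.eval, tmp, vcell, v1, hb.1, hx, hb.2]
          · simp [Mem.setNat, NExpr.eval, f1.nat 8 (k + 1) 0 (by omega)]
          · simp only [Mem.setNat, NExpr.eval, and_self, if_true, hx, vcell, firstIdx]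
            rw [if_pos ⟨by omega, hb.1⟩]
        · refine ⟨t + (1 + 1), _, .seq r1 (.condFalse ?_ (.skip _)), by omega,
            f2, f1.nat 8 (k + 1) 0 (by omega), ?_⟩
          · intro hc
            simp only [Test.Holds, NExpr.eval, tmp, vcell, v1, hx, not_lt] at hc
            refine hb ⟨fun h => ?_, hc.2⟩
            simp [h] at hc
          · rw [hk]; simp only [firstIdx]
            rw [if_neg]; rintro ⟨h1, h2⟩; exact hb ⟨h2, by omega⟩)
    refine ⟨1 + t, s', .seq (.setNat _ _ _ _ _) hr, ?_, (frame_setNat le_rfl).trans le_rfl hf, ?_⟩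
    · simp only [eval_add, eval_mul, eval_X, eval_ofNat]; omega
    · simp [NEx.val, hv]

theorem REx.comp_spec : ∀ e : REx, ∃ p : ℕ[X], ∀ (Q : Type) (O : Q → Mem → Mem) N σ ε,
    Computes (Q := Q) (fun k => e.comp k) p O N σ ε fun _ y => y = e.val N σ ε
  | .zero => ⟨1, fun Q O N σ ε k s h => ⟨1, _, .setReal _ _ _ _ _, by simp,
      frame_setReal le_rfl, by simp [Mem.setReal, NExpr.eval, RExpr.eval, REx.val]⟩⟩
  | .cell a i j => by
    obtain ⟨p, hp⟩ := i.comp_spec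
    obtain ⟨q, hq⟩ := j.comp_spec
    refine ⟨p + q + 2, fun Q O N σ ε => (hp Q O N σ ε).two (hq Q O N σ ε) ?_⟩
    exact fun k s h1 h2 h => ⟨1, _, .setReal _ _ _ _ _, by omega, frame_setReal le_rfl,
      by simp [Mem.setReal, NExpr.eval, RExpr.eval, REx.val, tmp, h1, h2, h.real]⟩
  | .add e f => by
    obtain ⟨p, hp⟩ := e.comp_spec
    obtain ⟨q, hq⟩ := f.comp_spec
    refine ⟨p + q + 2, fun Q O N σ ε => (hp Q O N σ ε).two (hq Q O N σ ε) ?_⟩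
    exact fun k s h1 h2 h => ⟨1, _, .setReal _ _ _ _ _, by omega, frame_setReal le_rfl,
      by simp [Mem.setReal, NExpr.eval, RExpr.eval, REx.val, rtmp, h1, h2]⟩
  | .sub e f => by
    obtain ⟨p, hp⟩ := e.comp_spec
    obtain ⟨q, hq⟩ := f.comp_spec
    refine ⟨p + q + 2, fun Q O N σ ε => (hp Q O N σ ε).two (hq Q O N σ ε) ?_⟩
    exact fun k s h1 h2 h => ⟨1, _, .setReal _ _ _ _ _, by omega, frame_setReal le_rfl,
      by simp [Mem.setReal, NExpr.eval, RExpr.eval, REx.val, rtmp, h1, h2]⟩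
  | .ite b e f => by
    obtain ⟨r, hr⟩ := b.comp_spec
    obtain ⟨p, hp⟩ := e.comp_spec
    obtain ⟨q, hq⟩ := f.comp_spec
    refine ⟨r + p + q + 1, fun Q O N σ ε k s h => ?_⟩
    obtain ⟨t, s1, r1, l1, f1, v1⟩ := hr Q O N σ ε k s h
    by_cases hb : b.Holds N σ ε
    · obtain ⟨t2, s2, r2, l2, f2, v2⟩ := hp Q O N σ ε k s1 (h.frame f1)
      refine ⟨_, s2, runs_ite _ r1 v1 (fun _ => r2) (fun h => absurd hb h), ?_,
        f1.trans le_rfl f2, by simp [REx.val, hb, v2]⟩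
      simp only [eval_add, eval_one]; omega
    · obtain ⟨t2, s2, r2, l2, f2, v2⟩ := hq Q O N σ ε k s1 (h.frame f1)
      refine ⟨_, s2, runs_ite _ r1 v1 (fun h => absurd h hb) (fun _ => r2), ?_,
        f1.trans le_rfl f2, by simp [REx.val, hb, v2]⟩
      simp only [eval_add, eval_one]; omega
  | .sum x e => by
    obtain ⟨p, hp⟩ := e.comp_spec
    refine ⟨X * (p + 1 + 2) + 5, fun Q O N σ ε k s h => ?_⟩
    obtain ⟨t, s', hr, ht, hf, hv⟩ := runs_accLoop (O := O) (x := x) (k := k)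
      (c := .seq (e.comp (k + 2)) (setRTmp k (.add (rtmp k) (rtmp (k + 2))))) (T := p.eval N + 1)
      (h.frame (frame_setReal (k := k) (l := k) (j := 0) (v := 0) le_rfl))
      (fun i _ a => a = ∑ i ∈ Finset.range i, e.val N σ (Function.update ε x i))
      (by simp [Mem.setReal])
      (by
        intro i hi s' h' ha
        obtain ⟨t, s'', r1, l1, f1, v1⟩ := hp Q O N σ _ (k + 2) s' h'
        refine ⟨t + 1, _, .seq r1 (.setReal _ _ _ _ _), by omega,
          (f1.weaken (by omega)).trans le_rfl (frame_setReal le_rfl), ?_, ?_⟩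
        · simp [Mem.setReal, NExpr.eval, f1.nat 8 (k + 1) 0 (by omega)]
        · simp [Mem.setReal, NExpr.eval, RExpr.eval, rtmp, v1, f1.real 8 k 0 (by omega), ha,
            Finset.sum_range_succ])
    refine ⟨1 + t, s', .seq (.setReal _ _ _ _ _) hr, ?_, (frame_setReal le_rfl).trans le_rfl hf, ?_⟩
    · simp only [eval_add, eval_mul, eval_X, eval_one, eval_ofNat]; omega
    · simp [REx.val, hv]

theorem BEx.comp_spec : ∀ b : BEx, ∃ p : ℕ[X], ∀ (Q : Type) (O : Q → Mem → Mem) N σ ε,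
    Computes (Q := Q) (fun k => b.comp k) p O N σ ε fun x _ => x = if b.Holds N σ ε then 1 else 0
  | .nlt e f => by
    obtain ⟨p, hp⟩ := e.comp_spec
    obtain ⟨q, hq⟩ := f.comp_spec
    refine ⟨p + q + 2, fun Q O N σ ε => (hp Q O N σ ε).two (hq Q O N σ ε) ?_⟩
    intro k s h1 h2 h
    by_cases hb : e.val N σ ε < f.val N σ ε
    · exact ⟨1 + 1, _, .condTrue (by simpa [Test.Holds, NExpr.eval, tmp, h1, h2] using hb)
        (.setNat _ _ _ _ _), le_rfl, frame_setNat le_rfl,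
        by simp [Mem.setNat, NExpr.eval, BEx.Holds, hb]⟩
    · exact ⟨1 + 1, _, .condFalse (by simpa [Test.Holds, NExpr.eval, tmp, h1, h2] using hb)
        (.setNat _ _ _ _ _), le_rfl, frame_setNat le_rfl,
        by simp [Mem.setNat, NExpr.eval, BEx.Holds, hb]⟩
  | .rlt e f => by
    obtain ⟨p, hp⟩ := e.comp_spec
    obtain ⟨q, hq⟩ := f.comp_spec
    refine ⟨p + q + 2, fun Q O N σ ε => (hp Q O N σ ε).two (hq Q O N σ ε) ?_⟩
    intro k s h1 h2 h
    by_cases hb : e.val N σ ε < f.val N σ ε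
    · exact ⟨1 + 1, _, .condTrue
        (by simpa [Test.Holds, NExpr.eval, RExpr.eval, rtmp, h1, h2] using hb)
        (.setNat _ _ _ _ _), le_rfl, frame_setNat le_rfl,
        by simp [Mem.setNat, NExpr.eval, BEx.Holds, hb]⟩
    · exact ⟨1 + 1, _, .condFalse
        (by simpa [Test.Holds, NExpr.eval, RExpr.eval, rtmp, h1, h2] using hb)
        (.setNat _ _ _ _ _), le_rfl, frame_setNat le_rfl,
        by simp [Mem.setNat, NExpr.eval, BEx.Holds, hb]⟩
  | .not b => by
    obtain ⟨p, hp⟩ := b.comp_spec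
    refine ⟨p + 1, fun Q O N σ ε k s h => ?_⟩
    obtain ⟨t, s1, r1, l1, f1, v1⟩ := hp Q O N σ ε k s h
    refine ⟨t + 1, _, .seq r1 (.setNat _ _ _ _ _), by simp [l1], f1.trans le_rfl
      (frame_setNat le_rfl), ?_⟩
    by_cases hb : b.Holds N σ ε <;> simp [Mem.setNat, NExpr.eval, tmp, v1, BEx.Holds, hb]
  | .and b c => by
    obtain ⟨p, hp⟩ := b.comp_spec
    obtain ⟨q, hq⟩ := c.comp_spec
    refine ⟨p + q + 2, fun Q O N σ ε => (hp Q O N σ ε).two (hq Q O N σ ε) ?_⟩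
    intro k s h1 h2 h
    by_cases hb : b.Holds N σ ε
    · exact ⟨1 + 1, _, .condTrue (by simp [Test.Holds, NExpr.eval, tmp, h1, hb])
        (.setNat _ _ _ _ _), le_rfl, frame_setNat le_rfl,
        by simp [Mem.setNat, NExpr.eval, BEx.Holds, hb, tmp, h2]⟩
    · exact ⟨1 + 1, _, .condFalse (by simp [Test.Holds, NExpr.eval, tmp, h1, hb])
        (.skip _), le_rfl, Frame.refl _ _, by simp [BEx.Holds, hb, h1]⟩
end

end

end RAM

-- Statements: semantics, compilation and frame rules

namespace RAM

open Polynomial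

/-- Statements. `tabN a e` and `tabR a e` replace the entries `(i, j)` with `i, j < N` of an array by
the values of `e`, where `i` and `j` are the variables `0` and `1`; `rep c` repeats `c` exactly `N`
times. -/
inductive Stm (Q : Type) where
  | skip
  | tabN (a : ℕ) (e : NEx)
  | tabR (a : ℕ) (e : REx)
  | seq (c d : Stm Q)
  | ifte (b : BEx) (c d : Stm Q)
  | rep (c : Stm Q)
  | call (q : Q)

/-- The values of the variables inside a table. -/
def ij (i j : ℕ) : ℕ → ℕ := Function.update (Function.update (fun _ => 0) 0 i) 1 j

def Mem.tabN (N : ℕ) (σ : Mem) (a : ℕ) (F : ℕ → ℕ → ℕ) : Mem where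
  nat := fun a' i j => if a' = a ∧ i < N ∧ j < N then F i j else σ.nat a' i j
  real := σ.real

noncomputable def Mem.tabR (N : ℕ) (σ : Mem) (a : ℕ) (F : ℕ → ℕ → ℝ) : Mem where
  nat := σ.nat
  real := fun a' i j => if a' = a ∧ i < N ∧ j < N then F i j else σ.real a' i j

variable {Q : Type}

-- Every statement terminates by construction, so its meaning is a function and algorithms can be
-- verified by rewriting. Step counts occur only in `Stm.comp_spec`.
open Classical in
noncomputable def Stm.den (O : Q → Mem → Mem) (N : ℕ) : Stm Q → Mem → Mem
  | .skip, σ => σ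
  | .tabN a e, σ => σ.tabN N a fun i j => e.val N σ (ij i j)
  | .tabR a e, σ => σ.tabR N a fun i j => e.val N σ (ij i j)
  | .seq c d, σ => d.den O N (c.den O N σ)
  | .ifte b c d, σ => if b.Holds N σ (fun _ => 0) then c.den O N σ else d.den O N σ
  | .rep c, σ => (c.den O N)^[N] σ
  | .call q, σ => O q σ

def loop2 (k : ℕ) (c : Program Q) : Program Q := varLoop 0 k (varLoop 1 (k + 1) c)

/-- A table is first computed into the buffer array `9` and copied afterwards, because `e` may read
the array that is being replaced. The counter of `rep` occupies slot `k`, hence the body starts at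
`k + 1`. -/
def Stm.comp (k : ℕ) : Stm Q → Program Q
  | .skip => .skip
  | .tabN a e => .seq
      (loop2 k (.seq (e.comp (k + 2)) (.setNat 9 (vcell 0) (vcell 1) (tmp (k + 2)))))
      (loop2 k (.setNat (arr a) (vcell 0) (vcell 1) (.cell 9 (vcell 0) (vcell 1))))
  | .tabR a e => .seq
      (loop2 k (.seq (e.comp (k + 2)) (.setReal 9 (vcell 0) (vcell 1) (rtmp (k + 2)))))
      (loop2 k (.setReal (arr a) (vcell 0) (vcell 1) (.cell 9 (vcell 0) (vcell 1))))
  | .seq c d => .seq (c.comp k) (d.comp k)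
  | .ifte b c d => .seq (b.comp k) (.cond (.nlt (.const 0) (tmp k)) (c.comp k) (d.comp k))
  | .rep c => .seq (setTmp k (.const 0)) (countLoop 8 k (c.comp (k + 1)))
  | .call q => .call q

/-- The oracles act on represented memories as on the memories that represent them. -/
def OracleOK (O : Q → Mem → Mem) : Prop :=
  ∀ q N σ ε s, Rep N σ ε s → Rep N (O q σ) ε (O q s) ∧ ∀ i, (O q s).nat 8 i 0 = s.nat 8 i 0

/-- The entries that a double loop has visited before `(i, j)`. -/
def Visited (N i j i' j' : ℕ) : Prop := (i' < i ∨ i' = i ∧ j' < j) ∧ i' < N ∧ j' < N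

theorem visited_row {N i : ℕ} (_hi : i < N) : Visited N i N = Visited N (i + 1) 0 := by
  funext i' j'; simp only [Visited, eq_iff_iff]; omega

theorem visited_succ {N i j i' j' : ℕ} (hi : i < N) (hj : j < N) :
    Visited N i (j + 1) i' j' ↔ Visited N i j i' j' ∨ i' = i ∧ j' = j := by
  simp only [Visited]; omega

theorem visited_all {N i' j' : ℕ} : Visited N N 0 i' j' ↔ i' < N ∧ j' < N := by
  simp only [Visited]; omega

theorem not_visited {N i' j' : ℕ} : ¬ Visited N 0 0 i' j' := by
  simp only [Visited]; omega

section

variable {O : Q → Mem → Mem}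

/-- The invariant depends on the set of visited entries only. The end of a row and the beginning of
the next one have the same visited set, so one invariant serves both loops. -/
theorem runs_loop2 {k N T : ℕ} {c : Program Q} {s : Mem} (hN : s.nat 6 0 0 = N)
    (J : (ℕ → ℕ → Prop) → Mem → Prop)
    (h7 : ∀ D s x v, x < 2 → J D s → J D (s.setNat 7 x 0 v))
    (h8 : ∀ D s l v, k ≤ l → J D s → J D (s.setNat 8 l 0 v))
    (h0 : J (Visited N 0 0) s)
    (step : ∀ i < N, ∀ j < N, ∀ s', J (Visited N i j) s' → s'.nat 7 0 0 = i → s'.nat 7 1 0 = j →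
      s'.nat 6 0 0 = N → ∃ t s'', Runs O c s' t s'' ∧ t ≤ T ∧ J (Visited N i (j + 1)) s'' ∧
        s''.nat 7 = s'.nat 7 ∧ s''.nat 6 = s'.nat 6 ∧
        ∀ l < k + 2, s''.nat 8 l 0 = s'.nat 8 l 0) :
    ∃ t s', Runs O (loop2 k c) s t s' ∧ t ≤ N * ((N * (T + 2) + 4) + 2) + 4 ∧
      J (Visited N N 0) s' ∧ s'.nat 7 0 0 = s.nat 7 0 0 ∧ s'.nat 7 1 0 = s.nat 7 1 0 := by
  obtain ⟨t, s', hr, ht, ⟨h1, h2⟩, h3⟩ := runs_varLoop (O := O) (x := 0) (k := k)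
    (c := varLoop 1 (k + 1) c) (T := N * (T + 2) + 4) hN
    (fun i s' => J (Visited N i 0) s' ∧ s'.nat 7 1 0 = s.nat 7 1 0)
    (fun i s' v h => ⟨h7 _ _ _ _ (by omega) h.1, by simpa [Mem.setNat] using h.2⟩)
    ⟨h8 _ _ _ _ le_rfl h0, by simp [Mem.setNat]⟩
    (by
      rintro i hi s' ⟨hJ, hv⟩ hs7 hs6
      obtain ⟨t, s'', hr, ht, ⟨h1, h2, h3, h4⟩, h5⟩ := runs_varLoop (O := O) (x := 1) (k := k + 1)
        (c := c) (T := T) hs6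
        (fun j s'' => J (Visited N i j) s'' ∧ s''.nat 7 0 0 = i ∧ s''.nat 6 0 0 = N ∧
          s''.nat 8 k 0 = s'.nat 8 k 0)
        (fun i s' v h => ⟨h7 _ _ _ _ (by omega) h.1, by simpa [Mem.setNat] using h.2⟩)
        ⟨h8 _ _ _ _ (by omega) hJ, by simp [Mem.setNat, hs6, hs7]⟩
        (by
          rintro j hj s'' ⟨h1, h2, h3, h4⟩ h5 h6
          obtain ⟨t, s3, hr, ht, h1', h2', h3', h4'⟩ := step i hi j hj s'' h1 h2 h5 h6
          exact ⟨t, s3, hr, ht, ⟨h1', by rw [h2', h2], by rw [h3', h3], by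
            rw [h4' _ (by omega), h4]⟩, by rw [h2', h5], by rw [h3', h6], h4' _ (by omega)⟩)
      rw [visited_row hi] at h1
      exact ⟨t, s'', hr, ht, ⟨h1, by rw [h5, hv]⟩, h2, h3, h4⟩)
  exact ⟨t, s', hr, ht, h1, h3, h2⟩

/-- The memory `s'` represents `σ` except for an array to be described by `P`. -/
structure PreRep (k N : ℕ) (σ s s' : Mem) (A B : ℕ → Prop) (P : Prop) : Prop where
  bound : s'.nat 6 0 0 = N
  var : ∀ x, 2 ≤ x → s'.nat 7 x 0 = 0
  nat : ∀ a i j, A a → s'.nat (arr a) i j = σ.nat a i j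
  real : ∀ a i j, B a → s'.real (arr a) i j = σ.real a i j
  tmp : ∀ l < k, s'.nat 8 l 0 = s.nat 8 l 0
  main : P

theorem PreRep.rep {k N : ℕ} {σ s s' : Mem} {A B : ℕ → Prop} {P : Prop}
    (h : PreRep k N σ s s' A B P) (hA : ∀ a, A a) (hB : ∀ a, B a) :
    Rep N σ (ij (s'.nat 7 0 0) (s'.nat 7 1 0)) s' where
  bound := h.bound
  var x := by
    rcases x with _ | _ | x
    · simp [ij]
    · simp [ij]
    · rw [h.var _ (by omega)]; simp [ij]
  nat a i j := h.nat a i j (hA a)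
  real a i j := h.real a i j (hB a)

/-- During the first pass the memory still represents `σ`, so every entry is evaluated in the old
memory. During the second pass only array `a` deviates: its visited entries are new, the others old,
and the buffer is constant. -/
theorem tabN_spec {p : ℕ[X]} {N k a : ℕ} {e : NEx} {σ s : Mem}
    (he : ∀ ε, Computes (Q := Q) (fun k => e.comp k) p O N σ ε fun x _ => x = e.val N σ ε)
    (h : Rep N σ (fun _ => 0) s) :
    ∃ t s', Runs O ((Stm.tabN a e).comp k) s t s' ∧
      t ≤ (N * ((N * (p.eval N + 1 + 2) + 4) + 2) + 4) + (N * ((N * (1 + 2) + 4) + 2) + 4) ∧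
      Rep N ((Stm.tabN a e).den O N σ) (fun _ => 0) s' ∧ ∀ l < k, s'.nat 8 l 0 = s.nat 8 l 0 := by
  obtain ⟨t, s1, r1, l1, f1, f2, f3⟩ := runs_loop2 (O := O) (k := k) (T := p.eval N + 1)
    (c := (.seq (e.comp (k + 2)) (.setNat 9 (vcell 0) (vcell 1) (tmp (k + 2))))) h.bound
    (fun D s' => PreRep k N σ s s' (fun _ => True) (fun _ => True)
      (∀ i j, D i j → s'.nat 9 i j = e.val N σ (ij i j)))
    (by
      intro D s' x v hx hJ
      refine ⟨by simpa [Mem.setNat] using hJ.bound, fun y hy => ?_, fun a i j ha => ?_,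
        hJ.real, by simpa [Mem.setNat] using hJ.tmp, by simpa [Mem.setNat] using hJ.main⟩
      · simp [Mem.setNat, hJ.var y hy]; omega
      · simpa [Mem.setNat, (arr_ne a).2.1] using hJ.nat a i j ha)
    (by
      intro D s' x v hx hJ
      refine ⟨by simpa [Mem.setNat] using hJ.bound, by simpa [Mem.setNat] using hJ.var,
        fun a i j ha => ?_, hJ.real, fun l hl => ?_, by simpa [Mem.setNat] using hJ.main⟩
      · simpa [Mem.setNat, (arr_ne a).2.2.1] using hJ.nat a i j ha
      · have : l ≠ x := by omega
        simpa [Mem.setNat, this] using hJ.tmp l hl)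
    ⟨h.bound, fun x _ => h.var x, fun a i j _ => h.nat a i j, fun a i j _ => h.real a i j,
      fun _ _ => rfl, fun i j h => absurd h not_visited⟩
    (by
      intro i hi j hj s' hJ h0 h1 h6
      have hrep := hJ.rep (fun _ => trivial) (fun _ => trivial)
      rw [h0, h1] at hrep
      obtain ⟨t, s'', hr, ht, hf, hv⟩ := he _ (k + 2) s' hrep
      have hrep' := hrep.frame hf
      refine ⟨t + 1, _, .seq hr (.setNat _ _ _ _ _), by omega, ⟨hrep'.bound, fun x hx => ?_,
        fun a i j _ => ?_, fun a i j _ => hrep'.real a i j, fun l hl => ?_, fun i' j' hD => ?_⟩,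
        ?_, ?_, fun l hl => ?_⟩
      · simp [Mem.setNat, hf.nat, hJ.var x hx]
      · simp [Mem.setNat, (arr_ne a).2.2.2, hrep'.nat]
      · simp [Mem.setNat, hf.nat 8 l 0 (by omega), hJ.tmp l hl]
      · have e0 : s''.nat 7 0 0 = i := by rw [hf.nat _ _ _ (by omega), h0]
        have e1 : s''.nat 7 1 0 = j := by rw [hf.nat _ _ _ (by omega), h1]
        simp only [Mem.setNat, NExpr.eval, vcell, tmp, e0, e1, hv, true_and]
        rw [visited_succ hi hj] at hD
        by_cases h' : i' = i ∧ j' = j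
        · rw [if_pos h', h'.1, h'.2]
        · rw [if_neg h', hf.nat _ _ _ (by omega)]
          exact hJ.main i' j' (by tauto)
      · funext x y; simp [Mem.setNat, hf.nat]
      · funext x y; simp [Mem.setNat, hf.nat]
      · simp [Mem.setNat, hf.nat 8 l 0 (by omega)])
  obtain ⟨t', s2, r2, l2, g1, g2, g3⟩ := runs_loop2 (O := O) (k := k) (T := 1)
    (c := (.setNat (arr a) (vcell 0) (vcell 1) (.cell 9 (vcell 0) (vcell 1)))) f1.bound
    (fun D s' => PreRep k N σ s s' (fun b => b ≠ a) (fun _ => True)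
      ((∀ i j, D i j → s'.nat (arr a) i j = e.val N σ (ij i j)) ∧
       (∀ i j, ¬ D i j → s'.nat (arr a) i j = σ.nat a i j) ∧ s'.nat 9 = s1.nat 9))
    (by
      intro D s' x v hx hJ
      refine ⟨by simpa [Mem.setNat] using hJ.bound, fun y hy => ?_, fun a i j ha => ?_,
        hJ.real, by simpa [Mem.setNat] using hJ.tmp,
        by simpa [Mem.setNat, (arr_ne a).2.1] using hJ.main⟩
      · simp [Mem.setNat, hJ.var y hy]; omega
      · simpa [Mem.setNat, (arr_ne a).2.1] using hJ.nat a i j ha)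
    (by
      intro D s' x v hx hJ
      refine ⟨by simpa [Mem.setNat] using hJ.bound, by simpa [Mem.setNat] using hJ.var,
        fun a i j ha => ?_, hJ.real, fun l hl => ?_,
        by simpa [Mem.setNat, (arr_ne a).2.2.1] using hJ.main⟩
      · simpa [Mem.setNat, (arr_ne a).2.2.1] using hJ.nat a i j ha
      · have : l ≠ x := by omega
        simpa [Mem.setNat, this] using hJ.tmp l hl)
    ⟨f1.bound, f1.var, fun b i j _ => f1.nat b i j trivial, f1.real, f1.tmp,
      fun i j h => absurd h not_visited, fun i j _ => f1.nat a i j trivial, rfl⟩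
    (by
      intro i hi j hj s' hJ h0 h1 h6
      have h9 := hJ.main.2.2
      have ha := arr_ne a
      refine ⟨1, _, .setNat _ _ _ _ _, le_rfl, ⟨?_, fun x hx => ?_, fun b i' j' hb => ?_, hJ.real,
        fun l hl => ?_, fun i' j' hD => ?_, fun i' j' hD => ?_, ?_⟩, ?_, ?_, fun l hl => ?_⟩
      · simp [Mem.setNat, ha.1.symm, h6]
      · simp [Mem.setNat, ha.2.1.symm, hJ.var x hx]
      · simp [Mem.setNat, arr_inj, hb, hJ.nat b i' j' hb]
      · simp [Mem.setNat, ha.2.2.1.symm, hJ.tmp l hl]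
      · simp only [Mem.setNat, NExpr.eval, vcell, h0, h1, true_and, h9]
        rw [visited_succ hi hj] at hD
        by_cases h' : i' = i ∧ j' = j
        · rw [if_pos h', h'.1, h'.2]
          exact f1.main _ _ (visited_all.2 ⟨hi, hj⟩)
        · rw [if_neg h']
          exact hJ.main.1 i' j' (by tauto)
      · simp only [Mem.setNat, NExpr.eval, vcell, h0, h1, true_and]
        rw [visited_succ hi hj] at hD
        rw [if_neg (by tauto)]
        exact hJ.main.2.1 i' j' (by tauto)
      · funext x y; simp [Mem.setNat, ha.2.2.2.symm, h9]
      · funext x y; simp [Mem.setNat, ha.2.1.symm]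
      · funext x y; simp [Mem.setNat, ha.1.symm]
      · simp [Mem.setNat, ha.2.2.1.symm])
  refine ⟨t + t', s2, .seq r1 r2, by omega, ⟨g1.bound, fun x => ?_, fun b i j => ?_,
    fun b i j => g1.real b i j trivial⟩, g1.tmp⟩
  · rcases x with _ | _ | x
    · rw [g2, f2, h.var]
    · rw [g3, f3, h.var]
    · exact g1.var _ (by omega)
  · simp only [Stm.den, Mem.tabN]
    by_cases hb : b = a
    · subst hb
      by_cases hD : i < N ∧ j < N
      · rw [if_pos ⟨rfl, hD⟩, g1.main.1 i j (visited_all.2 hD)]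
      · rw [if_neg (by tauto), g1.main.2.1 i j (by rwa [visited_all])]
    · rw [if_neg (by tauto), g1.nat b i j hb]

theorem tabR_spec {p : ℕ[X]} {N k a : ℕ} {e : REx} {σ s : Mem}
    (he : ∀ ε, Computes (Q := Q) (fun k => e.comp k) p O N σ ε fun _ x => x = e.val N σ ε)
    (h : Rep N σ (fun _ => 0) s) :
    ∃ t s', Runs O ((Stm.tabR a e).comp k) s t s' ∧
      t ≤ (N * ((N * (p.eval N + 1 + 2) + 4) + 2) + 4) + (N * ((N * (1 + 2) + 4) + 2) + 4) ∧
      Rep N ((Stm.tabR a e).den O N σ) (fun _ => 0) s' ∧ ∀ l < k, s'.nat 8 l 0 = s.nat 8 l 0 := by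
  obtain ⟨t, s1, r1, l1, f1, f2, f3⟩ := runs_loop2 (O := O) (k := k) (T := p.eval N + 1)
    (c := (.seq (e.comp (k + 2)) (.setReal 9 (vcell 0) (vcell 1) (rtmp (k + 2))))) h.bound
    (fun D s' => PreRep k N σ s s' (fun _ => True) (fun _ => True)
      (∀ i j, D i j → s'.real 9 i j = e.val N σ (ij i j)))
    (by
      intro D s' x v hx hJ
      refine ⟨by simpa [Mem.setNat] using hJ.bound, fun y hy => ?_, fun a i j ha => ?_,
        hJ.real, by simpa [Mem.setNat] using hJ.tmp, by simpa [Mem.setNat] using hJ.main⟩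
      · simp [Mem.setNat, hJ.var y hy]; omega
      · simpa [Mem.setNat, (arr_ne a).2.1] using hJ.nat a i j ha)
    (by
      intro D s' x v hx hJ
      refine ⟨by simpa [Mem.setNat] using hJ.bound, by simpa [Mem.setNat] using hJ.var,
        fun a i j ha => ?_, hJ.real, fun l hl => ?_, by simpa [Mem.setNat] using hJ.main⟩
      · simpa [Mem.setNat, (arr_ne a).2.2.1] using hJ.nat a i j ha
      · have : l ≠ x := by omega
        simpa [Mem.setNat, this] using hJ.tmp l hl)
    ⟨h.bound, fun x _ => h.var x, fun a i j _ => h.nat a i j, fun a i j _ => h.real a i j,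
      fun _ _ => rfl, fun i j h => absurd h not_visited⟩
    (by
      intro i hi j hj s' hJ h0 h1 h6
      have hrep := hJ.rep (fun _ => trivial) (fun _ => trivial)
      rw [h0, h1] at hrep
      obtain ⟨t, s'', hr, ht, hf, hv⟩ := he _ (k + 2) s' hrep
      have hrep' := hrep.frame hf
      refine ⟨t + 1, _, .seq hr (.setReal _ _ _ _ _), by omega, ⟨hrep'.bound, fun x hx => ?_,
        fun a i j _ => hrep'.nat a i j, fun a i j _ => ?_, fun l hl => ?_, fun i' j' hD => ?_⟩,
        ?_, ?_, fun l hl => hf.nat 8 l 0 (by omega)⟩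
      · simp [Mem.setReal, hf.nat, hJ.var x hx]
      · simp [Mem.setReal, (arr_ne a).2.2.2, hrep'.real]
      · simp [Mem.setReal, hf.nat 8 l 0 (by omega), hJ.tmp l hl]
      · have e0 : s''.nat 7 0 0 = i := by rw [hf.nat _ _ _ (by omega), h0]
        have e1 : s''.nat 7 1 0 = j := by rw [hf.nat _ _ _ (by omega), h1]
        simp only [Mem.setReal, NExpr.eval, RExpr.eval, vcell, rtmp, e0, e1, hv, true_and]
        rw [visited_succ hi hj] at hD
        by_cases h' : i' = i ∧ j' = j
        · rw [if_pos h', h'.1, h'.2]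
        · rw [if_neg h', hf.real _ _ _ (by omega)]
          exact hJ.main i' j' (by tauto)
      · funext x y; simp [Mem.setReal, hf.nat]
      · funext x y; simp [Mem.setReal, hf.nat])
  obtain ⟨t', s2, r2, l2, g1, g2, g3⟩ := runs_loop2 (O := O) (k := k) (T := 1)
    (c := (.setReal (arr a) (vcell 0) (vcell 1) (.cell 9 (vcell 0) (vcell 1)))) f1.bound
    (fun D s' => PreRep k N σ s s' (fun _ => True) (fun b => b ≠ a)
      ((∀ i j, D i j → s'.real (arr a) i j = e.val N σ (ij i j)) ∧
       (∀ i j, ¬ D i j → s'.real (arr a) i j = σ.real a i j) ∧ s'.real 9 = s1.real 9))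
    (by
      intro D s' x v hx hJ
      refine ⟨by simpa [Mem.setNat] using hJ.bound, fun y hy => ?_, fun a i j ha => ?_,
        hJ.real, by simpa [Mem.setNat] using hJ.tmp, hJ.main⟩
      · simp [Mem.setNat, hJ.var y hy]; omega
      · simpa [Mem.setNat, (arr_ne a).2.1] using hJ.nat a i j ha)
    (by
      intro D s' x v hx hJ
      refine ⟨by simpa [Mem.setNat] using hJ.bound, by simpa [Mem.setNat] using hJ.var,
        fun a i j ha => ?_, hJ.real, fun l hl => ?_, hJ.main⟩
      · simpa [Mem.setNat, (arr_ne a).2.2.1] using hJ.nat a i j ha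
      · have : l ≠ x := by omega
        simpa [Mem.setNat, this] using hJ.tmp l hl)
    ⟨f1.bound, f1.var, f1.nat, fun b i j _ => f1.real b i j trivial, f1.tmp,
      fun i j h => absurd h not_visited, fun i j _ => f1.real a i j trivial, rfl⟩
    (by
      intro i hi j hj s' hJ h0 h1 h6
      have h9 := hJ.main.2.2
      have ha := arr_ne a
      refine ⟨1, _, .setReal _ _ _ _ _, le_rfl, ⟨h6, hJ.var, hJ.nat, fun b i' j' hb => ?_,
        hJ.tmp, fun i' j' hD => ?_, fun i' j' hD => ?_, ?_⟩, rfl, rfl, fun l hl => rfl⟩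
      · simp [Mem.setReal, arr_inj, hb, hJ.real b i' j' hb]
      · simp only [Mem.setReal, NExpr.eval, RExpr.eval, vcell, h0, h1, true_and, h9]
        rw [visited_succ hi hj] at hD
        by_cases h' : i' = i ∧ j' = j
        · rw [if_pos h', h'.1, h'.2]
          exact f1.main _ _ (visited_all.2 ⟨hi, hj⟩)
        · rw [if_neg h']
          exact hJ.main.1 i' j' (by tauto)
      · simp only [Mem.setReal, NExpr.eval, RExpr.eval, vcell, h0, h1, true_and]
        rw [visited_succ hi hj] at hD
        rw [if_neg (by tauto)]
        exact hJ.main.2.1 i' j' (by tauto)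
      · funext x y; simp [Mem.setReal, ha.2.2.2.symm, h9])
  refine ⟨t + t', s2, .seq r1 r2, by omega, ⟨g1.bound, fun x => ?_, fun b i j => g1.nat b i j trivial,
    fun b i j => ?_⟩, g1.tmp⟩
  · rcases x with _ | _ | x
    · rw [g2, f2, h.var]
    · rw [g3, f3, h.var]
    · exact g1.var _ (by omega)
  · simp only [Stm.den, Mem.tabR]
    by_cases hb : b = a
    · subst hb
      by_cases hD : i < N ∧ j < N
      · rw [if_pos ⟨rfl, hD⟩, g1.main.1 i j (visited_all.2 hD)]
      · rw [if_neg (by tauto), g1.main.2.1 i j (by rwa [visited_all])]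
    · rw [if_neg (by tauto), g1.real b i j hb]

end

/-- An oracle call is one step, so the polynomial can be chosen before the oracle. Preserving the
slots below `k` is what allows a surrounding `rep` to keep its counter. -/
theorem Stm.comp_spec (c : Stm Q) : ∃ p : ℕ[X], ∀ O : Q → Mem → Mem, OracleOK O →
    ∀ N k σ s, Rep N σ (fun _ => 0) s →
      ∃ t s', Runs O (c.comp k) s t s' ∧ t ≤ p.eval N ∧ Rep N (c.den O N σ) (fun _ => 0) s' ∧
        ∀ l < k, s'.nat 8 l 0 = s.nat 8 l 0 := by
  classical
  induction c with
  | skip => exact ⟨1, fun O hO N k σ s h => ⟨1, s, .skip s, by simp, h, fun _ _ => rfl⟩⟩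
  | call q => exact ⟨1, fun O hO N k σ s h => ⟨1, _, .call q s, by simp, (hO q N σ _ s h).1,
      fun l _ => (hO q N σ _ s h).2 l⟩⟩
  | tabN a e =>
    obtain ⟨p, hp⟩ := e.comp_spec
    refine ⟨(X * ((X * (p + 1 + 2) + 4) + 2) + 4) + (X * ((X * (1 + 2) + 4) + 2) + 4),
      fun O hO N k σ s h => ?_⟩
    obtain ⟨t, s', hr, ht, h1, h2⟩ := tabN_spec (k := k) (a := a) (fun ε => hp Q O N σ ε) h
    refine ⟨t, s', hr, ?_, h1, h2⟩
    simpa only [eval_add, eval_mul, eval_X, eval_one, eval_ofNat] using ht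
  | tabR a e =>
    obtain ⟨p, hp⟩ := e.comp_spec
    refine ⟨(X * ((X * (p + 1 + 2) + 4) + 2) + 4) + (X * ((X * (1 + 2) + 4) + 2) + 4),
      fun O hO N k σ s h => ?_⟩
    obtain ⟨t, s', hr, ht, h1, h2⟩ := tabR_spec (k := k) (a := a) (fun ε => hp Q O N σ ε) h
    refine ⟨t, s', hr, ?_, h1, h2⟩
    simpa only [eval_add, eval_mul, eval_X, eval_one, eval_ofNat] using ht
  | seq c d ihc ihd =>
    obtain ⟨p, hp⟩ := ihc
    obtain ⟨q, hq⟩ := ihd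
    refine ⟨p + q, fun O hO N k σ s h => ?_⟩
    obtain ⟨t, s', hr, ht, h1, h2⟩ := hp O hO N k σ s h
    obtain ⟨t', s'', hr', ht', h1', h2'⟩ := hq O hO N k _ s' h1
    refine ⟨t + t', s'', .seq hr hr', ?_, h1', fun l hl => by rw [h2' l hl, h2 l hl]⟩
    rw [eval_add]; omega
  | ifte b c d ihc ihd =>
    obtain ⟨r, hr⟩ := b.comp_spec
    obtain ⟨p, hp⟩ := ihc
    obtain ⟨q, hq⟩ := ihd
    refine ⟨r + (p + q + 1), fun O hO N k σ s h => ?_⟩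
    obtain ⟨t, s1, r1, l1, f1, v1⟩ := hr Q O N σ _ k s h
    by_cases hb : b.Holds N σ (fun _ => 0)
    · obtain ⟨t', s'', hr', ht', h1', h2'⟩ := hp O hO N k σ s1 (h.frame f1)
      refine ⟨_, s'', runs_ite _ r1 v1 (fun _ => hr') (fun h => absurd hb h), ?_, ?_,
        fun l hl => by rw [h2' l hl, f1.nat _ _ _ (by omega)]⟩
      · simp only [eval_add, eval_one]; omega
      · simpa [Stm.den, hb] using h1'
    · obtain ⟨t', s'', hr', ht', h1', h2'⟩ := hq O hO N k σ s1 (h.frame f1)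
      refine ⟨_, s'', runs_ite _ r1 v1 (fun h => absurd h hb) (fun _ => hr'), ?_, ?_,
        fun l hl => by rw [h2' l hl, f1.nat _ _ _ (by omega)]⟩
      · simp only [eval_add, eval_one]; omega
      · simpa [Stm.den, hb] using h1'
  | rep c ih =>
    obtain ⟨p, hp⟩ := ih
    refine ⟨X * (p + 2) + 2, fun O hO N k σ s h => ?_⟩
    have hset : ∀ (ρ s' : Mem) (v : ℕ), Rep N ρ (fun _ => 0) s' →
        Rep N ρ (fun _ => 0) (s'.setNat 8 k 0 v) := fun ρ s' v h' => h'.frame (frame_setNat le_rfl)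
    obtain ⟨t, s', hr, ht, h1, h2, h3⟩ := runs_countLoop (O := O) (a := 8) (r := k) (N := N)
      (T := p.eval N) (c := c.comp (k + 1))
      (fun i s' => Rep N ((c.den O N)^[i] σ) (fun _ => 0) s' ∧ s'.nat 8 k 0 = i ∧
        ∀ l < k, s'.nat 8 l 0 = s.nat 8 l 0)
      (fun i s' h => ⟨h.2.1, h.1.bound⟩)
      (by
        rintro i hi s' ⟨h1, h2, h3⟩
        obtain ⟨t, s'', hr, ht, h1', h2'⟩ := hp O hO N (k + 1) _ s' h1
        refine ⟨t, s'', hr, ht, hset _ _ _ ?_, ?_, fun l hl => ?_⟩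
        · rwa [Function.iterate_succ_apply']
        · simp [Mem.setNat, h2' k (by omega), h2]
        · have : l ≠ k := by omega
          simp [Mem.setNat, this, h2' l (by omega), h3 l hl])
      (s := s.setNat 8 k 0 0)
      ⟨hset _ _ _ h, by simp [Mem.setNat], fun l hl => by
        have : l ≠ k := by omega
        simp [Mem.setNat, this]⟩
    refine ⟨1 + t, s', .seq (.setNat _ _ _ _ _) hr, ?_, h1, h3⟩
    simp only [eval_add, eval_mul, eval_X, eval_ofNat]; omega

/-- The arrays of natural numbers that a statement may change. -/
def Stm.natW : Stm Q → List ℕ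
  | .skip => []
  | .tabN a _ => [a]
  | .tabR _ _ => []
  | .seq c d => c.natW ++ d.natW
  | .ifte _ c d => c.natW ++ d.natW
  | .rep c => c.natW
  | .call _ => [5]

/-- The arrays of real numbers that a statement may change. -/
def Stm.realW : Stm Q → List ℕ
  | .skip => []
  | .tabN _ _ => []
  | .tabR a _ => [a]
  | .seq c d => c.realW ++ d.realW
  | .ifte _ c d => c.realW ++ d.realW
  | .rep c => c.realW
  | .call _ => [1]

/-- The oracles write their answers into the array `5` of natural numbers and into the array `1` of
real numbers. -/
structure OracleFrame (O : Q → Mem → Mem) : Prop where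
  nat : ∀ q σ a, a ≠ 5 → (O q σ).nat a = σ.nat a
  real : ∀ q σ a, a ≠ 1 → (O q σ).real a = σ.real a

/-- Frame rule: membership in the list of written arrays is settled by computation, and facts about
untouched arrays are carried through a statement this way. -/
theorem Stm.den_nat {O : Q → Mem → Mem} (hO : OracleFrame O) (N a : ℕ) (c : Stm Q) (σ : Mem)
    (ha : a ∉ c.natW) : (c.den O N σ).nat a = σ.nat a := by
  classical
  induction c generalizing σ with
  | skip => rfl
  | call q => exact hO.nat q σ a (by simpa [natW] using ha)
  | tabN b e =>
    have : a ≠ b := by simpa [natW] using ha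
    funext i j; simp [den, Mem.tabN, this]
  | tabR b e => rfl
  | seq c d ihc ihd =>
    simp only [natW, List.mem_append, not_or] at ha
    rw [den, ihd _ ha.2, ihc _ ha.1]
  | ifte b c d ihc ihd =>
    simp only [natW, List.mem_append, not_or] at ha
    rw [den]; split_ifs
    · exact ihc _ ha.1
    · exact ihd _ ha.2
  | rep c ih =>
    rw [den]
    have : ∀ n σ, ((c.den O N)^[n] σ).nat a = σ.nat a := by
      intro n
      induction n with
      | zero => exact fun _ => rfl
      | succ n ihn => intro σ; rw [Function.iterate_succ_apply, ihn, ih _ ha]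
    exact this _ _

theorem Stm.den_real {O : Q → Mem → Mem} (hO : OracleFrame O) (N a : ℕ) (c : Stm Q) (σ : Mem)
    (ha : a ∉ c.realW) : (c.den O N σ).real a = σ.real a := by
  classical
  induction c generalizing σ with
  | skip => rfl
  | call q => exact hO.real q σ a (by simpa [realW] using ha)
  | tabR b e =>
    have : a ≠ b := by simpa [realW] using ha
    funext i j; simp [den, Mem.tabR, this]
  | tabN b e => rfl
  | seq c d ihc ihd =>
    simp only [realW, List.mem_append, not_or] at ha
    rw [den, ihd _ ha.2, ihc _ ha.1]
  | ifte b c d ihc ihd =>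
    simp only [realW, List.mem_append, not_or] at ha
    rw [den]; split_ifs
    · exact ihc _ ha.1
    · exact ihd _ ha.2
  | rep c ih =>
    rw [den]
    have : ∀ n σ, ((c.den O N)^[n] σ).real a = σ.real a := by
      intro n
      induction n with
      | zero => exact fun _ => rfl
      | succ n ihn => intro σ; rw [Function.iterate_succ_apply, ihn, ih _ ha]
    exact this _ _

end RAM

-- Oracles on represented memories; from statements to programs

namespace FairDivision

open RAM

/-- The arrays of the interface have numbers below `6`, which `arr` leaves in place, and the arrays
reserved by the compiler are not among those that an oracle writes. -/
theorem oracleOK_oracles {m : ℕ} (u : Finset (Fin m) → ℝ) (f : Finset (Fin m) → ℕ → Fin m → ℕ) :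
    OracleOK (oracles u f) := by
  intro q N σ ε s h
  have hnat : ∀ a < 6, ∀ i j, s.nat a i j = σ.nat a i j := fun a ha i j => by
    have := h.nat a i j; rwa [arr, if_pos ha] at this
  have hq : querySet m s = querySet m σ := by
    ext v; simp [querySet, hnat 3 (by omega)]
  have h1 : ∀ a, arr a = 1 ↔ a = 1 := fun a => by unfold arr; split_ifs <;> omega
  have h5 : ∀ a, arr a = 5 ↔ a = 5 := fun a => by unfold arr; split_ifs <;> omega
  cases q with
  | utility =>
    refine ⟨⟨h.bound, h.var, h.nat, fun a i j => ?_⟩, fun _ => rfl⟩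
    simp only [oracles, Mem.setReal, h1, hq, h.real]
  | smms =>
    refine ⟨⟨by simp [oracles, h.bound], fun x => by simp [oracles, h.var],
      fun a i j => ?_, h.real⟩, fun i => by simp [oracles]⟩
    simp only [oracles, h5, hq, h.nat, hnat 4 (by omega)]

theorem oracleFrame_oracles {m : ℕ} (u : Finset (Fin m) → ℝ)
    (f : Finset (Fin m) → ℕ → Fin m → ℕ) : OracleFrame (oracles u f) := by
  constructor
  · intro q σ a ha
    cases q with
    | utility => rfl
    | smms => funext i j; simp [oracles, ha]
  · intro q σ a ha
    cases q with
    | utility => funext i j; simp [oracles, Mem.setReal, ha]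
    | smms => rfl

theorem oracleOK_elim : OracleOK (fun q : Empty => q.elim) := fun q => q.elim

theorem oracleFrame_elim : OracleFrame (fun q : Empty => q.elim) := ⟨fun q => q.elim, fun q => q.elim⟩

open Polynomial in
/-- Every statement is executed by a program in polynomial time. -/
theorem exists_program {Q : Type} (c : Stm Q) : ∃ (P : Program Q) (p : ℕ[X]),
    ∀ O : Q → Mem → Mem, OracleOK O → ∀ (m n : ℕ) (G : SimpleGraph (Fin m)) (w : Fin m → ℝ),
      ∃ t s, Runs O P (inputMem G n w) t s ∧ t ≤ p.eval (m + n) ∧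
        s.nat 2 = (c.den O (m + n + 1) (inputMem G n w)).nat 2 := by
  obtain ⟨p, hp⟩ := c.comp_spec
  -- The common loop bound `m + n + 1` exceeds both `m` and `n`: the index `m` is available for the
  -- sink of a rooted tree, and there are more rounds than agents. Hence the substitution of `X +
  -- 1`.
  refine ⟨.seq (.setNat 6 (.const 0) (.const 0) (.add (.cell 0 (.const 0) (.const 0))
    (.add (.cell 0 (.const 0) (.const 1)) (.const 1)))) (c.comp 0), p.comp (X + 1) + 1,
    fun O hO m n G w => ?_⟩
  have hrep : Rep (m + n + 1) (inputMem G n w) (fun _ => 0)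
      ((inputMem G n w).setNat 6 0 0 (m + (n + 1))) := by
    refine ⟨by simp [Mem.setNat, add_assoc], fun x => by simp [Mem.setNat, inputMem],
      fun a i j => ?_, fun a i j => ?_⟩
    · simp only [Mem.setNat, (arr_ne a).1, false_and, if_false]
      by_cases ha : a < 6
      · rw [arr, if_pos ha]
      · have h1 : a ≠ 0 ∧ a ≠ 1 := by omega
        simp [inputMem, arr, ha, h1]
    · by_cases ha : a < 6
      · rw [arr, if_pos ha]; rfl
      · have h1 : a ≠ 0 := by omega
        simp [inputMem, Mem.setNat, arr, ha, h1]
  obtain ⟨t, s, hr, ht, h1, -⟩ := hp O hO (m + n + 1) 0 _ _ hrep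
  refine ⟨1 + t, s, .seq ?_ hr, ?_, ?_⟩
  · have := Runs.setNat (O := O) 6 (.const 0) (.const 0) (.add (.cell 0 (.const 0) (.const 0))
      (.add (.cell 0 (.const 0) (.const 1)) (.const 1))) (inputMem G n w)
    simpa [NExpr.eval, inputMem] using this
  · simp only [eval_add, eval_comp, eval_X, eval_one]; omega
  · funext i j; exact h1.nat 2 i j

end FairDivision

-- Components, shares, losers, and correctness of the recursion

namespace FairDivision

section

variable {V : Type*} {G : SimpleGraph V}

theorem connBundle_empty : ConnBundle G ∅ := by
  rintro ⟨x, hx⟩; simp at hx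

theorem connBundle_singleton (v : V) : ConnBundle G {v} := by
  rintro ⟨x, hx⟩ ⟨y, hy⟩
  simp only [Finset.coe_singleton, Set.mem_singleton_iff] at hx hy
  subst hx; subst hy; rfl

variable [DecidableEq V]

theorem ConnBundle.union {X Y : Finset V} (hX : ConnBundle G X) (hY : ConnBundle G Y)
    (h : (X ∩ Y).Nonempty) : ConnBundle G (X ∪ Y) := by
  have := (SimpleGraph.induce_union_connected hX hY (by
    obtain ⟨v, hv⟩ := h; exact ⟨v, by simpa using hv⟩)).preconnected
  unfold ConnBundle; rwa [Finset.coe_union]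

theorem ConnBundle.union_of_adj {X Y : Finset V} (hX : ConnBundle G X) (hY : ConnBundle G Y)
    {v w : V} (hv : v ∈ X) (hw : w ∈ Y) (h : G.Adj v w) : ConnBundle G (X ∪ Y) := by
  have := (SimpleGraph.connected_induce_union hX hY (v := v) (w := w) (by simpa) (by simpa)
    h).preconnected
  unfold ConnBundle; rwa [Finset.coe_union]

theorem IsComponent.subset_of_inter {T C X : Finset V} (hC : IsComponent G T C) (hXT : X ⊆ T)
    (hX : ConnBundle G X) (h : (X ∩ C).Nonempty) : X ⊆ C := by
  have := hC.2.2.2 (C ∪ X) Finset.subset_union_left (Finset.union_subset hC.1 hXT)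
    (hC.2.2.1.union hX (by rwa [Finset.inter_comm]))
  exact this ▸ Finset.subset_union_right

theorem IsComponent.eq_of_inter {T C D : Finset V} (hC : IsComponent G T C)
    (hD : IsComponent G T D) (h : (C ∩ D).Nonempty) : C = D :=
  (hD.subset_of_inter hC.1 hC.2.2.1 h).antisymm
    (hC.subset_of_inter hD.1 hD.2.2.1 (by rwa [Finset.inter_comm]))

theorem IsComponent.eq_of_adj {T C D : Finset V} (hC : IsComponent G T C)
    (hD : IsComponent G T D) {v w : V} (hv : v ∈ C) (hw : w ∈ D) (h : G.Adj v w) : C = D := by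
  have h1 := hC.2.2.2 (C ∪ D) Finset.subset_union_left (Finset.union_subset hC.1 hD.1)
    (hC.2.2.1.union_of_adj hD.2.2.1 hv hw h)
  have h2 := hD.2.2.2 (C ∪ D) Finset.subset_union_right (Finset.union_subset hC.1 hD.1)
    (hC.2.2.1.union_of_adj hD.2.2.1 hv hw h)
  rw [← h1, h2]

theorem exists_component {T X : Finset V} (hX : ConnBundle G X) (hXT : X ⊆ T)
    (hne : X.Nonempty) : ∃ C, IsComponent G T C ∧ X ⊆ C := by
  classical
  obtain ⟨C, hC, hmax⟩ := (T.powerset.filter fun C => X ⊆ C ∧ ConnBundle G C).exists_max_image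
    Finset.card ⟨X, by simp [hXT, hX]⟩
  simp only [Finset.mem_filter, Finset.mem_powerset] at hC hmax
  refine ⟨C, ⟨hC.1, hne.mono hC.2.1, hC.2.2, fun D hCD hDT hD => ?_⟩, hC.2.1⟩
  exact (Finset.eq_of_subset_of_card_le hCD (hmax D ⟨hDT, hC.2.1.trans hCD, hD⟩)).symm

theorem component_of_conn {T C : Finset V} (hT : ConnBundle G T) (hC : IsComponent G T C) :
    C = T := (hC.2.2.2 T hC.1 subset_rfl hT).symm

theorem IsConnAlloc.subset {ι : Type*} {S : Finset V} {N : Finset ι} {A : ι → Finset V}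
    (h : IsConnAlloc G S N A) {i : ι} (hi : i ∈ N) : A i ⊆ S := by
  rw [← h.cover]; exact Finset.subset_biUnion_of_mem A hi

theorem IsConnAlloc.congr {ι : Type*} {S : Finset V} {N : Finset ι} {A B : ι → Finset V}
    (h : IsConnAlloc G S N A) (hAB : ∀ i ∈ N, B i = A i) : IsConnAlloc G S N B where
  conn i hi := by rw [hAB i hi]; exact h.conn i hi
  disj i hi j hj hij := by rw [hAB i hi, hAB j hj]; exact h.disj i hi j hj hij
  cover := by rw [← h.cover]; exact Finset.biUnion_congr rfl hAB

theorem IsConnAlloc.comp {ι κ : Type*} {S : Finset V} {N : Finset ι} {N' : Finset κ}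
    {A : ι → Finset V} (h : IsConnAlloc G S N A) {e : κ → ι} (he : Set.BijOn e N' N) :
    IsConnAlloc G S N' fun i => A (e i) where
  conn i hi := h.conn _ (he.mapsTo hi)
  disj i hi j hj hij := h.disj _ (he.mapsTo hi) _ (he.mapsTo hj) fun h' => hij (he.injOn hi hj h')
  cover := by
    rw [← h.cover]; ext v
    simp only [Finset.mem_biUnion]
    constructor
    · rintro ⟨i, hi, hv⟩; exact ⟨_, he.mapsTo hi, hv⟩
    · rintro ⟨i, hi, hv⟩
      obtain ⟨j, hj, rfl⟩ := he.surjOn hi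
      exact ⟨j, hj, hv⟩

theorem card_eq_of_bijOn {ι κ : Type*} {N : Finset ι} {N' : Finset κ} {e : κ → ι}
    (he : Set.BijOn e N' N) : N'.card = N.card :=
  Finset.card_nbij e (fun _ hi => he.mapsTo hi) he.injOn he.surjOn

theorem exists_bijOn_fin {ι : Type*} (N : Finset ι) :
    ∃ e : Fin N.card → ι, Set.BijOn e (Finset.univ : Finset (Fin N.card)) N := by
  refine ⟨fun j => N.equivFin.symm j, fun j _ => by simp, fun i _ j _ h => ?_, fun i hi => ?_⟩
  · exact N.equivFin.symm.injective (Subtype.ext h)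
  · exact ⟨N.equivFin ⟨i, hi⟩, by simp, by simp⟩

theorem exists_bijOn_symm {ι κ : Type*} {N : Finset ι} {N' : Finset κ} {e : κ → ι}
    (he : Set.BijOn e N' N) (hne : N'.Nonempty) :
    ∃ d : ι → κ, Set.BijOn d N N' ∧ (∀ i ∈ N', d (e i) = i) ∧ ∀ i ∈ N, e (d i) = i := by
  have : Nonempty κ := ⟨hne.choose⟩
  have := he.invOn_invFunOn
  exact ⟨Function.invFunOn e N', he.symm this.symm, fun i hi => this.1 hi, fun i hi => this.2 hi⟩

theorem exists_connAlloc {ι : Type*} {S : Finset V} {N : Finset ι} (hS : ConnBundle G S)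
    (hN : N.Nonempty) : ∃ A : ι → Finset V, IsConnAlloc G S N A := by
  classical
  obtain ⟨i0, h0⟩ := hN
  refine ⟨fun i => if i = i0 then S else ∅, fun i _ => ?_, fun i _ j _ hij => ?_, ?_⟩
  · split_ifs
    · exact hS
    · exact connBundle_empty
  · split_ifs with h1 h2
    · exact absurd (h1.trans h2.symm) hij
    all_goals simp
  · ext v; simp only [Finset.mem_biUnion]
    constructor
    · rintro ⟨i, _, hv⟩; split_ifs at hv
      · exact hv
      · simp at hv
    · exact fun hv => ⟨i0, h0, by simpa⟩

variable [Fintype V] {u : Finset V → ℝ}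

theorem finite_maximinShare_set (k : ℕ) (X : Finset V) : {r : ℝ | ∃ A : Fin k → Finset V,
    IsConnAlloc G X (Finset.univ : Finset (Fin k)) A ∧ r = ⨅ j, u (A j)}.Finite :=
  (Set.finite_range fun A : Fin k → Finset V => ⨅ j, u (A j)).subset
    (by rintro _ ⟨A, -, rfl⟩; exact ⟨A, rfl⟩)

/-- An enumeration of `N` turns the allocation into a competitor in the supremum over `Fin`, which
is bounded because there are only finitely many bundles. -/
theorem le_maximinShare {ι : Type*} {S : Finset V} {N : Finset ι} {A : ι → Finset V}
    (hA : IsConnAlloc G S N A) (hN : N.Nonempty) {r : ℝ} (hr : ∀ i ∈ N, r ≤ u (A i)) :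
    r ≤ maximinShare G u N.card S := by
  obtain ⟨e, he⟩ := exists_bijOn_fin N
  have : Nonempty (Fin N.card) := ⟨⟨0, hN.card_pos⟩⟩
  refine le_trans (le_ciInf fun j => ?_)
    (le_csSup (finite_maximinShare_set _ _).bddAbove ⟨_, hA.comp he, rfl⟩)
  exact hr _ (he.mapsTo (by simp))

theorem exists_maximinShare {ι : Type*} {S : Finset V} {N : Finset ι} (hN : N.Nonempty)
    (h : ∃ A : ι → Finset V, IsConnAlloc G S N A) :
    ∃ A : ι → Finset V, IsConnAlloc G S N A ∧ IsMMS G u S N A := by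
  obtain ⟨A, hA⟩ := h
  obtain ⟨e, he⟩ := exists_bijOn_fin N
  obtain ⟨B, hB, hr⟩ : maximinShare G u N.card S ∈ _ :=
    Set.Nonempty.csSup_mem ⟨_, _, hA.comp he, rfl⟩ (finite_maximinShare_set (u := u) _ _)
  obtain ⟨d, hd, -⟩ := exists_bijOn_symm he ⟨⟨0, hN.card_pos⟩, by simp⟩
  refine ⟨_, hB.comp hd, fun i hi => ?_⟩
  rw [hr]
  exact ciInf_le (Set.finite_range _).bddBelow _

/-- The least utility in `A` is reached by all bundles, so it is at most the share. This makes the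
recursion and its iterative form terminate. -/
theorem losers_nonempty {ι : Type*} {S : Finset V} {N : Finset ι} {A : ι → Finset V}
    (hA : IsConnAlloc G S N A) (hm : IsMMS G u S N A) (hN : N.Nonempty) :
    (losers G u S N A).Nonempty := by
  obtain ⟨i, hi, h⟩ := N.exists_min_image (fun i => u (A i)) hN
  exact ⟨i, by simpa [losers, hi] using (le_maximinShare hA hN h).antisymm (hm i hi)⟩

/-- All bundles reach the utility of the empty one, so it is at most the share. This is how the
hypothesis on `u ∅` enters: non-losers own a vertex and hence belong to a definite component. -/
theorem mem_losers_of_empty {ι : Type*} {S : Finset V} {N : Finset ι} {A : ι → Finset V}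
    (hu : ∀ X, u ∅ ≤ u X) (hA : IsConnAlloc G S N A) (hm : IsMMS G u S N A) {i : ι} (hi : i ∈ N)
    (h : A i = ∅) : i ∈ losers G u S N A := by
  simp only [losers, Finset.mem_filter]
  exact ⟨hi, le_antisymm (le_maximinShare hA ⟨i, hi⟩ fun j _ => h ▸ hu _) (hm i hi)⟩

theorem lt_of_notMem_losers {ι : Type*} {S : Finset V} {N : Finset ι} {A : ι → Finset V}
    (hm : IsMMS G u S N A) {i : ι} (hi : i ∈ N)
    (h : i ∉ losers G u S N A) : maximinShare G u N.card S < u (A i) := by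
  refine lt_of_le_of_ne (hm i hi) fun h' => h ?_
  simp [losers, hi, h']

theorem exists_isSMMS {ι : Type*} {S : Finset V} {N : Finset ι} (hS : ConnBundle G S)
    (hN : N.Nonempty) : ∃ A : ι → Finset V, IsSMMS G u S N A := by
  classical
  have h : ∃ n, ∃ A : ι → Finset V, IsConnAlloc G S N A ∧ IsMMS G u S N A ∧
      (losers G u S N A).card = n := by
    obtain ⟨A, h1, h2⟩ := exists_maximinShare (u := u) hN (exists_connAlloc hS hN)
    exact ⟨_, A, h1, h2, rfl⟩
  obtain ⟨A, h1, h2, h3⟩ := Nat.find_spec h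
  exact ⟨A, h1, h2, fun B hB hB' => by rw [h3]; exact Nat.find_min' h ⟨B, hB, hB', rfl⟩⟩

theorem losers_congr {ι : Type*} {S : Finset V} {N : Finset ι} {A B : ι → Finset V}
    (hAB : ∀ i ∈ N, B i = A i) : losers G u S N B = losers G u S N A :=
  Finset.filter_congr fun i hi => by rw [hAB i hi]

theorem IsSMMS.congr {ι : Type*} {S : Finset V} {N : Finset ι} {A B : ι → Finset V}
    (h : IsSMMS G u S N A) (hAB : ∀ i ∈ N, B i = A i) : IsSMMS G u S N B where
  alloc := h.alloc.congr hAB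
  mms i hi := by rw [hAB i hi]; exact h.mms i hi
  minimal C hC hC' := by rw [losers_congr hAB]; exact h.minimal C hC hC'

theorem IsMMS.comp {ι κ : Type*} {S : Finset V} {N : Finset ι} {N' : Finset κ}
    {A : ι → Finset V} (h : IsMMS G u S N A) {e : κ → ι} (he : Set.BijOn e N' N) :
    IsMMS G u S N' fun i => A (e i) := fun i hi => by
  rw [card_eq_of_bijOn he]; exact h _ (he.mapsTo hi)

theorem card_losers_comp {ι κ : Type*} {S : Finset V} {N : Finset ι} {N' : Finset κ}
    {A : ι → Finset V} {e : κ → ι} (he : Set.BijOn e N' N) :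
    (losers G u S N' fun i => A (e i)).card = (losers G u S N A).card := by
  refine card_eq_of_bijOn (e := e) ⟨fun i hi => ?_, fun i hi j hj h => he.injOn ?_ ?_ h, ?_⟩
  · simp only [losers, Finset.coe_filter, Set.mem_ofPred_eq, card_eq_of_bijOn he] at hi ⊢
    exact ⟨he.mapsTo hi.1, hi.2⟩
  · exact Finset.mem_coe.2 (Finset.filter_subset _ _ hi)
  · exact Finset.mem_coe.2 (Finset.filter_subset _ _ hj)
  · intro i hi
    simp only [losers, Finset.coe_filter, Set.mem_ofPred_eq] at hi
    obtain ⟨j, hj, rfl⟩ := he.surjOn hi.1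
    exact ⟨j, by simpa [losers, card_eq_of_bijOn he] using ⟨hj, hi.2⟩, rfl⟩

theorem IsSMMS.comp {ι κ : Type*} {S : Finset V} {N : Finset ι} {N' : Finset κ}
    {A : ι → Finset V} (h : IsSMMS G u S N A) {e : κ → ι} (he : Set.BijOn e N' N)
    (hne : N'.Nonempty) : IsSMMS G u S N' fun i => A (e i) where
  alloc := h.alloc.comp he
  mms := h.mms.comp he
  minimal B hB hB' := by
    obtain ⟨d, hd, -⟩ := exists_bijOn_symm he hne
    rw [card_losers_comp he, ← card_losers_comp hd]
    exact h.minimal _ (hB.comp hd) (hB'.comp hd)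

theorem exists_pair_of_lt_maximinShare {X : Finset V} {r : ℝ} (hr : 0 ≤ r)
    (h : r < maximinShare G u 2 X) : ∃ Y Z : Finset V, ConnBundle G Y ∧ ConnBundle G Z ∧
      Disjoint Y Z ∧ Y ∪ Z = X ∧ r < u Y ∧ r < u Z := by
  have hne : {r : ℝ | ∃ A : Fin 2 → Finset V,
      IsConnAlloc G X (Finset.univ : Finset (Fin 2)) A ∧ r = ⨅ j, u (A j)}.Nonempty := by
    -- Without any allocation the supremum has the default value `0`, which `0 ≤ r` excludes.
    by_contra hne
    rw [Set.not_nonempty_iff_eq_empty] at hne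
    rw [maximinShare, hne, Real.sSup_empty] at h
    linarith
  obtain ⟨B, hB, hB'⟩ := hne.csSup_mem (finite_maximinShare_set (u := u) _ _)
  have hle : ∀ j, r < u (B j) := fun j =>
    lt_of_lt_of_le (h.trans_eq hB') (ciInf_le (Set.finite_range _).bddBelow _)
  refine ⟨B 0, B 1, hB.conn _ (by simp), hB.conn _ (by simp), hB.disj _ (by simp) _ (by simp)
    (by simp), ?_, hle 0, hle 1⟩
  rw [← hB.cover]; ext v; simp [Fin.exists_fin_two]

/-- In an SMMS allocation, no pair containing a loser can be improved. -/
theorem IsSMMS.pair_le {ι : Type*} {S : Finset V} {N : Finset ι} {A : ι → Finset V}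
    (h0 : ∀ X, 0 ≤ u X) (h : IsSMMS G u S N A) {i j : ι} (hi : i ∈ N) (hj : j ∈ N) (hij : i ≠ j)
    (hl : i ∈ losers G u S N A ∨ j ∈ losers G u S N A) :
    maximinShare G u 2 (A i ∪ A j) ≤ u (A i) := by
  classical
  by_contra! hlt
  -- Giving `Y` to `i` and `Z` to `j` lifts both above `u (A i)`, hence above the share, and leaves
  -- everybody else unchanged. As `i` or `j` was a loser, the number of losers drops.
  obtain ⟨Y, Z, hY, hZ, hYZ, hU, huY, huZ⟩ := exists_pair_of_lt_maximinShare (h0 _) hlt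
  have hμ := h.mms i hi
  set B : ι → Finset V := Function.update (Function.update A i Y) j Z with hB
  have hBi : B i = Y := by simp [hB, Function.update_of_ne hij]
  have hBj : B j = Z := by simp [hB]
  have hBo : ∀ l, l ≠ i → l ≠ j → B l = A l := fun l h1 h2 => by simp [hB, h1, h2]
  have hYs : Y ⊆ A i ∪ A j := hU ▸ Finset.subset_union_left
  have hZs : Z ⊆ A i ∪ A j := hU ▸ Finset.subset_union_right
  have hd : ∀ l ∈ N, l ≠ i → l ≠ j → ∀ W ⊆ A i ∪ A j, Disjoint W (A l) := fun l hl h1 h2 W hW =>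
    Finset.disjoint_of_subset_left hW (Finset.disjoint_union_left.2
      ⟨h.alloc.disj i hi l hl h1.symm, h.alloc.disj j hj l hl h2.symm⟩)
  have hBA : IsConnAlloc G S N B := by
    refine ⟨fun l hl => ?_, fun l hl l' hl' hll => ?_, ?_⟩
    · by_cases h1 : l = i
      · rw [h1, hBi]; exact hY
      by_cases h2 : l = j
      · rw [h2, hBj]; exact hZ
      rw [hBo l h1 h2]; exact h.alloc.conn l hl
    -- Only pairs in a normal order are treated, the changed agents first and `i` before `j`; the
    -- other order follows by symmetry.
    · have key : ∀ l ∈ N, ∀ l' ∈ N, l ≠ l' → (l' = i ∨ l' = j → l = i ∨ l = j) →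
          (l = j → l' ≠ i) → Disjoint (B l) (B l') := by
        intro l hl l' hl' hll hor hor2
        by_cases h1 : l = i
        · subst h1
          rw [hBi]
          by_cases h2 : l' = j
          · rw [h2, hBj]; exact hYZ
          · rw [hBo l' hll.symm h2]; exact hd l' hl' hll.symm h2 _ hYs
        by_cases h2 : l = j
        · subst h2
          rw [hBj, hBo l' (hor2 rfl) hll.symm]
          exact hd l' hl' (hor2 rfl) hll.symm _ hZs
        rw [hBo l h1 h2, hBo l' (by tauto) (by tauto)]
        exact h.alloc.disj l hl l' hl' hll
      by_cases hc : (l' = i ∨ l' = j → l = i ∨ l = j) ∧ (l = j → l' ≠ i)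
      · exact key l hl l' hl' hll hc.1 hc.2
      · refine (key l' hl' l hl hll.symm ?_ ?_).symm
        · intro h; by_contra h'; exact hc ⟨fun h'' => absurd h'' h', fun h1 h2 => h' (Or.inl h2)⟩
        · rintro rfl rfl; exact hc ⟨fun _ => Or.inl rfl, fun h => absurd h hij⟩
    · ext v
      rw [← h.alloc.cover]
      simp only [Finset.mem_biUnion]
      have hv : v ∈ Y ∨ v ∈ Z ↔ v ∈ A i ∨ v ∈ A j := by
        rw [← Finset.mem_union, hU, Finset.mem_union]
      constructor
      · rintro ⟨l, hl, hvl⟩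
        by_cases h1 : l = i
        · rw [h1, hBi] at hvl
          rcases hv.1 (Or.inl hvl) with h' | h'
          · exact ⟨i, hi, h'⟩
          · exact ⟨j, hj, h'⟩
        by_cases h2 : l = j
        · rw [h2, hBj] at hvl
          rcases hv.1 (Or.inr hvl) with h' | h'
          · exact ⟨i, hi, h'⟩
          · exact ⟨j, hj, h'⟩
        rw [hBo l h1 h2] at hvl
        exact ⟨l, hl, hvl⟩
      · rintro ⟨l, hl, hvl⟩
        by_cases h1 : l = i ∨ l = j
        · rcases hv.2 (by rcases h1 with rfl | rfl <;> tauto) with h' | h'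
          · exact ⟨i, hi, hBi ▸ h'⟩
          · exact ⟨j, hj, hBj ▸ h'⟩
        · rw [not_or] at h1
          exact ⟨l, hl, by rwa [hBo l h1.1 h1.2]⟩
  have hBM : IsMMS G u S N B := by
    intro l hl
    by_cases h1 : l = i
    · rw [h1, hBi]; linarith
    by_cases h2 : l = j
    · rw [h2, hBj]; linarith
    rw [hBo l h1 h2]; exact h.mms l hl
  have hsub : losers G u S N B ⊂ losers G u S N A := by
    have hni : i ∉ losers G u S N B := fun h' => by
      have := (Finset.mem_filter.1 h').2; rw [hBi] at this; linarith
    have hnj : j ∉ losers G u S N B := fun h' => by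
      have := (Finset.mem_filter.1 h').2; rw [hBj] at this; linarith
    refine Finset.ssubset_iff_subset_ne.2 ⟨fun l hl => ?_, fun he => ?_⟩
    · have h1 : l ≠ i := fun h => hni (h ▸ hl)
      have h2 : l ≠ j := fun h => hnj (h ▸ hl)
      simpa only [losers, Finset.mem_filter, hBo l h1 h2] using hl
    · rw [← he] at hl; tauto
  exact absurd (h.minimal B hBA hBM) (not_le.2 (Finset.card_lt_card hsub))

/-- The non-losers whose bundles lie in a component. -/
theorem component_agents {ι : Type*} {S : Finset V} {N : Finset ι} {A : ι → Finset V}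
    [DecidableEq ι] (h : IsConnAlloc G S N A) {L : Finset ι} (hL : L ⊆ N) {C : Finset V}
    (hC : IsComponent G (S \ L.biUnion A) C) :
    (N.filter fun i => i ∉ L ∧ A i ⊆ C).Nonempty ∧
      IsConnAlloc G C (N.filter fun i => i ∉ L ∧ A i ⊆ C) A := by
  -- The owner of a remaining vertex is not in `L`; its bundle is connected and avoids the deleted
  -- ones, so it cannot leave the component.
  have key : ∀ v ∈ C, ∃ i ∈ N.filter fun i => i ∉ L ∧ A i ⊆ C, v ∈ A i := by
    intro v hv
    have hvT := hC.1 hv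
    simp only [Finset.mem_sdiff, Finset.mem_biUnion, not_exists, not_and, ← h.cover] at hvT
    obtain ⟨⟨i, hi, hvi⟩, hn⟩ := hvT
    have hiL : i ∉ L := fun hL => hn i hL hvi
    refine ⟨i, Finset.mem_filter.2 ⟨hi, hiL, ?_⟩, hvi⟩
    refine hC.subset_of_inter ?_ (h.conn i hi) ⟨v, by simp [hvi, hv]⟩
    refine Finset.subset_sdiff.2 ⟨h.subset hi, ?_⟩
    rw [Finset.disjoint_biUnion_right]
    exact fun j hj => h.disj i hi j (hL hj) fun h => hiL (h ▸ hj)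
  refine ⟨?_, fun i hi => h.conn i (Finset.mem_filter.1 hi).1, fun i hi j hj =>
    h.disj i (Finset.mem_filter.1 hi).1 j (Finset.mem_filter.1 hj).1, ?_⟩
  · obtain ⟨v, hv⟩ := hC.2.1
    obtain ⟨i, hi, -⟩ := key v hv
    exact ⟨i, hi⟩
  · ext v
    rw [Finset.mem_biUnion]
    constructor
    · rintro ⟨i, hi, hv⟩; exact (Finset.mem_filter.1 hi).2.2 hv
    · exact key v

/-- Every result of the recursive algorithm is SMMS and PMMS. -/
theorem LoserRecursion.correct {ι : Type*} [DecidableEq ι] (h0 : ∀ X, 0 ≤ u X)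
    (hu : ∀ X, u ∅ ≤ u X) {S : Finset V} {N : Finset ι} {B : ι → Finset V}
    (h : LoserRecursion G u S N B) (hN : N.Nonempty) :
    IsSMMS G u S N B ∧ IsPMMS G u N B := by
  induction h with
  | @step S N A B smms fixed recurse ih =>
    set L := losers G u S N A with hL
    have hLN : L ⊆ N := Finset.filter_subset _ _
    set T := S \ L.biUnion A with hT
    have hsub : ∀ i ∈ N, i ∉ L → A i ⊆ T := fun i hi hiL => by
      refine Finset.subset_sdiff.2 ⟨smms.alloc.subset hi, ?_⟩
      rw [Finset.disjoint_biUnion_right]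
      exact fun j hj => smms.alloc.disj i hi j (hLN hj) fun h => hiL (h ▸ hj)
    have hC : ∀ i ∈ N, i ∉ L → ∃ C, IsComponent G T C ∧
        i ∈ N.filter fun i => i ∉ L ∧ A i ⊆ C := by
      intro i hi hiL
      have hne : (A i).Nonempty := by
        rw [Finset.nonempty_iff_ne_empty]
        exact fun h => hiL (mem_losers_of_empty hu smms.alloc smms.mms hi h)
      obtain ⟨C, hC, hAC⟩ := exists_component (smms.alloc.conn i hi) (hsub i hi hiL) hne
      exact ⟨C, hC, Finset.mem_filter.2 ⟨hi, hiL, hAC⟩⟩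
    have hih := fun C hC => ih C hC (component_agents smms.alloc hLN hC).1
    have hBC : ∀ C (hC : IsComponent G T C), ∀ i ∈ N.filter fun i => i ∉ L ∧ A i ⊆ C, B i ⊆ C :=
      fun C hC i hi => (hih C hC).1.alloc.subset hi
    -- The bundles `A j` inside `C` form an allocation of `C`, all of them above the share of `S`;
    -- so the share of `C` is above it too, and the recursive result is MMS on `C`.
    have hgt : ∀ i ∈ N, i ∉ L → maximinShare G u N.card S < u (B i) := by
      intro i hi hiL
      obtain ⟨C, hC, hiC⟩ := hC i hi hiL
      obtain ⟨hne, hAC⟩ := component_agents smms.alloc hLN hC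
      obtain ⟨j, hj, hmin⟩ := Finset.exists_min_image _ (fun i => u (A i)) hne
      have hj' := Finset.mem_filter.1 hj
      exact (lt_of_notMem_losers smms.mms hj'.1 hj'.2.1).trans_le
        ((le_maximinShare hAC hne hmin).trans ((hih C hC).1.mms i hiC))
    have halloc : IsConnAlloc G S N B := by
      refine ⟨fun i hi => ?_, ?_, ?_⟩
      · by_cases hiL : i ∈ L
        · rw [fixed i hiL]; exact smms.alloc.conn i hi
        · obtain ⟨C, hC, hiC⟩ := hC i hi hiL
          exact (hih C hC).1.alloc.conn i hiC
      · have h1 : ∀ i ∈ L, ∀ j ∈ N, j ∉ L → Disjoint (B i) (B j) := by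
          intro i hi j hj hjL
          obtain ⟨C, hC, hjC⟩ := hC j hj hjL
          rw [fixed i hi]
          refine Finset.disjoint_of_subset_right ((hBC C hC j hjC).trans hC.1) ?_
          exact Finset.disjoint_of_subset_left (Finset.subset_biUnion_of_mem A hi)
            Finset.sdiff_disjoint.symm
        intro i hi j hj hij
        by_cases hiL : i ∈ L <;> by_cases hjL : j ∈ L
        · rw [fixed i hiL, fixed j hjL]; exact smms.alloc.disj i hi j hj hij
        · exact h1 i hiL j hj hjL
        · exact (h1 j hjL i hi hiL).symm
        · obtain ⟨C, hC1, hiC⟩ := hC i hi hiL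
          obtain ⟨D, hD, hjD⟩ := hC j hj hjL
          by_cases hCD : (C ∩ D).Nonempty
          · obtain rfl := hC1.eq_of_inter hD hCD
            exact (hih C hC1).1.alloc.disj i hiC j hjD hij
          · rw [Finset.not_nonempty_iff_eq_empty, ← Finset.disjoint_iff_inter_eq_empty] at hCD
            exact Finset.disjoint_of_subset_left (hBC C hC1 i hiC)
              (Finset.disjoint_of_subset_right (hBC D hD j hjD) hCD)
      · ext v
        rw [Finset.mem_biUnion]
        constructor
        · rintro ⟨i, hi, hv⟩
          by_cases hiL : i ∈ L
          · rw [fixed i hiL] at hv; exact smms.alloc.subset hi hv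
          · obtain ⟨C, hC, hiC⟩ := hC i hi hiL
            exact Finset.sdiff_subset (hC.1 (hBC C hC i hiC hv))
        · intro hv
          by_cases hvL : v ∈ L.biUnion A
          · obtain ⟨i, hi, hvi⟩ := Finset.mem_biUnion.1 hvL
            exact ⟨i, hLN hi, by rwa [fixed i hi]⟩
          · obtain ⟨C, hC, hvC⟩ := exists_component (G := G) (T := T) (connBundle_singleton v)
              (Finset.singleton_subset_iff.2 (Finset.mem_sdiff.2 ⟨hv, hvL⟩))
              (Finset.singleton_nonempty v)
            rw [Finset.singleton_subset_iff, ← (hih C hC).1.alloc.cover, Finset.mem_biUnion] at hvC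
            obtain ⟨i, hi, hvi⟩ := hvC
            exact ⟨i, (Finset.mem_filter.1 hi).1, hvi⟩
    have hmms : IsMMS G u S N B := by
      intro i hi
      by_cases hiL : i ∈ L
      · rw [fixed i hiL]; exact smms.mms i hi
      · exact (hgt i hi hiL).le
    -- Having the same losers as `A`, the allocation `B` inherits the minimality of their number.
    have hlos : losers G u S N B = L := by
      ext i
      constructor
      · intro hi
        have hi' := Finset.mem_filter.1 hi
        by_contra hiL
        exact (hgt i hi'.1 hiL).ne' hi'.2
      · intro hi
        refine Finset.mem_filter.2 ⟨hLN hi, ?_⟩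
        rw [fixed i hi]
        exact (Finset.mem_filter.1 hi).2
    have hsmms : IsSMMS G u S N B := ⟨halloc, hmms, fun D hD hD' => by
      rw [hlos]; exact smms.minimal D hD hD'⟩
    refine ⟨hsmms, fun i hi j hj hij hor => ?_⟩
    by_cases hl : i ∈ L ∨ j ∈ L
    · exact hsmms.pair_le h0 hi hj hij (by rwa [hlos])
    rw [not_or] at hl
    obtain ⟨C, hC1, hiC⟩ := hC i hi hl.1
    obtain ⟨D, hD, hjD⟩ := hC j hj hl.2
    -- Two non-losers: an empty bundle is impossible, and an edge between the bundles forces a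
    -- common component, where the induction hypothesis applies.
    rcases hor with hor | ⟨v, hv, w, hw, hvw⟩
    · exact absurd (hlos ▸ mem_losers_of_empty hu halloc hmms hi hor) hl.1
    · obtain rfl := hC1.eq_of_adj hD (hBC C hC1 i hiC hv) (hBC D hD j hjD hw) hvw
      exact (hih C hC1).2 i hiC j hjD hij (Or.inr ⟨v, hv, w, hw, hvw⟩)

theorem LoserRecursion.congr {ι : Type*} [DecidableEq ι] {S : Finset V} {N : Finset ι}
    {B : ι → Finset V} (h : LoserRecursion G u S N B) {B' : ι → Finset V}
    (hB : ∀ i ∈ N, B' i = B i) : LoserRecursion G u S N B' := by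
  induction h with
  | @step S N A B smms fixed recurse ih =>
    refine .step smms (fun i hi => ?_) fun C hC => ?_
    · rw [hB i (Finset.filter_subset _ _ hi), fixed i hi]
    · exact ih C hC fun i hi => hB i (Finset.filter_subset _ _ hi)

/-- Induction on the number of agents, since a loser leaves in every call. The results for the
components can be glued because the bundle of a non-loser is non-empty and thus lies in only one
component. -/
theorem exists_loserRecursion {ι : Type*} [DecidableEq ι] (S : Finset V)
    (N : Finset ι) (hS : ConnBundle G S) (hN : N.Nonempty) (hu : ∀ X, u ∅ ≤ u X) :
    ∃ B : ι → Finset V, LoserRecursion G u S N B := by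
  classical
  induction hc : N.card using Nat.strong_induction_on generalizing S N with
  | _ k ih =>
    obtain ⟨A, hA⟩ := exists_isSMMS (u := u) hS hN
    set L := losers G u S N A with hL
    have hLN : L ⊆ N := Finset.filter_subset _ _
    have hB : ∀ C, IsComponent G (S \ L.biUnion A) C →
        ∃ B : ι → Finset V, LoserRecursion G u C (N.filter fun i => i ∉ L ∧ A i ⊆ C) B := by
      intro C hC
      refine ih _ ?_ C _ hC.2.2.1 (component_agents hA.alloc hLN hC).1 rfl
      rw [← hc]
      obtain ⟨i, hi⟩ := losers_nonempty hA.alloc hA.mms hN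
      refine Finset.card_lt_card (Finset.filter_ssubset.2 ⟨i, hLN hi, fun h => h.1 hi⟩)
    choose! B hB using hB
    refine ⟨fun i => if i ∈ L then A i else
      if h : ∃ C, IsComponent G (S \ L.biUnion A) C ∧ A i ⊆ C then B h.choose i else ∅,
      .step hA (fun i hi => if_pos hi) fun C hC => (hB C hC).congr fun i hi => ?_⟩
    obtain ⟨hi1, hi2, hi3⟩ := Finset.mem_filter.1 hi
    have h : ∃ C, IsComponent G (S \ L.biUnion A) C ∧ A i ⊆ C := ⟨C, hC, hi3⟩
    rw [if_neg hi2, dif_pos h]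
    have : h.choose = C := by
      refine h.choose_spec.1.eq_of_inter hC ?_
      have hne : (A i).Nonempty := by
        rw [Finset.nonempty_iff_ne_empty]
        exact fun h => hi2 (mem_losers_of_empty hu hA.alloc hA.mms hi1 h)
      exact hne.mono (Finset.subset_inter h.choose_spec.2 hi3)
    rw [this]

theorem connBundle_univ (hG : G.Connected) : ConnBundle G Finset.univ := by
  unfold ConnBundle
  rw [Finset.coe_univ]
  exact ((SimpleGraph.induceUnivIso G).symm.connected_iff.1 hG).preconnected

end

end FairDivision

-- The recursion as an iteration over components

namespace FairDivision

section

variable {V : Type*} [DecidableEq V] {G : SimpleGraph V}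

theorem ConnBundle.subset_of_closed {D X : Finset V} (hD : ConnBundle G D) {v : V} (hv : v ∈ D)
    (hvX : v ∈ X) (h : ∀ x ∈ D, x ∈ X → ∀ y ∈ D, G.Adj x y → y ∈ X) : D ⊆ X := by
  intro w hw
  have hr := hD ⟨v, by simpa⟩ ⟨w, by simpa⟩
  rw [SimpleGraph.reachable_iff_reflTransGen] at hr
  have : ∀ z : ((D : Set V) : Type _), Relation.ReflTransGen (G.induce (D : Set V)).Adj
      ⟨v, by simpa⟩ z → (z : V) ∈ X := by
    intro z hz
    induction hz with
    | refl => exact hvX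
    | @tail b c _ hyz ih => exact h b.1 (by simp) ih c.1 (by simp) hyz
  exact this _ hr

variable [Fintype V] {u : Finset V → ℝ} {ι : Type*} [DecidableEq ι]

/-- The vertices of an agent. -/
def fiber (ag : V → ι) (i : ι) : Finset V := Finset.univ.filter fun v => ag v = i

/-- The vertices whose agents are not finished. -/
def alive (ag : V → ι) (D : Finset ι) : Finset V := Finset.univ.filter fun v => ag v ∉ D

theorem mem_fiber {ag : V → ι} {i : ι} {v : V} : v ∈ fiber ag i ↔ ag v = i := by simp [fiber]

theorem mem_alive {ag : V → ι} {D : Finset ι} {v : V} : v ∈ alive ag D ↔ ag v ∉ D := by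
  simp [alive]

theorem fiber_subset_alive {ag : V → ι} {D : Finset ι} {i : ι} (hi : i ∉ D) :
    fiber ag i ⊆ alive ag D := fun v hv => by
  rw [mem_fiber] at hv; rw [mem_alive, hv]; exact hi

variable [Fintype ι]

/-- The agents who share a component of the remaining graph. -/
def active (ag : V → ι) (D : Finset ι) (C : Finset V) : Finset ι :=
  Finset.univ.filter fun i => i ∉ D ∧ fiber ag i ⊆ C

theorem mem_active {ag : V → ι} {D : Finset ι} {C : Finset V} {i : ι} :
    i ∈ active ag D C ↔ i ∉ D ∧ fiber ag i ⊆ C := by simp [active]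

/-- The invariant of the iterative form of the recursive algorithm: `D` is the set of finished
agents, and it remains to run the algorithm on the components of the remaining graph. -/
structure LoopInv (G : SimpleGraph V) (u : Finset V → ℝ) (ag : V → ι) (D : Finset ι) : Prop where
  conn : ∀ i ∉ D, ConnBundle G (fiber ag i)
  -- An empty bundle lies in every component, so its owner would be active in all of them. This
  -- happens only at the start, when there is just one component.
  empty : ∀ i ∉ D, fiber ag i = ∅ → ConnBundle G (alive ag D)
  -- The pending calls are recorded as an implication: every way to complete the components
  -- completes the run. No stack is needed.
  cont : ∀ B : ι → Finset V, (∀ i ∈ D, B i = fiber ag i) →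
    (∀ C, IsComponent G (alive ag D) C → LoserRecursion G u C (active ag D C) B) →
    LoserRecursion G u Finset.univ Finset.univ B

/-- Provisionally one agent holds everything. The only component is then the whole graph, and all
agents, the others with empty bundles, are active in it. -/
theorem LoopInv.init (hG : ConnBundle G (Finset.univ : Finset V)) (hne : Nonempty V) (i0 : ι) :
    LoopInv G u (fun _ : V => i0) ∅ := by
  have hT : alive (fun _ : V => i0) ∅ = Finset.univ := by ext; simp [mem_alive]
  refine ⟨fun i _ => ?_, fun _ _ _ => by rwa [hT], fun B _ h => ?_⟩
  · by_cases hi : i0 = i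
    · simpa [fiber, hi] using hG
    · simpa [fiber, hi] using connBundle_empty
  · have := h Finset.univ ⟨by rw [hT], Finset.univ_nonempty, hG, fun D hD _ _ =>
      Finset.univ_subset_iff.1 hD⟩
    simpa [active] using this

theorem LoopInv.final {ag : V → ι} {D : Finset ι} (h : LoopInv G u ag D) (hT : alive ag D = ∅) :
    LoserRecursion G u Finset.univ Finset.univ (fiber ag) := by
  refine h.cont _ (fun _ _ => rfl) fun C hC => ?_
  obtain ⟨v, hv⟩ := hC.2.1
  have := hC.1 hv
  simp [hT] at this

theorem LoopInv.active_nonempty {ag : V → ι} {D : Finset ι} (h : LoopInv G u ag D) {C : Finset V}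
    (hC : IsComponent G (alive ag D) C) {v : V} (hv : v ∈ C) : ag v ∈ active ag D C := by
  have hvD := mem_alive.1 (hC.1 hv)
  exact mem_active.2 ⟨hvD, hC.subset_of_inter (fiber_subset_alive hvD) (h.conn _ hvD)
    ⟨v, by simp [mem_fiber, hv]⟩⟩

/-- The new components are the other old ones, with the same active agents, and the components of
`C` without the losers' bundles. Hence the pending call on `C` may be replaced by the pending calls
on its pieces, which is one application of `LoserRecursion.step`. -/
theorem LoopInv.step (hu : ∀ X, u ∅ ≤ u X) {ag ag' : V → ι} {D : Finset ι}
    (h : LoopInv G u ag D) {C : Finset V} (hC : IsComponent G (alive ag D) C)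
    (hag : ∀ v ∉ C, ag' v = ag v)
    (hS : IsSMMS G u C (active ag D C) fun i => C.filter fun v => ag' v = i) :
    LoopInv G u ag' (D ∪ losers G u C (active ag D C) fun i => C.filter fun v => ag' v = i) := by
  set M := active ag D C with hM
  set A' : ι → Finset V := fun i => C.filter fun v => ag' v = i with hA'
  set L := losers G u C M A' with hL
  have hLM : L ⊆ M := Finset.filter_subset _ _
  have hmem : ∀ v ∈ C, ag' v ∈ M := by
    intro v hv
    rw [← hS.alloc.cover, Finset.mem_biUnion] at hv
    obtain ⟨i, hi, hvi⟩ := hv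
    rwa [(Finset.mem_filter.1 hvi).2]
  have hMD : ∀ i ∈ M, i ∉ D := fun i hi => (mem_active.1 hi).1
  have hfib : ∀ i ∈ M, fiber ag' i = A' i := by
    intro i hi
    ext v
    simp only [mem_fiber, hA', Finset.mem_filter]
    refine ⟨fun hv => ⟨?_, hv⟩, fun hv => hv.2⟩
    by_contra hvC
    rw [hag v hvC] at hv
    exact hvC ((mem_active.1 hi).2 (mem_fiber.2 hv))
  have hfib' : ∀ i ∉ M, fiber ag' i = fiber ag i := by
    intro i hi
    ext v
    simp only [mem_fiber]
    by_cases hv : v ∈ C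
    · have h1 : ag' v ≠ i := fun h => hi (h ▸ hmem v hv)
      have h2 : ag v ≠ i := fun h' => hi (h' ▸ h.active_nonempty hC hv)
      simp [h1, h2]
    · rw [hag v hv]
  have hT : ∀ v, v ∈ alive ag' (D ∪ L) ↔
      v ∈ alive ag D ∧ (v ∈ C → v ∈ C \ L.biUnion A') := by
    intro v
    by_cases hv : v ∈ C
    · have h1 := hMD _ (hmem v hv)
      have h2 := hC.1 hv
      simp only [mem_alive, Finset.mem_union, not_or, h1, not_false_eq_true, true_and, hv,
        forall_const, Finset.mem_sdiff, Finset.mem_biUnion, hA', Finset.mem_filter] at h2 ⊢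
      simp [h2]
    · have h1 : ag v ∉ M := fun h => hv ((mem_active.1 h).2 (mem_fiber.2 rfl))
      have h2 : ag v ∉ L := fun h => h1 (hLM h)
      simp [mem_alive, hag v hv, h2, hv]
  have hT' : alive ag' (D ∪ L) ⊆ alive ag D := fun v hv => ((hT v).1 hv).1
  have hcomp1 : ∀ E, IsComponent G (alive ag D) E → E ≠ C →
      IsComponent G (alive ag' (D ∪ L)) E := by
    intro E hE hne
    refine ⟨fun v hv => (hT v).2 ⟨hE.1 hv, fun hvC => ?_⟩, hE.2.1, hE.2.2.1, fun F h1 h2 h3 =>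
      hE.2.2.2 F h1 (h2.trans hT') h3⟩
    exact absurd (hE.eq_of_inter hC ⟨v, by simp [hv, hvC]⟩) hne
  have hcomp2 : ∀ E, IsComponent G (C \ L.biUnion A') E →
      IsComponent G (alive ag' (D ∪ L)) E := by
    intro E hE
    refine ⟨fun v hv => (hT v).2 ⟨hC.1 (Finset.sdiff_subset (hE.1 hv)), fun _ => hE.1 hv⟩,
      hE.2.1, hE.2.2.1, fun F h1 h2 h3 => hE.2.2.2 F h1 (fun v hv => ?_) h3⟩
    refine ((hT v).1 (h2 hv)).2 (hC.subset_of_inter (h2.trans hT') h3 ?_ hv)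
    obtain ⟨x, hx⟩ := hE.2.1
    exact ⟨x, Finset.mem_inter.2 ⟨h1 hx, Finset.sdiff_subset (hE.1 hx)⟩⟩
  have hloser : ∀ i ∈ M, A' i = ∅ → i ∈ L := fun i hi h =>
    mem_losers_of_empty hu hS.alloc hS.mms hi h
  refine ⟨fun i hi => ?_, fun i hi he => ?_, fun B hB hrec => h.cont B (fun i hi => ?_)
    fun E hE => ?_⟩
  · rw [Finset.mem_union, not_or] at hi
    by_cases hiM : i ∈ M
    · rw [hfib i hiM]; exact hS.alloc.conn i hiM
    · rw [hfib' i hiM]; exact h.conn i hi.1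
  · rw [Finset.mem_union, not_or] at hi
    -- After a round no unfinished agent has an empty bundle: inside `M` such an agent is a loser,
    -- and outside `M` it would have been active in `C`.
    exfalso
    by_cases hiM : i ∈ M
    · rw [hfib i hiM] at he
      exact hi.2 (hloser i hiM he)
    · rw [hfib' i hiM] at he
      exact hiM (mem_active.2 ⟨hi.1, by simp [he]⟩)
  · rw [hB i (Finset.mem_union_left _ hi), hfib' i fun hiM => hMD i hiM hi]
  · by_cases hEC : E = C
    · subst hEC
      refine .step hS (fun i hi => ?_) fun F hF => ?_
      · rw [hB i (Finset.mem_union_right _ hi), hfib i (hLM hi)]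
      · convert hrec F (hcomp2 F hF) using 1
        ext i
        constructor
        · intro hi
          obtain ⟨h1, h2, h3⟩ := Finset.mem_filter.1 hi
          refine mem_active.2 ⟨?_, by rwa [hfib i h1]⟩
          rw [Finset.mem_union, not_or]
          exact ⟨hMD i h1, h2⟩
        · intro hi
          obtain ⟨h1, h3⟩ := mem_active.1 hi
          rw [Finset.mem_union, not_or] at h1
          have hiM : i ∈ M := by
            by_contra hiM
            rw [hfib' i hiM] at h3
            exact hiM (mem_active.2 ⟨h1.1, h3.trans (hF.1.trans Finset.sdiff_subset)⟩)
          exact Finset.mem_filter.2 ⟨hiM, h1.2, by rwa [hfib i hiM] at h3⟩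
    · convert hrec E (hcomp1 E hE hEC) using 1
      have hdisj : ∀ X : Finset V, X ⊆ E → X ⊆ C → X = ∅ := by
        intro X h1 h2
        by_contra hX
        obtain ⟨x, hx⟩ := Finset.nonempty_iff_ne_empty.2 hX
        exact hEC (hE.eq_of_inter hC ⟨x, by simp [h1 hx, h2 hx]⟩)
      ext i
      simp only [mem_active, Finset.mem_union, not_or]
      constructor
      · rintro ⟨h1, h3⟩
        have hiM : i ∉ M := fun hiM => by
          -- An agent active in both `E` and `C` has an empty bundle, and then the remaining graph
          -- has only one component.
          have h0 := h.empty i h1 (hdisj _ h3 (mem_active.1 hiM).2)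
          exact hEC ((component_of_conn h0 hE).trans (component_of_conn h0 hC).symm)
        exact ⟨⟨h1, fun h => hiM (hLM h)⟩, by rwa [hfib' i hiM]⟩
      · rintro ⟨⟨h1, h2⟩, h3⟩
        have hiM : i ∉ M := fun hiM => by
          rw [hfib i hiM] at h3
          exact h2 (hloser i hiM (hdisj _ h3 (Finset.filter_subset _ _)))
        exact ⟨h1, by rwa [hfib' i hiM] at h3⟩

open Classical in
/-- One round of a search inside `T`. -/
noncomputable def expand (G : SimpleGraph V) (T R : Finset V) : Finset V :=
  T.filter fun v => v ∈ R ∨ ∃ w, G.Adj w v ∧ w ∈ R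

/-- The sets reached grow until they stop for good, which cardinality forces within `N` rounds. They
are connected throughout, and the final one is closed under adjacency in `T`, hence a maximal
connected set. -/
theorem isComponent_iterate_expand {T : Finset V} {v : V} (hv : v ∈ T) {N : ℕ}
    (hN : Fintype.card V ≤ N) : IsComponent G T ((expand G T)^[N] {v}) ∧
      v ∈ (expand G T)^[N] {v} := by
  classical
  set R : ℕ → Finset V := fun t => (expand G T)^[t] {v} with hR
  have hsucc : ∀ t, R (t + 1) = expand G T (R t) := fun t => Function.iterate_succ_apply' _ _ _
  have hRT : ∀ t, R t ⊆ T := by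
    intro t
    cases t with
    | zero => simpa [hR] using hv
    | succ t => rw [hsucc]; exact Finset.filter_subset _ _
  have hmono : ∀ t, R t ⊆ R (t + 1) := fun t x hx => by
    rw [hsucc]; exact Finset.mem_filter.2 ⟨hRT t hx, Or.inl hx⟩
  have hvR : ∀ t, v ∈ R t := by
    intro t
    induction t with
    | zero => simp [hR]
    | succ t ih => exact hmono t ih
  have hconn : ∀ t, ConnBundle G (R t) := by
    intro t
    induction t with
    | zero => exact connBundle_singleton v
    | succ t ih =>
      have key : ∀ Y ⊆ R (t + 1), ConnBundle G (R t ∪ Y) := by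
        intro Y
        induction Y using Finset.induction_on with
        | empty => intro _; simpa using ih
        | insert y Y hy ihY =>
          intro hY
          rw [Finset.insert_subset_iff] at hY
          have h1 := ihY hY.2
          rw [Finset.union_insert, ← Finset.union_singleton]
          have hy1 := hY.1
          rw [hsucc] at hy1
          rcases (Finset.mem_filter.1 hy1).2 with h | ⟨w, hwy, hw⟩
          · exact h1.union (connBundle_singleton y) ⟨y, by simp [h]⟩
          · exact h1.union_of_adj (connBundle_singleton y) (Finset.mem_union_left _ hw)
              (Finset.mem_singleton_self y) hwy
      have := key _ subset_rfl
      rwa [Finset.union_eq_right.2 (hmono t)] at this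
  have hfix : ∃ t ≤ N, R (t + 1) = R t := by
    by_contra! hne
    have hcard : ∀ t ≤ N + 1, t + 1 ≤ (R t).card := by
      intro t
      induction t with
      | zero => intro _; simp [hR]
      | succ t ih =>
        intro ht
        have := Finset.card_lt_card ((hmono t).ssubset_of_ne (hne t (by omega)).symm)
        have := ih (by omega)
        omega
    have := hcard (N + 1) le_rfl
    have := Finset.card_le_univ (R (N + 1))
    omega
  obtain ⟨t, ht, hfix⟩ := hfix
  have hstay : ∀ d, R (t + d) = R t := by
    intro d
    induction d with
    | zero => rfl
    | succ d ih => rw [← add_assoc, hsucc, ih, ← hsucc, hfix]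
  have hRN : R N = R t := by
    have := hstay (N - t)
    rwa [Nat.add_sub_cancel' ht] at this
  change IsComponent G T (R N) ∧ v ∈ R N
  rw [hRN]
  refine ⟨⟨hRT t, ⟨v, hvR t⟩, hconn t, fun D h1 h2 h3 => (h1.antisymm ?_).symm⟩, hvR t⟩
  refine h3.subset_of_closed (h1 (hvR t)) (hvR t) fun x _ hx y hy hxy => ?_
  rw [← hfix, hsucc]
  exact Finset.mem_filter.2 ⟨h2 hy, Or.inr ⟨x, hxy, hx⟩⟩

/-- Lets a program recognise the losers by comparing utilities, without knowing the share. -/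
theorem loser_iff_min {S : Finset V} {N : Finset ι} {A : ι → Finset V}
    (hA : IsConnAlloc G S N A) (hm : IsMMS G u S N A) {i : ι} (hi : i ∈ N) :
    i ∈ losers G u S N A ↔ ∀ j ∈ N, u (A i) ≤ u (A j) := by
  constructor
  · intro h j hj
    rw [(Finset.mem_filter.1 h).2]
    exact hm j hj
  · intro h
    exact Finset.mem_filter.2 ⟨hi, (le_maximinShare hA ⟨i, hi⟩ h).antisymm (hm i hi)⟩

end

/-- The number of elements of `M` whose key is smaller than `x`. -/
def rankBelow {α β : Type*} [LinearOrder β] (key : α → β) (M : Finset α) (x : β) : ℕ :=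
  (M.filter fun j => key j < x).card

/-- The rank is strictly monotone in the key. It translates between active agents, or cuts, and the
labels `0, …, k - 1`. -/
theorem bijOn_rankBelow {α β : Type*} [LinearOrder β] {key : α → β} {M : Finset α}
    (hinj : Set.InjOn key M) :
    Set.BijOn (fun i => rankBelow key M (key i)) M (Finset.range M.card) := by
  classical
  have hmaps : Set.MapsTo (fun i => rankBelow key M (key i)) (M : Set α) (Finset.range M.card) := by
    intro i hi
    rw [Finset.mem_coe, Finset.mem_range]
    exact Finset.card_lt_card (Finset.filter_ssubset.2 ⟨i, hi, lt_irrefl _⟩)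
  have hlt : ∀ i ∈ M, ∀ j ∈ M, key i < key j →
      rankBelow key M (key i) < rankBelow key M (key j) := by
    intro i hi j hj hij
    refine Finset.card_lt_card (Finset.ssubset_iff_subset_ne.2 ⟨fun l hl => ?_, fun he => ?_⟩)
    · rw [Finset.mem_filter] at hl ⊢
      exact ⟨hl.1, hl.2.trans hij⟩
    · have : i ∈ M.filter fun l => key l < key j := Finset.mem_filter.2 ⟨hi, hij⟩
      rw [← he] at this
      exact lt_irrefl _ (Finset.mem_filter.1 this).2
  have hi : Set.InjOn (fun i => rankBelow key M (key i)) (M : Set α) := by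
    intro i hi j hj h
    refine hinj hi hj ?_
    rcases lt_trichotomy (key i) (key j) with h' | h' | h'
    · exact absurd h (hlt i hi j hj h').ne
    · exact h'
    · exact absurd h (hlt j hj i hi h').ne'
  refine ⟨hmaps, hi, ?_⟩
  exact Finset.surjOn_of_injOn_of_card_le _ hmaps hi (by simp)

theorem sum_range_indicator {n N : ℕ} (hn : n ≤ N) {f : ℕ → ℕ} {M : Finset (Fin n)}
    (hf : ∀ i : Fin n, f i = if i ∈ M then 1 else 0) (h0 : ∀ i, n ≤ i → i < N → f i = 0) :
    ∑ i ∈ Finset.range N, f i = M.card := by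
  rw [← Finset.sum_subset (Finset.range_subset_range.2 hn) fun i hi hi' =>
    h0 i (by simpa using hi') (by simpa using hi), Finset.sum_range]
  simp [hf]

end FairDivision

-- Derived conditions and expressions

namespace RAM

attribute [simp] NEx.val REx.val BEx.Holds Stm.natW Stm.realW

def BEx.or (b c : BEx) : BEx := .not (.and (.not b) (.not c))
def BEx.eq (e f : NEx) : BEx := .and (.not (.nlt e f)) (.not (.nlt f e))
def BEx.ex (x : ℕ) (b : BEx) : BEx := .nlt (.first x b) .bound
def BEx.all (x : ℕ) (b : BEx) : BEx := .not (.ex x (.not b))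
def BEx.imp (b c : BEx) : BEx := .not (.and b (.not c))
/-- Cell `e` of row `0`. -/
def NEx.row (a : ℕ) (e : NEx) : NEx := .cell a (.const 0) e
def REx.row (a : ℕ) (e : NEx) : REx := .cell a (.const 0) e
def BEx.toNat (b : BEx) : NEx := .ite b (.const 1) (.const 0)

section

variable {N : ℕ} {σ : Mem} {ε : ℕ → ℕ}

@[simp] theorem BEx.holds_or (b c : BEx) :
    (b.or c).Holds N σ ε ↔ b.Holds N σ ε ∨ c.Holds N σ ε := by
  simp only [BEx.or, BEx.Holds]; tauto

@[simp] theorem BEx.holds_imp (b c : BEx) :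
    (b.imp c).Holds N σ ε ↔ (b.Holds N σ ε → c.Holds N σ ε) := by
  simp only [BEx.imp, BEx.Holds]; tauto

@[simp] theorem BEx.holds_eq (e f : NEx) :
    (BEx.eq e f).Holds N σ ε ↔ e.val N σ ε = f.val N σ ε := by
  simp only [BEx.eq, BEx.Holds]; omega

@[simp] theorem BEx.holds_ex (x : ℕ) (b : BEx) :
    (BEx.ex x b).Holds N σ ε ↔ ∃ i < N, b.Holds N σ (Function.update ε x i) := by
  simp only [BEx.ex, BEx.Holds, NEx.val, firstIdx_lt_iff]

@[simp] theorem BEx.holds_all (x : ℕ) (b : BEx) :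
    (BEx.all x b).Holds N σ ε ↔ ∀ i < N, b.Holds N σ (Function.update ε x i) := by
  simp [BEx.all]

@[simp] theorem NEx.val_row (a : ℕ) (e : NEx) :
    (NEx.row a e).val N σ ε = σ.nat a 0 (e.val N σ ε) := by simp [NEx.row]

@[simp] theorem REx.val_row (a : ℕ) (e : NEx) :
    (REx.row a e).val N σ ε = σ.real a 0 (e.val N σ ε) := by simp [REx.row]

open Classical in
@[simp] theorem BEx.val_toNat (b : BEx) :
    b.toNat.val N σ ε = if b.Holds N σ ε then 1 else 0 := by simp [BEx.toNat]

@[simp] theorem ij_zero (i j : ℕ) : ij i j 0 = i := by simp [ij]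
@[simp] theorem ij_one (i j : ℕ) : ij i j 1 = j := by simp [ij]

variable {Q : Type} {O : Q → Mem → Mem}

theorem Stm.den_tabN_apply {a : ℕ} {e : NEx} {i j : ℕ} (hi : i < N) (hj : j < N) :
    ((Stm.tabN a e).den O N σ).nat a i j = e.val N σ (ij i j) := by
  simp [Stm.den, Mem.tabN, hi, hj]

theorem Stm.den_tabR_apply {a : ℕ} {e : REx} {i j : ℕ} (hi : i < N) (hj : j < N) :
    ((Stm.tabR a e).den O N σ).real a i j = e.val N σ (ij i j) := by
  simp [Stm.den, Mem.tabR, hi, hj]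

theorem Stm.den_seq {c d : Stm Q} : (c.seq d).den O N σ = d.den O N (c.den O N σ) := rfl

end

end RAM

/-! ### The iterative form of the recursive algorithm as a program -/

namespace FairDivision

open RAM

/-- The numbers `f 0, …, f (N - 1)` are the indicator function of `C`. -/
def Ind {m : ℕ} (N : ℕ) (f : ℕ → ℕ) (C : Finset (Fin m)) : Prop :=
  ∀ v < N, f v = if ∃ w ∈ C, (w : ℕ) = v then 1 else 0

theorem Ind.apply {m N : ℕ} {f : ℕ → ℕ} {C : Finset (Fin m)} (h : Ind N f C) (hN : m ≤ N)
    (v : Fin m) : f v = if v ∈ C then 1 else 0 := by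
  rw [h v (v.2.trans_le hN)]
  congr 1
  simp only [Fin.val_inj, exists_eq_right]

theorem Ind.pos {m N : ℕ} {f : ℕ → ℕ} {C : Finset (Fin m)} (h : Ind N f C) {v : ℕ} (hv : v < N) :
    0 < f v ↔ ∃ w ∈ C, (w : ℕ) = v := by
  rw [h v hv]; split_ifs with h' <;> simp [h']

theorem Ind.sum {m N : ℕ} {f : ℕ → ℕ} {C : Finset (Fin m)} (h : Ind N f C) (hN : m ≤ N) :
    ∑ i ∈ Finset.range N, f i = C.card := by
  refine sum_range_indicator hN (h.apply hN) fun i hi hiN => ?_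
  rw [h i hiN, if_neg]
  rintro ⟨w, -, hw⟩
  omega

theorem Ind.rank {m N : ℕ} {f : ℕ → ℕ} {C : Finset (Fin m)} (h : Ind N f C) (hN : m ≤ N) (x : ℕ) :
    ∑ i ∈ Finset.range N, (if i < x then f i else 0) =
      rankBelow (fun j : Fin m => (j : ℕ)) C x := by
  refine Ind.sum (C := C.filter fun j => (j : ℕ) < x) (fun v hv => ?_) hN
  rw [h v hv]
  by_cases hvx : v < x
  · rw [if_pos hvx]
    congr 1
    simp only [Finset.mem_filter, eq_iff_iff]
    exact ⟨fun ⟨w, h1, h2⟩ => ⟨w, ⟨h1, by omega⟩, h2⟩, fun ⟨w, h1, h2⟩ => ⟨w, h1.1, h2⟩⟩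
  · rw [if_neg hvx, if_neg]
    rintro ⟨w, h1, h2⟩
    have := (Finset.mem_filter.1 h1).2
    omega

/-- The memory contains the input. -/
structure HasInput {m : ℕ} (G : SimpleGraph (Fin m)) (n : ℕ) (w : Fin m → ℝ) (σ : Mem) : Prop where
  size : σ.nat 0 = (inputMem G n w).nat 0
  adj : σ.nat 1 = (inputMem G n w).nat 1
  weight : σ.real 0 = (inputMem G n w).real 0

section

variable {m n : ℕ} {G : SimpleGraph (Fin m)} {w : Fin m → ℝ} {σ σ' : Mem}

theorem HasInput.m_eq (h : HasInput G n w σ) : σ.nat 0 0 0 = m := by simp [h.size, inputMem]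
theorem HasInput.n_eq (h : HasInput G n w σ) : σ.nat 0 0 1 = n := by simp [h.size, inputMem]
theorem HasInput.adj_eq (h : HasInput G n w σ) (i j : ℕ) :
    σ.nat 1 i j = 1 ↔ ∃ v w : Fin m, (v : ℕ) = i ∧ (w : ℕ) = j ∧ G.Adj v w := by
  simp [h.adj, inputMem]

theorem HasInput.congr (h : HasInput G n w σ) (h0 : σ'.nat 0 = σ.nat 0) (h1 : σ'.nat 1 = σ.nat 1)
    (h2 : σ'.real 0 = σ.real 0) : HasInput G n w σ' :=
  ⟨h0.trans h.size, h1.trans h.adj, h2.trans h.weight⟩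

/-- The memory stores the agents of the vertices and the set of finished agents. -/
structure Stores (G : SimpleGraph (Fin m)) (n : ℕ) (w : Fin m → ℝ) (σ : Mem) (ag : Fin m → Fin n)
    (D : Finset (Fin n)) : Prop where
  input : HasInput G n w σ
  agent : ∀ v : Fin m, σ.nat 2 0 v = ag v
  done : ∀ i : Fin n, σ.nat 10 0 i = if i ∈ D then 1 else 0

theorem Stores.congr {ag : Fin m → Fin n} {D : Finset (Fin n)} (h : Stores G n w σ ag D)
    (h0 : ∀ a ∈ [0, 1, 2, 10], σ'.nat a = σ.nat a) (h2 : σ'.real 0 = σ.real 0) :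
    Stores G n w σ' ag D :=
  ⟨h.input.congr (h0 0 (by simp)) (h0 1 (by simp)) h2, fun v => by rw [h0 2 (by simp), h.agent],
    fun i => by rw [h0 10 (by simp), h.done]⟩

/-- Use of the arrays in the main loop: `2` the current agents, `3` the query set, `4` the number of
agents of the query, `5` the labels in the answer, `10` the finished agents (natural numbers) and
the utilities of the labels (reals), `11` the current component, `12` the active agents, `13` their
list. -/
def nV : NEx := .cell 0 (.const 0) (.const 0)
def nA : NEx := .cell 0 (.const 0) (.const 1)
/-- The agent of vertex `e` is not finished. -/
def aliveB (e : NEx) : BEx := .and (.nlt e nV) (.eq (.row 10 (.row 2 e)) (.const 0))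

theorem holds_aliveB {N : ℕ} {ε : ℕ → ℕ} {e : NEx} {ag : Fin m → Fin n} {D : Finset (Fin n)}
    (h : Stores G n w σ ag D) :
    (aliveB e).Holds N σ ε ↔ ∃ v ∈ alive ag D, (v : ℕ) = e.val N σ ε := by
  simp only [aliveB, BEx.Holds, nV, NEx.val, h.input.m_eq, BEx.holds_eq, NEx.val_row]
  constructor
  · rintro ⟨h1, h2⟩
    refine ⟨⟨_, h1⟩, mem_alive.2 fun hD => ?_, rfl⟩
    have h3 := h.agent ⟨_, h1⟩
    rw [h3, h.done, if_pos hD] at h2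
    omega
  · rintro ⟨v, hv, hve⟩
    rw [← hve]
    refine ⟨v.2, ?_⟩
    rw [h.agent, h.done, if_neg (mem_alive.1 hv)]

variable {Q : Type} {O : Q → Mem → Mem}

/-- A table reads the old contents of array `11` throughout, so one assignment is exactly one round
of `expand`. -/
def expandStm : Stm Q := .tabN 11 (BEx.toNat (.and (aliveB (.var 1))
  (.or (.nlt (.const 0) (.row 11 (.var 1)))
    (.ex 2 (.and (.eq (.cell 1 (.var 2) (.var 1)) (.const 1))
      (.nlt (.const 0) (.row 11 (.var 2))))))))

@[simp] theorem natW_expandStm : (expandStm : Stm Q).natW = [11] := rfl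
@[simp] theorem realW_expandStm : (expandStm : Stm Q).realW = [] := rfl

/-- Compute the component of the first unfinished vertex. -/
def compStm : Stm Q := .seq
  (.tabN 11 (BEx.toNat (.eq (.var 1) (.first 2 (aliveB (.var 2)))))) (.rep expandStm)

@[simp] theorem natW_compStm : (compStm : Stm Q).natW = [11, 11] := rfl
@[simp] theorem realW_compStm : (compStm : Stm Q).realW = [] := rfl

theorem expandStm_spec {N : ℕ} (hN : m ≤ N) {ag : Fin m → Fin n} {D : Finset (Fin n)}
    (h : Stores G n w σ ag D) {R : Finset (Fin m)} (hR : Ind N (σ.nat 11 0) R) :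
    Ind N (((expandStm : Stm Q).den O N σ).nat 11 0) (expand G (alive ag D) R) := by
  classical
  intro v hv
  rw [expandStm, Stm.den_tabN_apply (by omega) hv, BEx.val_toNat]
  refine if_congr ?_ rfl rfl
  simp only [BEx.Holds, BEx.holds_or, BEx.holds_ex, BEx.holds_eq, NEx.val, NEx.val_row,
    holds_aliveB h, ij_one, h.input.adj_eq, Function.update_self, expand, Finset.mem_filter]
  have e1 : ∀ i, Function.update (ij 0 v) 2 i 1 = v := fun i => by simp
  simp only [e1, hR.pos hv]
  constructor
  · rintro ⟨⟨x, hx, rfl⟩, h' | ⟨i, hi, ⟨y, x', rfl, hx', hadj⟩, hi'⟩⟩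
    · obtain ⟨y, hy, hyx⟩ := h'
      obtain rfl : y = x := Fin.ext hyx
      exact ⟨y, ⟨hx, Or.inl hy⟩, rfl⟩
    · obtain rfl : x' = x := Fin.ext hx'
      obtain ⟨y', hy', hyy⟩ := (hR.pos hi).1 hi'
      obtain rfl : y' = y := Fin.ext hyy
      exact ⟨x', ⟨hx, Or.inr ⟨y', hadj, hy'⟩⟩, rfl⟩
  · rintro ⟨x, ⟨hx, h'⟩, rfl⟩
    refine ⟨⟨x, hx, rfl⟩, ?_⟩
    rcases h' with h' | ⟨y, hadj, hy⟩
    · exact Or.inl ⟨x, h', rfl⟩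
    · exact Or.inr ⟨y, by omega, ⟨y, x, rfl, rfl, hadj⟩, (hR.pos (by omega)).2 ⟨y, hy, rfl⟩⟩

theorem compStm_spec (hO : OracleFrame O) {N : ℕ} (hN : m ≤ N) {ag : Fin m → Fin n}
    {D : Finset (Fin n)} (h : Stores G n w σ ag D) (hT : (alive ag D).Nonempty) :
    ∃ C, IsComponent G (alive ag D) C ∧
      Ind N (((compStm : Stm Q).den O N σ).nat 11 0) C := by
  classical
  obtain ⟨v1, hv1⟩ := hT
  set p : ℕ → Prop := fun i => ∃ v ∈ alive ag D, (v : ℕ) = i with hp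
  have hlt : firstIdx p N < N := firstIdx_lt_iff.2 ⟨v1, by omega, v1, hv1, rfl⟩
  obtain ⟨v0, hv0, hv0'⟩ := firstIdx_spec hlt
  refine ⟨_, (isComponent_iterate_expand (G := G) hv0 (N := N) (by simpa using hN)).1, ?_⟩
  rw [compStm, Stm.den_seq]
  set σ1 := (Stm.tabN 11 (BEx.toNat (.eq (.var 1) (.first 2 (aliveB (.var 2)))))).den O N σ with hσ1
  have hI : Ind N (σ1.nat 11 0) {v0} := by
    intro v hv
    rw [hσ1, Stm.den_tabN_apply (by omega) hv, BEx.val_toNat]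
    refine if_congr ?_ rfl rfl
    simp only [BEx.holds_eq, NEx.val, holds_aliveB h, Function.update_self, ij_one]
    rw [← hp, ← hv0']
    simp [eq_comm]
  have hS1 : Stores G n w σ1 ag D := h.congr
    (fun a ha => Stm.den_nat hO _ _ _ _ (by revert a; simp)) rfl
  rw [Stm.den]
  have key : ∀ t, Stores G n w (((expandStm : Stm Q).den O N)^[t] σ1) ag D ∧
      Ind N ((((expandStm : Stm Q).den O N)^[t] σ1).nat 11 0) ((expand G (alive ag D))^[t] {v0}) := by
    intro t
    induction t with
    | zero => exact ⟨hS1, hI⟩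
    | succ t ih =>
      rw [Function.iterate_succ_apply', Function.iterate_succ_apply']
      exact ⟨ih.1.congr (fun a ha => Stm.den_nat hO _ _ _ _ (by revert a; simp)) rfl,
        expandStm_spec hN ih.1 ih.2⟩
  exact (key N).2

/-- The number of active agents before agent `e`. -/
def rankE (e : NEx) : NEx := .sum 3 (.ite (.nlt (.var 3) e) (.row 12 (.var 3)) (.const 0))

/-- Compute the query set, the active agents, their number and their list. -/
def agentsStm : Stm Q := .seq (.tabN 3 (.row 11 (.var 1))) (.seq
  (.tabN 12 (BEx.toNat (.and (.nlt (.var 1) nA) (.and (.eq (.row 10 (.var 1)) (.const 0))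
    (.all 2 (.imp (.and (.nlt (.var 2) nV) (.eq (.row 2 (.var 2)) (.var 1)))
      (.nlt (.const 0) (.row 11 (.var 2)))))))))
  (.seq (.tabN 4 (.sum 2 (.row 12 (.var 2))))
    -- The inverse of the rank: cell `r` receives the active agent of rank `r`, which turns a label
    -- back into an agent.
    (.tabN 13 (.first 2 (.and (.eq (.row 12 (.var 2)) (.const 1)) (.eq (rankE (.var 2)) (.var 1)))))))

@[simp] theorem natW_agentsStm : (agentsStm : Stm Q).natW = [3, 12, 4, 13] := rfl
@[simp] theorem realW_agentsStm : (agentsStm : Stm Q).realW = [] := rfl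

/-- The number of active agents before agent `i`. -/
abbrev agentRank (M : Finset (Fin n)) (i : ℕ) : ℕ := rankBelow (fun j : Fin n => (j : ℕ)) M i

theorem bijOn_agentRank (M : Finset (Fin n)) :
    Set.BijOn (fun i : Fin n => agentRank M i) M (Finset.range M.card) :=
  bijOn_rankBelow (key := fun j : Fin n => (j : ℕ)) fun _ _ _ _ h => Fin.ext h

theorem val_rankE {N : ℕ} (hN : n ≤ N) {M : Finset (Fin n)} (h : Ind N (σ.nat 12 0) M) {e : NEx}
    {ε : ℕ → ℕ} (he : ∀ i, e.val N σ (Function.update ε 3 i) = e.val N σ ε) :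
    (rankE e).val N σ ε = agentRank M (e.val N σ ε) := by
  classical
  rw [agentRank, ← h.rank hN]
  simp only [rankE, NEx.val, BEx.Holds, he, Function.update_self, NEx.val_row]

theorem agentsStm_spec (hO : OracleFrame O) {N : ℕ} (hmN : m < N) (hnN : n < N)
    {ag : Fin m → Fin n} {D : Finset (Fin n)} (h : Stores G n w σ ag D) {C : Finset (Fin m)}
    (hC : Ind N (σ.nat 11 0) C) {σ' : Mem} (hσ' : σ' = (agentsStm : Stm Q).den O N σ) :
    Ind N (σ'.nat 3 0) C ∧ Ind N (σ'.nat 12 0) (active ag D C) ∧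
      σ'.nat 4 0 0 = (active ag D C).card ∧
      ∀ i ∈ active ag D C, σ'.nat 13 0 (agentRank (active ag D C) i) = i := by
  classical
  set M := active ag D C with hM
  rw [agentsStm, Stm.den_seq, Stm.den_seq, Stm.den_seq] at hσ'
  set σ1 := (Stm.tabN 3 (.row 11 (.var 1)) : Stm Q).den O N σ with h1
  set σ2 := Stm.den O N _ σ1 with h2
  set σ3 := Stm.den O N _ σ2 with h3
  have hS1 : Stores G n w σ1 ag D := h.congr
    (fun a ha => Stm.den_nat hO _ _ _ _ (by revert a; simp)) rfl
  have hC1 : Ind N (σ1.nat 11 0) C := by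
    rw [show σ1.nat 11 = σ.nat 11 from Stm.den_nat hO _ _ _ _ (by simp)]; exact hC
  have hq : Ind N (σ1.nat 3 0) C := by
    intro v hv
    rw [h1, Stm.den_tabN_apply (by omega) hv]
    simp only [NEx.val_row, NEx.val, ij_one, hC v hv]
  have hact : Ind N (σ2.nat 12 0) M := by
    intro i hi
    rw [h2, Stm.den_tabN_apply (by omega) hi, BEx.val_toNat]
    refine if_congr ?_ rfl rfl
    simp only [BEx.Holds, NEx.val, nA, nV, hS1.input.n_eq, hS1.input.m_eq, ij_one, BEx.holds_eq,
      NEx.val_row, BEx.holds_all, BEx.holds_imp, Function.update_self]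
    have e1 : ∀ x, Function.update (ij 0 i) 2 x 1 = i := fun x => by simp
    simp only [e1]
    constructor
    · rintro ⟨hin, hd, hall⟩
      refine ⟨⟨i, hin⟩, mem_active.2 ⟨fun hD => ?_, fun v hv => ?_⟩, rfl⟩
      · have : σ1.nat 10 0 i = _ := hS1.done ⟨i, hin⟩
        rw [if_pos hD] at this
        omega
      · have := hall v (by omega) ⟨v.2, by rw [hS1.agent, mem_fiber.1 hv]⟩
        obtain ⟨x, hx, hxv⟩ := (hC1.pos (v.2.trans hmN)).1 this
        rwa [← Fin.ext hxv]
    · rintro ⟨j, hj, rfl⟩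
      have hj' := mem_active.1 hj
      refine ⟨j.2, ?_, fun v hv hvm => ?_⟩
      · rw [hS1.done, if_neg hj'.1]
      · have h4 := hS1.agent ⟨v, hvm.1⟩
        refine (hC1.pos hv).2 ⟨⟨v, hvm.1⟩, hj'.2 (mem_fiber.2 ?_), rfl⟩
        rw [Fin.ext_iff, ← h4]; exact hvm.2
  have hact3 : Ind N (σ3.nat 12 0) M := by
    rw [show σ3.nat 12 = σ2.nat 12 from Stm.den_nat hO _ _ _ _ (by simp)]; exact hact
  refine ⟨?_, ?_, ?_, fun i hi => ?_⟩
  · rw [hσ', Stm.den_nat hO _ _ _ _ (by simp), h3, Stm.den_nat hO _ _ _ _ (by simp), h2,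
      Stm.den_nat hO _ _ _ _ (by simp)]
    exact hq
  · rw [hσ', Stm.den_nat hO _ _ _ _ (by simp)]
    exact hact3
  · rw [hσ', Stm.den_nat hO _ _ _ _ (by simp), h3, Stm.den_tabN_apply (by omega) (by omega)]
    simp only [NEx.val, NEx.val_row, Function.update_self]
    exact hact.sum hnN.le
  · have hrank : agentRank M i < N := by
      have := (bijOn_agentRank M).mapsTo hi
      have h5 := Finset.card_le_univ M
      rw [Fintype.card_fin] at h5
      rw [Finset.mem_coe, Finset.mem_range] at this
      omega
    rw [hσ', Stm.den_tabN_apply (by omega) hrank]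
    have hv : ∀ x ε, (rankE (.var 2)).val N σ3 (Function.update ε 2 x) = agentRank M x := by
      intro x ε
      rw [val_rankE hnN.le hact3]
      · simp
      · intro y; simp
    have e1 : ∀ x, Function.update (ij 0 (agentRank M i)) 2 x 1 = agentRank M i :=
      fun x => by simp
    simp only [NEx.val, BEx.Holds, BEx.holds_eq, NEx.val_row, Function.update_self, hv, e1]
    set p : ℕ → Prop := fun x => σ3.nat 12 0 x = 1 ∧ agentRank M x = agentRank M i with hp
    have hpi : p i := by
      refine ⟨?_, rfl⟩
      rw [hact3 i (by omega), if_pos ⟨i, hi, rfl⟩]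
    have hlt : firstIdx p N < N := firstIdx_lt_iff.2 ⟨i, by omega, hpi⟩
    obtain ⟨hs1, hs2⟩ := firstIdx_spec hlt
    rw [hact3 _ hlt] at hs1
    have hex : ∃ w ∈ M, (w : ℕ) = firstIdx p N := by
      by_contra hne; rw [if_neg hne] at hs1; omega
    obtain ⟨j, hj, hji⟩ := hex
    rw [← hji] at hs2 ⊢
    rw [(bijOn_agentRank M).injOn hj hi hs2]

/-- Record the new agents of the vertices and the new finished agents. -/
def updateStm : Stm Q := .seq
  (.tabN 2 (.ite (.nlt (.const 0) (.row 11 (.var 1))) (.row 13 (.row 5 (.var 1))) (.row 2 (.var 1))))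
  (.tabN 10 (BEx.toNat (.or (.eq (.row 10 (.var 1)) (.const 1))
    -- An active agent is finished if no label has a smaller utility than its own, in accordance
    -- with `loser_iff_min`.
    (.and (.eq (.row 12 (.var 1)) (.const 1)) (.all 2 (.imp (.nlt (.var 2) (.cell 4 (.const 0) (.const 0)))
      (.not (.rlt (.row 10 (.var 2)) (.row 10 (rankE (.var 1)))))))))))

@[simp] theorem natW_updateStm : (updateStm : Stm Q).natW = [2, 10] := rfl
@[simp] theorem realW_updateStm : (updateStm : Stm Q).realW = [] := rfl

/-- The answer to a query uses the labels below `M.card`. Being SMMS is invariant under renaming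
agents, so the rank bijection carries it over to the active agents. -/
theorem updateStm_spec {u : Finset (Fin m) → ℝ} (hO : OracleFrame O) {N : ℕ} (hmN : m < N)
    (hnN : n < N) {ag : Fin m → Fin n} {D : Finset (Fin n)} (h : Stores G n w σ ag D)
    {C : Finset (Fin m)} {M : Finset (Fin n)} (hM : M.Nonempty)
    (hC : Ind N (σ.nat 11 0) C) (hact : Ind N (σ.nat 12 0) M) (hk : σ.nat 4 0 0 = M.card)
    (hidx : ∀ i ∈ M, σ.nat 13 0 (agentRank M i) = i)
    (hS : IsSMMS G u C (Finset.univ : Finset (Fin M.card))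
      fun i => C.filter fun v : Fin m => σ.nat 5 0 v = i)
    (hU : ∀ i : Fin M.card, σ.real 10 0 i = u (C.filter fun v : Fin m => σ.nat 5 0 v = i)) :
    ∃ ag' : Fin m → Fin n, (∀ v ∉ C, ag' v = ag v) ∧
      IsSMMS G u C M (fun i => C.filter fun v => ag' v = i) ∧
      Stores G n w ((updateStm : Stm Q).den O N σ) ag'
        (D ∪ losers G u C M fun i => C.filter fun v => ag' v = i) := by
  classical
  have hb := bijOn_agentRank M
  have hMn : M.card ≤ n := by simpa using Finset.card_le_univ M
  obtain ⟨d, hd, hd1, hd2⟩ := exists_bijOn_symm hb hM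
  have hlab : ∀ v ∈ C, σ.nat 5 0 v ∈ Finset.range M.card := by
    intro v hv
    rw [← hS.alloc.cover, Finset.mem_biUnion] at hv
    obtain ⟨i, -, hvi⟩ := hv
    rw [(Finset.mem_filter.1 hvi).2]
    simp
  set ag' : Fin m → Fin n := fun v => if v ∈ C then d (σ.nat 5 0 v) else ag v with hag'
  have hr : ∀ i ∈ M, agentRank M i < M.card := fun i hi => by
    simpa using hb.mapsTo hi
  have hfil : ∀ i ∈ M, (C.filter fun v => ag' v = i) =
      C.filter fun v : Fin m => σ.nat 5 0 v = agentRank M i := by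
    intro i hi
    refine Finset.filter_congr fun v hv => ?_
    simp only [hag', if_pos hv]
    constructor
    · rintro rfl; exact (hd2 _ (hlab v hv)).symm
    · intro h'; rw [h', hd1 i hi]
  have hS' : IsSMMS G u C M fun i => C.filter fun v => ag' v = i := by
    have he : Set.BijOn (fun i : Fin n => if h : agentRank M i < M.card then
        (⟨agentRank M i, h⟩ : Fin M.card) else ⟨0, hM.card_pos⟩) M
        (Finset.univ : Finset (Fin M.card)) := by
      refine ⟨fun i _ => by simp, fun i hi j hj hij => ?_, fun j _ => ?_⟩
      · simp only [dif_pos (hr i hi), dif_pos (hr j hj), Fin.mk.injEq] at hij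
        exact hb.injOn hi hj hij
      · obtain ⟨i, hi, hij⟩ := hb.surjOn (show (j : ℕ) ∈ _ by simp)
        have hij : agentRank M i = j := hij
        refine ⟨i, hi, ?_⟩
        simp only [dif_pos (hr i hi)]
        exact Fin.ext hij
    refine (hS.comp he hM).congr fun i hi => ?_
    simp only [hfil i hi, dif_pos (hr i hi)]
  refine ⟨ag', fun v hv => by simp [hag', hv], hS', ?_⟩
  rw [updateStm, Stm.den_seq]
  set σ1 := Stm.den O N _ σ with h1
  have hf : ∀ a, a ≠ 2 → σ1.nat a = σ.nat a := fun a ha =>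
    Stm.den_nat hO _ _ _ _ (by simpa [Stm.natW] using ha)
  have hfr : σ1.real = σ.real := rfl
  refine ⟨h.input.congr ?_ ?_ ?_, fun v => ?_, fun i => ?_⟩
  · rw [Stm.den_nat hO _ _ _ _ (by simp), hf 0 (by decide)]
  · rw [Stm.den_nat hO _ _ _ _ (by simp), hf 1 (by decide)]
  · rfl
  · rw [Stm.den_nat hO _ _ _ _ (by simp), h1, Stm.den_tabN_apply (by omega) (by omega)]
    simp only [NEx.val, BEx.Holds, NEx.val_row, ij_one]
    rw [hC.apply hmN.le]
    by_cases hv : v ∈ C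
    · simp only [hag', if_pos hv, if_pos one_pos]
      have h2 := hlab v hv
      rw [← hidx _ (hd.mapsTo h2)]
      congr 1
      exact (hd2 _ h2).symm
    · simp [hag', if_neg hv, h.agent]
  · rw [Stm.den_tabN_apply (by omega) (by omega), BEx.val_toNat]
    refine if_congr ?_ rfl rfl
    have hact1 : Ind N (σ1.nat 12 0) M := by rw [hf 12 (by decide)]; exact hact
    have hv : ∀ x, (rankE (.var 1)).val N σ1 (Function.update (ij 0 i) 2 x) = agentRank M i := by
      intro x
      rw [val_rankE hnN.le hact1]
      · simp
      · intro y; simp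
    simp only [BEx.holds_or, BEx.Holds, BEx.holds_eq, NEx.val, NEx.val_row, ij_one, BEx.holds_all,
      BEx.holds_imp, REx.val_row, hv, Function.update_self, hf 10 (by decide), hf 12 (by decide),
      hf 4 (by decide), hfr, hk, Finset.mem_union, h.done, hact.apply hnN.le]
    have hl : i ∈ M → ((∀ x < N, x < M.card → ¬ σ.real 10 0 x < σ.real 10 0 (agentRank M i)) ↔
        i ∈ losers G u C M fun i => C.filter fun v => ag' v = i) := by
      intro hi
      rw [loser_iff_min hS'.alloc hS'.mms hi]
      have hUi : ∀ j ∈ M, σ.real 10 0 (agentRank M j) = u (C.filter fun v => ag' v = j) := by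
        intro j hj
        rw [hfil j hj]
        exact hU ⟨_, hr j hj⟩
      constructor
      · intro h' j hj
        have := h' (agentRank M j) ((hr j hj).trans_le (by omega)) (hr j hj)
        rwa [hUi j hj, hUi i hi, not_lt] at this
      · intro h' x _ hx
        obtain ⟨j, hj, hjx⟩ := hb.surjOn (show x ∈ _ by simpa using hx)
        have hjx : agentRank M j = x := hjx
        rw [← hjx, hUi j hj, hUi i hi, not_lt]
        exact h' j hj
    by_cases hi : i ∈ M
    · simp only [if_pos hi, true_and, hl hi]
      by_cases hiD : i ∈ D <;> simp [hiD]
    · have : i ∉ losers G u C M fun i => C.filter fun v => ag' v = i := fun h' =>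
        hi (Finset.filter_subset _ _ h')
      by_cases hiD : i ∈ D <;> simp [hiD, hi, this]

/-- The subroutine `c` finds an SMMS allocation of the query set (array `3`) to the number of agents
in array `4`; it writes the agents into array `5` and their utilities into array `10`. -/
structure SolvesQueries (O : Q → Mem → Mem) (G : SimpleGraph (Fin m)) (n : ℕ) (w : Fin m → ℝ)
    (u : Finset (Fin m) → ℝ) (c : Stm Q) : Prop where
  natW : ∀ a ∈ [0, 1, 2, 4, 10, 11, 12, 13], a ∉ c.natW
  realW : 0 ∉ c.realW
  spec : ∀ (σ : Mem) (X : Finset (Fin m)) (k : ℕ), HasInput G n w σ → X.Nonempty →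
    ConnBundle G X → 0 < k → k ≤ n → Ind (m + n + 1) (σ.nat 3 0) X → σ.nat 4 0 0 = k →
    IsSMMS G u X (Finset.univ : Finset (Fin k))
      (fun i => X.filter fun v : Fin m => (c.den O (m + n + 1) σ).nat 5 0 v = i) ∧
    ∀ i : Fin k, (c.den O (m + n + 1) σ).real 10 0 i =
      u (X.filter fun v : Fin m => (c.den O (m + n + 1) σ).nat 5 0 v = i)

/-- One step of the algorithm, on one component of the remaining graph. -/
def roundStm (c : Stm Q) : Stm Q := .ifte (.ex 2 (aliveB (.var 2)))
  (.seq compStm (.seq agentsStm (.seq c updateStm))) .skip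

/-- Progress comes from `losers_nonempty`: the treated component contributes a loser, which was
active and hence not yet in `D`. -/
theorem roundStm_spec {u : Finset (Fin m) → ℝ} (hu : ∀ X, u ∅ ≤ u X) (hO : OracleFrame O)
    {c : Stm Q} (hc : SolvesQueries O G n w u c) {ag : Fin m → Fin n} {D : Finset (Fin n)}
    (h : Stores G n w σ ag D) (hinv : LoopInv G u ag D) {σ' : Mem}
    (hσ' : σ' = (roundStm c).den O (m + n + 1) σ) :
    (alive ag D = ∅ ∧ Stores G n w σ' ag D) ∨ (alive ag D).Nonempty ∧ ∃ ag' D', D.card < Finset.card D' ∧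
      Stores G n w σ' ag' D' ∧ LoopInv G u ag' D' := by
  classical
  by_cases hT : (alive ag D).Nonempty
  swap
  · rw [Finset.not_nonempty_iff_eq_empty] at hT
    refine Or.inl ⟨hT, ?_⟩
    rw [hσ', roundStm, Stm.den, if_neg]
    · exact h
    · simp [holds_aliveB h, hT]
  refine Or.inr ⟨hT, ?_⟩
  rw [roundStm, Stm.den, if_pos, Stm.den_seq, Stm.den_seq, Stm.den_seq] at hσ'
  swap
  · obtain ⟨v, hv⟩ := hT
    simp only [BEx.holds_ex, holds_aliveB h]
    exact ⟨v, by omega, v, hv, by simp⟩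
  obtain ⟨C, hC, hCI⟩ := compStm_spec (O := O) hO (N := m + n + 1) (by omega) h hT
  set σ1 := (compStm : Stm Q).den O (m + n + 1) σ with h1
  have hS1 : Stores G n w σ1 ag D := h.congr
    (fun a ha => Stm.den_nat hO _ _ _ _ (by revert a; simp))
    (Stm.den_real hO _ _ _ _ (by simp))
  set σ2 := (agentsStm : Stm Q).den O (m + n + 1) σ1 with h2
  obtain ⟨hq, hact, hk, hidx⟩ := agentsStm_spec hO (by omega) (by omega) hS1 hCI h2
  have hS2 : Stores G n w σ2 ag D := hS1.congr
    (fun a ha => Stm.den_nat hO _ _ _ _ (by revert a; simp))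
    (Stm.den_real hO _ _ _ _ (by simp))
  set M := active ag D C with hM
  have hMne : M.Nonempty := by
    obtain ⟨v, hv⟩ := hC.2.1
    exact ⟨_, hinv.active_nonempty hC hv⟩
  have hMn : M.card ≤ n := by simpa using Finset.card_le_univ M
  obtain ⟨hS, hU⟩ := hc.spec σ2 C M.card hS2.input hC.2.1 hC.2.2.1 hMne.card_pos hMn hq hk
  set σ3 := c.den O (m + n + 1) σ2 with h3
  have hf : ∀ a ∈ [0, 1, 2, 4, 10, 11, 12, 13], σ3.nat a = σ2.nat a := fun a ha =>
    Stm.den_nat hO _ _ _ _ (hc.natW a ha)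
  have hS3 : Stores G n w σ3 ag D := hS2.congr
    (fun a ha => hf a (by revert a; decide)) (Stm.den_real hO _ _ _ _ hc.realW)
  have hC3 : Ind (m + n + 1) (σ3.nat 11 0) C := by
    rw [hf 11 (by decide), h2, Stm.den_nat hO _ _ _ _ (by simp)]; exact hCI
  obtain ⟨ag', hag', hS', hst⟩ := updateStm_spec (O := O) hO (by omega) (by omega) hS3 hMne hC3
    (by rw [hf 12 (by decide)]; exact hact) (by rw [hf 4 (by decide), hk])
    (by rw [hf 13 (by decide)]; exact hidx) hS hU
  rw [← hσ'] at hst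
  refine ⟨ag', _, ?_, hst, hinv.step hu hC hag' hS'⟩
  obtain ⟨i, hi⟩ := losers_nonempty hS'.alloc hS'.mms hMne
  refine Finset.card_lt_card (Finset.ssubset_iff_subset_ne.2 ⟨Finset.subset_union_left,
    fun he => ?_⟩)
  have hiM : i ∈ M := Finset.filter_subset _ _ hi
  have hiD : i ∈ D := by rw [he]; exact Finset.mem_union_right _ hi
  exact (mem_active.1 hiM).1 hiD

theorem rep_roundStm_spec {u : Finset (Fin m) → ℝ} (hu : ∀ X, u ∅ ≤ u X) (hO : OracleFrame O)
    (hG : G.Connected) (hn : 0 < n) {c : Stm Q} (hc : SolvesQueries O G n w u c) {s : Mem}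
    (hs : s.nat 2 = ((Stm.rep (roundStm c)).den O (m + n + 1) (inputMem G n w)).nat 2) :
    ∃ A : Fin n → Finset (Fin m), OutputsAlloc s A ∧
      LoserRecursion G u Finset.univ Finset.univ A := by
  have key : ∀ t, ∃ ag D, Stores G n w (((roundStm c).den O (m + n + 1))^[t] (inputMem G n w)) ag D ∧
      LoopInv G u ag D ∧ (alive ag D = ∅ ∨ t ≤ D.card) := by
    intro t
    induction t with
    | zero =>
      refine ⟨fun _ => ⟨0, hn⟩, ∅, ⟨⟨rfl, rfl, rfl⟩, fun v => ?_, fun i => ?_⟩,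
        LoopInv.init (connBundle_univ hG) hG.nonempty _, Or.inr (by simp)⟩ <;>
      simp [inputMem]
    | succ t ih =>
      obtain ⟨ag, D, h1, h2, h3⟩ := ih
      rw [Function.iterate_succ_apply']
      rcases roundStm_spec hu hO hc h1 h2 rfl with ⟨h4, h5⟩ | ⟨h7, ag', D', h4, h5, h6⟩
      · exact ⟨ag, D, h5, h2, Or.inl h4⟩
      · refine ⟨ag', D', h5, h6, ?_⟩
        rcases h3 with h3 | h3
        · exact absurd h3 h7.ne_empty
        · right; omega
  obtain ⟨ag, D, h1, h2, h3⟩ := key (m + n + 1)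
  have hD : D.card ≤ n := by simpa using Finset.card_le_univ D
  -- Otherwise `m + n + 1` rounds would have finished more than `n` agents.
  have hT : alive ag D = ∅ := h3.resolve_right (by omega)
  rw [Stm.den] at hs
  refine ⟨fiber ag, ⟨fun v => ?_, fun i v => ?_⟩, h2.final hT⟩
  · rw [hs, h1.agent]; exact (ag v).2
  · rw [hs, h1.agent, mem_fiber, Fin.val_inj]

end

end FairDivision

/-! ### The subroutine that uses the oracles -/

namespace FairDivision

open RAM

/-- Store the utility of the class of label `c` in `(0, c)`, where `c` is the counter in
array `14`. -/
def utilityStm : Stm OracleName := .seq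
  (.tabN 3 (BEx.toNat (.and (.eq (.row 15 (.var 1)) (.const 1))
    (.eq (.row 5 (.var 1)) (.row 14 (.const 0))))))
  (.seq (.call .utility) (.seq
    (.tabR 10 (.ite (.eq (.var 1) (.row 14 (.const 0))) (.row 1 (.const 0)) (.row 10 (.var 1))))
    (.tabN 14 (.add (.row 14 (.const 0)) (.const 1)))))

/-- Call the oracle for SMMS allocations and compute the utilities. -/
def oracleStm : Stm OracleName := .seq (.tabN 15 (.row 3 (.var 1))) (.seq (.call .smms)
  -- The utility queries overwrite array `3`; the vertex set survives in array `15`. The loop runs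
  -- through more labels than there are agents, which does no harm.
  (.seq (.tabN 14 (.const 0)) (.rep utilityStm)))

theorem querySet_eq {m N : ℕ} (hN : m ≤ N) {σ : Mem} {X : Finset (Fin m)}
    (h : Ind N (σ.nat 3 0) X) : querySet m σ = X := by
  ext v; simp [querySet, h.apply hN]

theorem solvesQueries_oracleStm {m n : ℕ} {G : SimpleGraph (Fin m)} {w : Fin m → ℝ}
    {u : Finset (Fin m) → ℝ} {f : Finset (Fin m) → ℕ → Fin m → ℕ} (hf : SolvesSMMS G u f) :
    SolvesQueries (oracles u f) G n w u oracleStm where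
  natW := by decide
  realW := by decide
  spec := by
    classical
    intro σ X k _ hX hXc hk hkn hq hσk
    have hO := oracleFrame_oracles u f
    set N := m + n + 1 with hN
    rw [oracleStm, Stm.den_seq, Stm.den_seq, Stm.den_seq]
    set σ1 := Stm.den _ N _ σ with h1
    set σ2 := Stm.den _ N _ σ1 with h2
    set σ3 := Stm.den _ N _ σ2 with h3
    have hq1 : querySet m σ1 = X := by
      refine querySet_eq (N := N) (by omega) ?_
      rw [h1, Stm.den_nat hO _ _ _ _ (by simp)]; exact hq
    have h5 : ∀ v : Fin m, σ2.nat 5 0 v = f X k v := by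
      intro v
      have h4 : σ1.nat 4 0 0 = k := by rw [h1, Stm.den_nat hO _ _ _ _ (by simp), hσk]
      simp [h2, Stm.den, oracles, hq1, h4]
    have h15 : Ind N (σ3.nat 15 0) X := by
      rw [h3, Stm.den_nat hO _ _ _ _ (by simp), h2, Stm.den_nat hO _ _ _ _ (by simp)]
      intro v hv
      rw [h1, Stm.den_tabN_apply (by omega) hv]
      simpa using hq v hv
    have h35 : ∀ v : Fin m, σ3.nat 5 0 v = f X k v := by
      intro v; rw [h3, Stm.den_nat hO _ _ _ _ (by simp), h5]
    have key : ∀ t, ∀ τ, τ = (utilityStm.den (oracles u f) N)^[t] σ3 → τ.nat 14 0 0 = t ∧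
        Ind N (τ.nat 15 0) X ∧ (∀ v : Fin m, τ.nat 5 0 v = f X k v) ∧
        ∀ i < N, i < t → τ.real 10 0 i = u (X.filter fun v => f X k v = i) := by
      intro t
      induction t with
      | zero =>
        rintro _ rfl
        refine ⟨?_, h15, h35, fun i _ hi => by omega⟩
        rw [Function.iterate_zero, id_eq, h3, Stm.den_tabN_apply (by omega) (by omega)]
        rfl
      | succ t ih =>
        intro τ' hτ'
        rw [Function.iterate_succ_apply'] at hτ'
        obtain ⟨ih1, ih2, ih3, ih4⟩ := ih _ rfl
        set τ := (utilityStm.den (oracles u f) N)^[t] σ3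
        rw [utilityStm, Stm.den_seq, Stm.den_seq, Stm.den_seq] at hτ'
        set τ1 := Stm.den _ N _ τ with e1
        set τ2 := Stm.den _ N _ τ1 with e2
        set τ3 := Stm.den _ N _ τ2 with e3
        have hn2 : τ2.nat = τ1.nat := rfl
        have hn3 : τ3.nat = τ1.nat := rfl
        have hn1 : ∀ a, a ≠ 3 → τ1.nat a = τ.nat a := fun a ha =>
          Stm.den_nat hO _ _ _ _ (by simpa using ha)
        have hn' : ∀ a, a ≠ 14 → τ'.nat a = τ1.nat a := fun a ha => by
          rw [hτ', Stm.den_nat hO _ _ _ _ (by simpa using ha), hn3]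
        have hq2 : querySet m τ1 = X.filter fun v => f X k v = t := by
          ext v
          simp only [querySet, Finset.mem_filter, Finset.mem_univ, true_and]
          rw [e1, Stm.den_tabN_apply (by omega) (by omega), BEx.val_toNat]
          simp only [BEx.Holds, BEx.holds_eq, NEx.val_row, NEx.val, ij_one, ih1, ih3,
            ih2.apply (N := N) (by omega) v]
          by_cases hv : v ∈ X <;> simp [hv]
        refine ⟨?_, ?_, fun v => ?_, fun i hi hit => ?_⟩
        · rw [hτ', Stm.den_tabN_apply (by omega) (by omega)]
          simp [hn3, hn1, ih1]
        · rw [hn' _ (by decide), hn1 _ (by decide)]; exact ih2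
        · rw [hn' _ (by decide), hn1 _ (by decide)]; exact ih3 v
        · rw [hτ', Stm.den_real hO _ _ _ _ (by simp), e3, Stm.den_tabR_apply (by omega) hi]
          simp only [REx.val, BEx.holds_eq, NEx.val, ij_one, NEx.val_row, REx.val_row, hn2,
            hn1 14 (by decide), ih1]
          split_ifs with hit'
          · subst hit'
            simp [e2, Stm.den, oracles, Mem.setReal, hq2]
          · rw [e2, Stm.den_real hO _ _ _ _ (by simp), e1, Stm.den_real hO _ _ _ _ (by simp)]
            exact ih4 i hi (by omega)
    obtain ⟨-, -, k1, k2⟩ := key N _ rfl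
    rw [Stm.den]
    simp only [k1]
    exact ⟨hf X k hX hXc hk, fun i => k2 i (by omega) (by omega)⟩

end FairDivision

/-! ### Cutting a rooted tree into heavy parts -/

namespace FairDivision

open RAM

/-- Lexicographic comparison of a number of parts and a remaining weight. -/
def LexLE (a b : ℕ × ℝ) : Prop := a.1 < b.1 ∨ a.1 = b.1 ∧ a.2 ≤ b.2

theorem LexLE.refl (a : ℕ × ℝ) : LexLE a a := Or.inr ⟨rfl, le_rfl⟩

theorem LexLE.trans {a b c : ℕ × ℝ} (h : LexLE a b) (h' : LexLE b c) : LexLE a c := by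
  rcases h with h | ⟨h, h1⟩ <;> rcases h' with h' | ⟨h', h2⟩
  · exact Or.inl (h.trans h')
  · exact Or.inl (h' ▸ h)
  · exact Or.inl (h ▸ h')
  · exact Or.inr ⟨h.trans h', h1.trans h2⟩

theorem LexLE.total (a b : ℕ × ℝ) : LexLE a b ∨ LexLE b a := by
  rcases lt_trichotomy a.1 b.1 with h | h | h
  · exact Or.inl (Or.inl h)
  · rcases le_total a.2 b.2 with h' | h'
    · exact Or.inl (Or.inr ⟨h, h'⟩)
    · exact Or.inr (Or.inr ⟨h.symm, h'⟩)
  · exact Or.inr (Or.inl h)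

theorem LexLE.add {a b c d : ℕ × ℝ} (h : LexLE a b) (h' : LexLE c d) : LexLE (a + c) (b + d) := by
  simp only [LexLE, Prod.fst_add, Prod.snd_add] at *
  rcases h with h | ⟨h, h1⟩ <;> rcases h' with h' | ⟨h', h2⟩
  · left; omega
  · left; omega
  · left; omega
  · right; exact ⟨by omega, by linarith⟩

theorem LexLE.fst_le {a b : ℕ × ℝ} (h : LexLE a b) : a.1 ≤ b.1 := by
  rcases h with h | h <;> omega

/-- A part more beats any remaining weight. -/
theorem LexLE.close {c : ℕ} {b : ℕ × ℝ} (h : c < b.1) (hb : 0 ≤ b.2) : LexLE (c + 1, 0) b := by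
  rcases Nat.lt_or_ge (c + 1) b.1 with h' | h'
  · exact Or.inl h'
  · exact Or.inr ⟨by simp only; omega, hb⟩

open Classical in
/-- Optionally close the current part, for every bound on the number of parts of weight `μ`. -/
noncomputable def clo (al : Prop) (μ : ℝ) (x : ℕ → ℕ × ℝ) (l : ℕ) : ℕ × ℝ :=
  -- There are two ways to close. A weight above `μ` closes free of charge; a weight of at least `μ`
  -- may be paid for with one unit of the bound, which leaves `l - 1` for what lies below. Paying is
  -- preferred only if it gives strictly more parts than the better of the other options, since a
  -- tie with an open part favours its non-negative weight.
  if al ∧ 0 < l ∧ μ ≤ (x (l - 1)).2 ∧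
      (if al ∧ μ < (x l).2 then (x l).1 + 1 else (x l).1) < (x (l - 1)).1 + 1 then
    ((x (l - 1)).1 + 1, 0)
  else if al ∧ μ < (x l).2 then ((x l).1 + 1, 0) else x l

/-- The best way to split the bound `l` between `x` and `y`. -/
noncomputable def splitAt (N : ℕ) (x y : ℕ → ℕ × ℝ) (l : ℕ) : ℕ :=
  firstIdx (fun a => a ≤ l ∧ ∀ b < N, b ≤ l → LexLE (x b + y (l - b)) (x a + y (l - a))) N

noncomputable def mergeAt (N : ℕ) (x y : ℕ → ℕ × ℝ) (l : ℕ) : ℕ × ℝ :=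
  x (splitAt N x y l) + y (l - splitAt N x y l)

theorem splitAt_spec {N l : ℕ} (hl : l < N) (x y : ℕ → ℕ × ℝ) : splitAt N x y l ≤ l ∧
    ∀ b ≤ l, LexLE (x b + y (l - b)) (mergeAt N x y l) := by
  have hmax : ∃ a ≤ l, ∀ b ≤ l, LexLE (x b + y (l - b)) (x a + y (l - a)) := by
    have : ∀ k, ∃ a ≤ k, ∀ b ≤ k, LexLE (x b + y (l - b)) (x a + y (l - a)) := by
      intro k
      induction k with
      | zero => exact ⟨0, le_rfl, fun b hb => by rw [Nat.le_zero.1 hb]; exact LexLE.refl _⟩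
      | succ k ih =>
        obtain ⟨a, ha, h⟩ := ih
        rcases LexLE.total (x a + y (l - a)) (x (k + 1) + y (l - (k + 1))) with h' | h'
        · refine ⟨k + 1, le_rfl, fun b hb => ?_⟩
          rcases Nat.lt_or_ge k b with hb' | hb'
          · rw [show b = k + 1 by omega]; exact LexLE.refl _
          · exact (h b hb').trans h'
        · refine ⟨a, by omega, fun b hb => ?_⟩
          rcases Nat.lt_or_ge k b with hb' | hb'
          · rw [show b = k + 1 by omega]; exact h'
          · exact h b hb'
    exact this l
  obtain ⟨a, ha, h⟩ := hmax
  have hlt : splitAt N x y l < N :=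
    firstIdx_lt_iff.2 ⟨a, by omega, ha, fun b _ hb => h b hb⟩
  obtain ⟨h1, h2⟩ := firstIdx_spec hlt
  exact ⟨h1, fun b hb => h2 b (by omega) hb⟩

/-- A set `X` of vertices with an elimination order; every vertex has a parent, which is a later
vertex or the sink `m`. -/
structure Rooted where
  m : ℕ
  ord : ℕ → ℕ
  X : Finset ℕ
  P : ℕ → ℕ
  w : ℕ → ℝ
  lt : ∀ t < m, ord t < m
  inj : ∀ s < m, ∀ t < m, ord s = ord t → s = t
  par : ∀ t < m, ord t ∈ X → P (ord t) = m ∨ ∃ s, t < s ∧ s < m ∧ P (ord t) = ord s ∧ ord s ∈ X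
  X_lt : ∀ v ∈ X, v < m
  w_nonneg : ∀ v, 0 ≤ w v
  w_sink : w m = 0

namespace Rooted

variable (T : Rooted)

theorem exists_ord {v : ℕ} (hv : v < T.m) : ∃ t < T.m, T.ord t = v := by
  have := Finset.surj_on_of_inj_on_of_card_le (s := Finset.range T.m) (t := Finset.range T.m)
    (fun t _ => T.ord t) (fun t ht => by simpa using T.lt t (by simpa using ht))
    (fun s t hs ht h => T.inj s (by simpa using hs) t (by simpa using ht) h) le_rfl v (by simpa)
  obtain ⟨t, ht, h⟩ := this
  exact ⟨t, by simpa using ht, h.symm⟩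

/-- Still present at time `t`. -/
def Rem (t v : ℕ) : Prop := v = T.m ∨ ∃ s, t ≤ s ∧ s < T.m ∧ T.ord s = v

variable {T}

theorem Rem.ne {t v : ℕ} (h : T.Rem t v) {s : ℕ} (hs : s < t) (hsm : s < T.m) : v ≠ T.ord s := by
  rcases h with rfl | ⟨s', h1, h2, rfl⟩
  · exact (T.lt s hsm).ne'
  · intro h; have := T.inj _ h2 _ hsm h; omega

theorem Rem.mono {t t' v : ℕ} (h : T.Rem t' v) (htt : t ≤ t') : T.Rem t v := by
  rcases h with h | ⟨s, h1, h2, h3⟩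
  · exact Or.inl h
  · exact Or.inr ⟨s, htt.trans h1, h2, h3⟩

theorem rem_self {t : ℕ} (ht : t < T.m) : T.Rem t (T.ord t) := Or.inr ⟨t, le_rfl, ht, rfl⟩

theorem rem_par {t : ℕ} (ht : t < T.m) (hX : T.ord t ∈ T.X) : T.Rem (t + 1) (T.P (T.ord t)) := by
  rcases T.par t ht hX with h | ⟨s, h1, h2, h3, h4⟩
  · exact Or.inl h
  · exact Or.inr ⟨s, h1, h2, h3.symm⟩

theorem par_ne {t : ℕ} (ht : t < T.m) (hX : T.ord t ∈ T.X) : T.P (T.ord t) ≠ T.ord t :=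
  (rem_par ht hX).ne (Nat.lt_succ_self t) ht

theorem Rem.succ {t v : ℕ} (h : T.Rem t v) (hv : v ≠ T.ord t) : T.Rem (t + 1) v := by
  rcases h with h | ⟨s, h1, h2, h3⟩
  · exact Or.inl h
  · refine Or.inr ⟨s, ?_, h2, h3⟩
    rcases Nat.lt_or_ge t s with h | h
    · exact h
    · obtain rfl : t = s := by omega
      exact absurd h3.symm hv

/-- Induction from the root downwards. -/
theorem induction_down {motive : ℕ → Prop}
    (h : ∀ v ∈ T.X, (T.P v ∈ T.X → motive (T.P v)) → motive v) : ∀ v ∈ T.X, motive v := by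
  have key : ∀ d t, t < T.m → T.m ≤ t + d → T.ord t ∈ T.X → motive (T.ord t) := by
    intro d
    induction d with
    | zero => intro t h1 h2; omega
    | succ d ih =>
      intro t h1 h2 hX
      refine h _ hX fun hPX => ?_
      rcases T.par t h1 hX with h | ⟨s, h3, h4, h5, h6⟩
      · rw [h] at hPX; exact absurd (T.X_lt _ hPX) (lt_irrefl _)
      · rw [h5]; exact ih s h4 (by omega) h6
  intro v hv
  obtain ⟨t, ht, rfl⟩ := T.exists_ord (T.X_lt v hv)
  exact key T.m t ht (by omega) hv

variable (T)

open Classical in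
/-- The dynamic program. For every remaining vertex and every bound `l` on the number of parts of
weight exactly `μ` it holds the lexicographically largest pair consisting of the number of
closed parts and of the weight of the open part; only vertices of `L` may close a part. -/
noncomputable def dp (N : ℕ) (L : Finset ℕ) (μ : ℝ) : ℕ → ℕ → ℕ → ℕ × ℝ
  | 0 => fun v _ => (0, T.w v)
  | t + 1 => if T.ord t ∈ T.X then
      Function.update (dp N L μ t) (T.P (T.ord t)) (mergeAt N (dp N L μ t (T.P (T.ord t)))
        (clo (T.ord t ∈ L) μ (dp N L μ t (T.ord t))))
    else dp N L μ t

open Classical in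
/-- Close the current part at `v` if `v` is a cut. -/
noncomputable def kclo (μ : ℝ) (K : Finset ℕ) (v : ℕ) (a : ℕ × ℝ × ℕ) : ℕ × ℝ × ℕ :=
  if v ∈ K then (a.1 + 1, 0, a.2.2 + if a.2.1 = μ then 1 else 0) else a

open Classical in
/-- The number of closed parts, the open weight, and the number of closed parts of weight `μ` for a
fixed set `K` of cuts. -/
noncomputable def krun (μ : ℝ) (K : Finset ℕ) : ℕ → ℕ → ℕ × ℝ × ℕ
  | 0 => fun v => (0, T.w v, 0)
  | t + 1 => if T.ord t ∈ T.X then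
      Function.update (krun μ K t) (T.P (T.ord t)) (krun μ K t (T.P (T.ord t)) +
        kclo μ K (T.ord t) (krun μ K t (T.ord t)))
    else krun μ K t

/-- All parts closed before time `t` have weight at least `μ`. -/
def Valid (μ : ℝ) (K : Finset ℕ) (t : ℕ) : Prop :=
  ∀ s < t, T.ord s ∈ T.X → T.ord s ∈ K → μ ≤ (T.krun μ K s (T.ord s)).2.1

variable {T} {N : ℕ} {L K : Finset ℕ} {μ : ℝ}

theorem dp_succ_of_notMem {t : ℕ} (h : T.ord t ∉ T.X) : T.dp N L μ (t + 1) = T.dp N L μ t := by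
  rw [dp, if_neg h]

theorem dp_succ_par {t : ℕ} (h : T.ord t ∈ T.X) : T.dp N L μ (t + 1) (T.P (T.ord t)) =
    mergeAt N (T.dp N L μ t (T.P (T.ord t))) (clo (T.ord t ∈ L) μ (T.dp N L μ t (T.ord t))) := by
  rw [dp, if_pos h, Function.update_self]

theorem dp_succ_ne {t v : ℕ} (h : T.ord t ∈ T.X → v ≠ T.P (T.ord t)) :
    T.dp N L μ (t + 1) v = T.dp N L μ t v := by
  rw [dp]; split_ifs with h'
  · rw [Function.update_of_ne (h h')]
  · rfl

theorem krun_succ_of_notMem {t : ℕ} (h : T.ord t ∉ T.X) : T.krun μ K (t + 1) = T.krun μ K t := by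
  rw [krun, if_neg h]

theorem krun_succ_par {t : ℕ} (h : T.ord t ∈ T.X) : T.krun μ K (t + 1) (T.P (T.ord t)) =
    T.krun μ K t (T.P (T.ord t)) + kclo μ K (T.ord t) (T.krun μ K t (T.ord t)) := by
  rw [krun, if_pos h, Function.update_self]

theorem krun_succ_ne {t v : ℕ} (h : T.ord t ∈ T.X → v ≠ T.P (T.ord t)) :
    T.krun μ K (t + 1) v = T.krun μ K t v := by
  rw [krun]; split_ifs with h'
  · rw [Function.update_of_ne (h h')]
  · rfl

/-- The ways in which an entry of `clo` arises. -/
theorem clo_cases (al : Prop) (μ : ℝ) (x : ℕ → ℕ × ℝ) (l : ℕ) :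
    clo al μ x l = x l ∨ (al ∧ μ < (x l).2 ∧ clo al μ x l = ((x l).1 + 1, 0)) ∨
      ∃ l', l = l' + 1 ∧ al ∧ μ ≤ (x l').2 ∧ clo al μ x l = ((x l').1 + 1, 0) := by
  unfold clo
  by_cases h2 : al ∧ μ < (x l).2
  all_goals first | rw [if_pos h2, if_pos h2] | rw [if_neg h2, if_neg h2]
  all_goals split_ifs with h1
  · exact Or.inr (Or.inr ⟨l - 1, by omega, h1.1, h1.2.2.1, rfl⟩)
  · exact Or.inr (Or.inl ⟨h2.1, h2.2, rfl⟩)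
  · exact Or.inr (Or.inr ⟨l - 1, by omega, h1.1, h1.2.2.1, rfl⟩)
  · exact Or.inl rfl

theorem clo_nonneg {al : Prop} {x : ℕ → ℕ × ℝ} (hx : ∀ l, 0 ≤ (x l).2) (l : ℕ) :
    0 ≤ (clo al μ x l).2 := by
  rcases clo_cases al μ x l with h | ⟨-, -, h⟩ | ⟨l', -, -, -, h⟩ <;> rw [h]
  exact hx l

theorem dp_nonneg (t v l : ℕ) : 0 ≤ (T.dp N L μ t v l).2 := by
  induction t generalizing v l with
  | zero => exact T.w_nonneg v
  | succ t ih =>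
    by_cases h : T.ord t ∈ T.X
    · by_cases hv : v = T.P (T.ord t)
      · rw [hv, dp_succ_par h, mergeAt]
        exact add_nonneg (ih _ _) (clo_nonneg (ih _) _)
      · rw [dp_succ_ne fun _ => hv]; exact ih _ _
    · rw [dp_succ_of_notMem h]; exact ih _ _

/-- Together with the next two lemmas: `clo` dominates leaving the part open, closing it free of
charge and closing it at the cost of one unit. With `clo_cases` it is the maximum of these options.
-/
theorem le_clo (al : Prop) (μ : ℝ) (x : ℕ → ℕ × ℝ) (l : ℕ) :
    LexLE (x l) (clo al μ x l) := by
  unfold clo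
  by_cases h2 : al ∧ μ < (x l).2
  all_goals first | rw [if_pos h2, if_pos h2] | rw [if_neg h2, if_neg h2]
  all_goals split_ifs with h1
  · exact Or.inl (show (x l).1 < (x (l - 1)).1 + 1 by have := h1.2.2.2; omega)
  · exact Or.inl (Nat.lt_succ_self _)
  · exact Or.inl h1.2.2.2
  · exact LexLE.refl _

theorem close_le_clo {al : Prop} {x : ℕ → ℕ × ℝ} {l : ℕ} (hal : al) (h : μ < (x l).2) :
    LexLE ((x l).1 + 1, 0) (clo al μ x l) := by
  unfold clo
  rw [if_pos (⟨hal, h⟩ : al ∧ μ < (x l).2), if_pos (⟨hal, h⟩ : al ∧ μ < (x l).2)]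
  split_ifs with h1
  · left; simp only; omega
  · exact LexLE.refl _

theorem close_le_clo_succ {al : Prop} {x : ℕ → ℕ × ℝ} {l : ℕ} (hx : ∀ l, 0 ≤ (x l).2) (hal : al)
    (h : μ ≤ (x l).2) : LexLE ((x l).1 + 1, 0) (clo al μ x (l + 1)) := by
  unfold clo
  rw [Nat.add_sub_cancel]
  by_cases h2 : al ∧ μ < (x (l + 1)).2
  all_goals first | rw [if_pos h2, if_pos h2] | rw [if_neg h2, if_neg h2]
  all_goals split_ifs with h1
  · exact LexLE.refl _
  · rcases Nat.lt_or_ge ((x l).1 + 1) ((x (l + 1)).1 + 1) with h' | h'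
    · exact Or.inl h'
    · refine Or.inr ⟨?_, le_rfl⟩
      by_contra h3
      exact h1 ⟨hal, Nat.succ_pos l, h, by simp only at h3; omega⟩
  · exact LexLE.refl _
  · refine LexLE.close ?_ (hx _)
    by_contra h3
    exact h1 ⟨hal, Nat.succ_pos l, h, by omega⟩

/-- The dynamic program is monotone in the bound. -/
theorem dp_mono (t v : ℕ) {l : ℕ} (hl : l + 1 < N) :
    LexLE (T.dp N L μ t v l) (T.dp N L μ t v (l + 1)) := by
  induction t generalizing v l with
  | zero => exact LexLE.refl _
  | succ t ih =>
    by_cases h : T.ord t ∈ T.X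
    swap
    · rw [dp_succ_of_notMem h]; exact ih _ hl
    by_cases hv : v = T.P (T.ord t)
    swap
    · rw [dp_succ_ne fun _ => hv]; exact ih _ hl
    rw [hv, dp_succ_par h]
    have hx := fun l => dp_nonneg (T := T) (N := N) (L := L) (μ := μ) t (T.ord t) l
    have hmono : ∀ l, l + 1 < N → LexLE (clo (T.ord t ∈ L) μ (T.dp N L μ t (T.ord t)) l)
        (clo (T.ord t ∈ L) μ (T.dp N L μ t (T.ord t)) (l + 1)) := by
      intro l hl
      rcases clo_cases (T.ord t ∈ L) μ (T.dp N L μ t (T.ord t)) l with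
        h1 | ⟨h1, h2, h3⟩ | ⟨l', rfl, h1, h2, h3⟩
      · rw [h1]; exact (ih _ hl).trans (le_clo _ _ _ _)
      · rw [h3]; exact close_le_clo_succ hx h1 h2.le
      · rw [h3]
        have h4 := ih (T.ord t) (l := l') (by omega)
        -- If the larger bound already yields more closed parts, it beats closing at `l'`. Otherwise
        -- the open weight has not decreased, and the same closing is possible one unit later.
        rcases h4 with h4 | ⟨h4, h5⟩
        · exact (LexLE.close h4 (hx _)).trans ((ih _ hl).trans (le_clo _ _ _ _))
        · rw [h4]; exact close_le_clo_succ hx h1 (h2.trans h5)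
    obtain ⟨h1, -⟩ := splitAt_spec (N := N) (l := l) (by omega) (T.dp N L μ t (T.P (T.ord t)))
      (clo (T.ord t ∈ L) μ (T.dp N L μ t (T.ord t)))
    obtain ⟨-, h2⟩ := splitAt_spec (N := N) (l := l + 1) hl (T.dp N L μ t (T.P (T.ord t)))
      (clo (T.ord t ∈ L) μ (T.dp N L μ t (T.ord t)))
    -- The split that was best for `l` competes for `l + 1`, the extra unit going to the child.
    refine LexLE.trans ?_ (h2 (splitAt N (T.dp N L μ t (T.P (T.ord t)))
      (clo (T.ord t ∈ L) μ (T.dp N L μ t (T.ord t))) l) (by omega))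
    rw [mergeAt]
    refine (LexLE.refl _).add ?_
    rw [Nat.sub_add_comm h1]
    exact hmono _ (by omega)

/-- Optimality of the dynamic program. -/
theorem krun_le_dp (hKL : ∀ v ∈ K, v ∈ L) {t : ℕ} (hK : T.Valid μ K t) (v : ℕ) {l : ℕ}
    (hl : l < N) (hlos : (T.krun μ K t v).2.2 ≤ l) :
    LexLE ((T.krun μ K t v).1, (T.krun μ K t v).2.1) (T.dp N L μ t v l) := by
  induction t generalizing v l with
  | zero => exact LexLE.refl _
  | succ t ih =>
    have ih := fun v l => @ih (fun s hs => hK s (by omega)) v l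
    by_cases h : T.ord t ∈ T.X
    swap
    · rw [krun_succ_of_notMem h] at hlos ⊢
      rw [dp_succ_of_notMem h]; exact ih _ _ hl hlos
    by_cases hv : v = T.P (T.ord t)
    swap
    · rw [krun_succ_ne fun _ => hv] at hlos ⊢
      rw [dp_succ_ne fun _ => hv]; exact ih _ _ hl hlos
    rw [hv, krun_succ_par h] at hlos ⊢
    rw [dp_succ_par h]
    set p := T.krun μ K t (T.P (T.ord t)) with hp
    set a := T.krun μ K t (T.ord t) with ha
    set x := T.dp N L μ t (T.ord t) with hx'
    have hx : ∀ l, 0 ≤ (x l).2 := fun l => dp_nonneg t (T.ord t) l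
    simp only [Prod.snd_add, Prod.fst_add] at hlos ⊢
    obtain ⟨-, h2⟩ := splitAt_spec (N := N) hl (T.dp N L μ t (T.P (T.ord t)))
      (clo (T.ord t ∈ L) μ x)
    -- Compare with the split that `K` itself uses: its light parts on the parent's side, and the
    -- rest of the bound for the child.
    refine LexLE.trans ?_ (h2 p.2.2 (by omega))
    refine LexLE.add (a := (p.1, p.2.1)) (c := ((kclo μ K (T.ord t) a).1,
      (kclo μ K (T.ord t) a).2.1)) (ih _ _ (by omega) le_rfl) ?_
    set b := l - p.2.2 with hb
    -- Exchange argument. If the table already has more closed parts than `K` below this vertex, it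
    -- need not close here. Otherwise its open weight is at least that of `K`, so it may close
    -- wherever `K` does; a part of weight exactly `μ` in `K` provides the unit that pays for it.
    by_cases hvK : T.ord t ∈ K
    · simp only [kclo, if_pos hvK] at hlos ⊢
      have hval : μ ≤ a.2.1 := hK t (by omega) h hvK
      by_cases haμ : a.2.1 = μ
      · rw [if_pos haμ] at hlos
        obtain ⟨b', hb'⟩ : ∃ b', b = b' + 1 := ⟨b - 1, by omega⟩
        rw [hb']
        have h3 := ih (T.ord t) b' (by omega) (show a.2.2 ≤ _ by omega)
        rcases h3 with h3 | ⟨h3, h4⟩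
        · exact (LexLE.close h3 (hx _)).trans ((dp_mono t _ (by omega)).trans (le_clo _ _ _ _))
        · simp only at h3 h4
          rw [h3]
          exact close_le_clo_succ hx (hKL _ hvK) (hval.trans h4)
      · rw [if_neg haμ] at hlos
        have h3 := ih (T.ord t) b (by omega) (show a.2.2 ≤ _ by omega)
        rcases h3 with h3 | ⟨h3, h4⟩
        · exact (LexLE.close h3 (hx _)).trans (le_clo _ _ _ _)
        · simp only at h3 h4
          rw [h3]
          exact close_le_clo (hKL _ hvK) ((lt_of_le_of_ne hval (Ne.symm haμ)).trans_le h4)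
    · simp only [kclo, if_neg hvK] at hlos ⊢
      exact (ih _ b (by omega) (show a.2.2 ≤ _ by omega)).trans (le_clo _ _ _ _)

theorem krun_congr {K' : Finset ℕ} {t : ℕ} (h : ∀ s < t, T.ord s ∈ K ↔ T.ord s ∈ K') :
    T.krun μ K t = T.krun μ K' t := by
  induction t with
  | zero => rfl
  | succ t ih =>
    have ih := ih fun s hs => h s (by omega)
    rw [krun, krun, ih]
    simp only [kclo, h t (by omega)]

theorem Valid.congr {K' : Finset ℕ} {t : ℕ} (h : ∀ s < t, T.ord s ∈ K ↔ T.ord s ∈ K')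
    (hK : T.Valid μ K t) : T.Valid μ K' t := by
  intro s hs hX hsK
  rw [← krun_congr (K := K) fun s' hs' => h s' (by omega)]
  exact hK s hs hX ((h s hs).2 hsK)

/-- All entries of the dynamic program are attained simultaneously. -/
theorem exists_krun_eq_dp {t : ℕ} (ht : t ≤ T.m) (β : ℕ → ℕ) (hβ : ∀ v, β v < N) :
    ∃ K : Finset ℕ, (∀ v ∈ K, v ∈ L ∧ v ∈ T.X ∧ ∃ s < t, T.ord s = v) ∧ T.Valid μ K t ∧
      ∀ v, T.Rem t v → (T.krun μ K t v).2.2 ≤ β v ∧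
        ((T.krun μ K t v).1, (T.krun μ K t v).2.1) = T.dp N L μ t v (β v) := by
  classical
  induction t generalizing β with
  | zero => exact ⟨∅, by simp, fun s hs => by omega, fun v _ => ⟨by simp [krun], rfl⟩⟩
  | succ t ih =>
    have ih := fun β => @ih (by omega) β
    by_cases h : T.ord t ∈ T.X
    swap
    · obtain ⟨K, h1, h2, h3⟩ := ih β hβ
      refine ⟨K, fun v hv => ?_, fun s hs hX hsK => ?_, fun v hv => ?_⟩
      · obtain ⟨h4, h5, s, hs, h6⟩ := h1 v hv
        exact ⟨h4, h5, s, by omega, h6⟩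
      · refine h2 s (lt_of_le_of_ne (by omega) ?_) hX hsK
        rintro rfl; exact h hX
      · rw [krun_succ_of_notMem h, dp_succ_of_notMem h]
        exact h3 v (hv.mono (by omega))
    set v := T.ord t with hv
    set p := T.P v with hp
    have hpv : p ≠ v := par_ne (by omega) h
    obtain ⟨hs1, -⟩ := splitAt_spec (N := N) (hβ p) (T.dp N L μ t p)
      (clo (v ∈ L) μ (T.dp N L μ t v))
    set a := splitAt N (T.dp N L μ t p) (clo (v ∈ L) μ (T.dp N L μ t v)) (β p) with ha
    set b := β p - a with hb
    have hbN : b < N := lt_of_le_of_lt (Nat.sub_le _ _) (hβ p)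
    have hnew : T.dp N L μ (t + 1) p (β p) = T.dp N L μ t p a +
        clo (v ∈ L) μ (T.dp N L μ t v) b := by rw [hp, dp_succ_par h]; rfl
    -- The new entry at `p` combines the entries of `p` and `v`, which must come from one set of
    -- cuts; this is why the statement treats all vertices at once. The induction hypothesis is used
    -- with the bound `a` at `p` and `b'` at `v`, where `b'` is `b`, or `b - 1` if a unit is paid.
    -- `K'` either leaves `K` alone or inserts `v`.
    have main : ∀ b' ≤ b, ∀ K' : Finset ℕ → Finset ℕ,
        (∀ K, (∀ x ∈ K, x ∈ L ∧ x ∈ T.X ∧ ∃ s < t, T.ord s = x) → T.Valid μ K t →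
          (T.krun μ K t v).2.2 ≤ b' →
          ((T.krun μ K t v).1, (T.krun μ K t v).2.1) = T.dp N L μ t v b' →
          (∀ s < t, T.ord s ∈ K ↔ T.ord s ∈ K' K) ∧
          (∀ x ∈ K' K, x ∈ L ∧ x ∈ T.X ∧ ∃ s < t + 1, T.ord s = x) ∧
          (v ∈ K' K → μ ≤ (T.krun μ K t v).2.1) ∧
          (kclo μ (K' K) v (T.krun μ K t v)).2.2 ≤ b ∧
          ((kclo μ (K' K) v (T.krun μ K t v)).1, (kclo μ (K' K) v (T.krun μ K t v)).2.1) =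
            clo (v ∈ L) μ (T.dp N L μ t v) b) →
        ∃ K : Finset ℕ, (∀ v ∈ K, v ∈ L ∧ v ∈ T.X ∧ ∃ s < t + 1, T.ord s = v) ∧
          T.Valid μ K (t + 1) ∧ ∀ v, T.Rem (t + 1) v → (T.krun μ K (t + 1) v).2.2 ≤ β v ∧
          ((T.krun μ K (t + 1) v).1, (T.krun μ K (t + 1) v).2.1) =
            T.dp N L μ (t + 1) v (β v) := by
      intro b' hb' K' hK'
      obtain ⟨K, h1, h2, h3⟩ := ih (Function.update (Function.update β p a) v b') (by
        intro x
        by_cases hxv : x = v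
        · subst hxv; rw [Function.update_self]; omega
        rw [Function.update_of_ne hxv]
        by_cases hxp : x = p
        · rw [hxp, Function.update_self]; exact lt_of_le_of_lt hs1 (hβ p)
        · rw [Function.update_of_ne hxp]; exact hβ x)
      obtain ⟨h4, h5⟩ := h3 v (rem_self (by omega))
      rw [Function.update_self] at h4 h5
      obtain ⟨g1, g2, g3, g4, g5⟩ := hK' K h1 h2 h4 h5
      have hkr : T.krun μ (K' K) t = T.krun μ K t := (krun_congr g1).symm
      refine ⟨K' K, g2, fun s hs hX hsK => ?_, fun x hx => ?_⟩
      · rcases Nat.lt_succ_iff_lt_or_eq.1 hs with hs | rfl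
        · exact h2.congr g1 s hs hX hsK
        · rw [hkr]; exact g3 hsK
      · have hxv : x ≠ v := hx.ne (Nat.lt_succ_self t) (by omega)
        obtain ⟨h6, h7⟩ := h3 x (hx.mono (by omega))
        rw [Function.update_of_ne hxv] at h6 h7
        by_cases hxp : x = p
        · rw [hxp, Function.update_self] at h6 h7
          rw [hxp, hnew, hp, krun_succ_par h, ← hp, hkr, ← h7, ← g5]
          refine ⟨?_, rfl⟩
          simp only [Prod.snd_add]
          rw [← hv]
          omega
        · rw [Function.update_of_ne hxp] at h6 h7
          rw [krun_succ_ne fun _ => hxp, dp_succ_ne fun _ => hxp, hkr]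
          exact ⟨h6, h7⟩
    have hnotin : ∀ K : Finset ℕ, (∀ x ∈ K, x ∈ L ∧ x ∈ T.X ∧ ∃ s < t, T.ord s = x) → v ∉ K := by
      intro K hK hvK
      obtain ⟨-, -, s, hs, hsv⟩ := hK v hvK
      have := T.inj s (by omega) t (by omega) hsv
      omega
    have hins : ∀ K : Finset ℕ, (∀ x ∈ K, x ∈ L ∧ x ∈ T.X ∧ ∃ s < t, T.ord s = x) → v ∈ L →
        (∀ s < t, T.ord s ∈ K ↔ T.ord s ∈ insert v K) ∧
          (∀ x ∈ insert v K, x ∈ L ∧ x ∈ T.X ∧ ∃ s < t + 1, T.ord s = x) := by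
      intro K hK hvL
      refine ⟨fun s hs => ?_, fun x hx => ?_⟩
      · rw [Finset.mem_insert, or_iff_right]
        intro h'
        have := T.inj s (by omega) t (by omega) h'
        omega
      · rcases Finset.mem_insert.1 hx with rfl | hx
        · exact ⟨hvL, h, t, by omega, rfl⟩
        · obtain ⟨k1, k2, s, hs, k3⟩ := hK x hx
          exact ⟨k1, k2, s, by omega, k3⟩
    rcases clo_cases (v ∈ L) μ (T.dp N L μ t v) b with h1 | ⟨h1, h2, h3⟩ | ⟨l', hl', h1, h2, h3⟩
    · refine main b le_rfl id fun K hK _ h4 h5 => ⟨fun _ _ => Iff.rfl, fun x hx => ?_,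
        fun hvK => absurd hvK (hnotin K hK), ?_, ?_⟩
      · obtain ⟨k1, k2, s, hs, k3⟩ := hK x hx
        exact ⟨k1, k2, s, by omega, k3⟩
      · rw [id, kclo, if_neg (hnotin K hK)]; exact h4
      · rw [id, kclo, if_neg (hnotin K hK), h1]; exact h5
    · refine main b le_rfl (insert v) fun K hK _ h4 h5 => ⟨(hins K hK h1).1, (hins K hK h1).2,
        fun _ => ?_, ?_, ?_⟩
      · rw [← h5] at h2; exact h2.le
      · rw [← h5] at h2
        rw [kclo, if_pos (Finset.mem_insert_self _ _), if_neg h2.ne']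
        exact h4
      · rw [kclo, if_pos (Finset.mem_insert_self _ _), h3, ← h5]
    · refine main l' (by omega) (insert v) fun K hK _ h4 h5 => ⟨(hins K hK h1).1,
        (hins K hK h1).2, fun _ => ?_, ?_, ?_⟩
      · rw [← h5] at h2; exact h2
      · rw [kclo, if_pos (Finset.mem_insert_self _ _)]
        simp only; split_ifs <;> omega
      · rw [kclo, if_pos (Finset.mem_insert_self _ _), h3, ← h5]

end Rooted

end FairDivision

-- Parts of a set of cuts, optimality at the sink, and raising the threshold

namespace FairDivision

open RAM

namespace Rooted

variable {T : Rooted} {N : ℕ} {L K : Finset ℕ} {μ : ℝ}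

variable (T) in
open Classical in
/-- The remaining vertex or cut to whose part `y` belongs at time `t`. -/
noncomputable def own (K : Finset ℕ) : ℕ → ℕ → ℕ
  | 0, y => y
  | t + 1, y => if own K t y = T.ord t ∧ T.ord t ∈ T.X ∧ T.ord t ∉ K then T.P (T.ord t)
      else own K t y

theorem own_succ_of_ne {t y : ℕ} (h : T.own K t y ≠ T.ord t) :
    T.own K (t + 1) y = T.own K t y := by
  rw [own, if_neg fun h' => h h'.1]

theorem rem_own {t y : ℕ} (ht : t ≤ T.m) (hy : y ∈ T.X) :
    (T.own K t y ∈ T.X ∨ T.own K t y = T.m) ∧ (T.Rem t (T.own K t y) ∨ T.own K t y ∈ K) := by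
  induction t with
  | zero =>
    obtain ⟨s, h1, h2⟩ := T.exists_ord (T.X_lt y hy)
    exact ⟨Or.inl hy, Or.inl (Or.inr ⟨s, Nat.zero_le _, h1, h2⟩)⟩
  | succ t ih =>
    obtain ⟨h1, h2⟩ := ih (by omega)
    rw [own]
    split_ifs with h
    · refine ⟨?_, Or.inl (rem_par (by omega) h.2.1)⟩
      rcases T.par t (by omega) h.2.1 with h3 | ⟨s, -, -, h3, h4⟩
      · exact Or.inr h3
      · exact Or.inl (h3 ▸ h4)
    · refine ⟨h1, ?_⟩
      by_cases h3 : T.own K t y = T.ord t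
      · right
        by_contra h4
        refine h ⟨h3, ?_, by rwa [← h3]⟩
        rcases h1 with h1 | h1
        · rwa [← h3]
        · rw [h1] at h3
          exact absurd h3 (T.lt t (by omega)).ne'
      · exact h2.imp_left fun h2 => h2.succ h3

theorem own_of_rem {t y : ℕ} (ht : t ≤ T.m) (hy : T.Rem t y) : T.own K t y = y := by
  induction t with
  | zero => rfl
  | succ t ih =>
    have := ih (by omega) (hy.mono (Nat.le_succ t))
    rw [own_succ_of_ne, this]
    rw [this]
    exact hy.ne (Nat.lt_succ_self t) (by omega)

theorem own_congr {s t y z : ℕ} (hst : s ≤ t) (h : T.own K s y = T.own K s z) :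
    T.own K t y = T.own K t z := by
  induction t, hst using Nat.le_induction with
  | base => exact h
  | succ t _ ih => rw [own, own, ih]

/-- Cuts keep their parts. -/
theorem own_eq_iff {s t y : ℕ} (hst : s ≤ t) (ht : t ≤ T.m) (hs : s < T.m) (hK : T.ord s ∈ K) :
    T.own K t y = T.ord s ↔ T.own K s y = T.ord s := by
  induction t, hst using Nat.le_induction with
  | base => exact Iff.rfl
  | succ t hst ih =>
    rw [← ih (by omega), own]
    split_ifs with h
    · constructor
      · intro h'
        exact absurd h' ((rem_par (by omega) h.2.1).ne (by omega) hs)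
      · intro h'
        rw [h.1] at h'
        rw [h'] at h
        exact absurd hK h.2.2
    · exact Iff.rfl

variable (T) in
/-- The cut to whose part `y` belongs, or the sink. -/
noncomputable def fin (K : Finset ℕ) (y : ℕ) : ℕ := T.own K T.m y

/-- With `fin_of_mem` and `fin_par` this determines `fin` from the root downwards, without reference
to elimination times. -/
theorem fin_sink : T.fin K T.m = T.m := own_of_rem le_rfl (Or.inl rfl)

theorem fin_of_mem {y : ℕ} (hX : y ∈ T.X) (hK : y ∈ K) : T.fin K y = y := by
  obtain ⟨s, hs, rfl⟩ := T.exists_ord (T.X_lt y hX)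
  exact (own_eq_iff hs.le le_rfl hs hK).2 (own_of_rem hs.le (rem_self hs))

theorem fin_par {y : ℕ} (hX : y ∈ T.X) (hK : y ∉ K) : T.fin K y = T.fin K (T.P y) := by
  obtain ⟨s, hs, rfl⟩ := T.exists_ord (T.X_lt y hX)
  refine own_congr (s := s + 1) hs ?_
  have h := own_of_rem (K := K) hs.le (rem_self hs)
  rw [own, if_pos ⟨h, hX, hK⟩]
  exact (own_of_rem (by omega) (rem_par hs hX)).symm

theorem fin_mem {y : ℕ} (hX : y ∈ T.X) : T.fin K y = T.m ∨ T.fin K y ∈ K ∧ T.fin K y ∈ T.X := by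
  obtain ⟨h1, h2⟩ := rem_own (K := K) le_rfl hX
  rcases h1 with h1 | h1
  · rcases h2 with (h2 | ⟨s, h2, h3, -⟩) | h2
    · exact Or.inl h2
    · omega
    · exact Or.inr ⟨h2, h1⟩
  · exact Or.inl h1

variable (T) in
/-- The position in the elimination order. -/
noncomputable def pos (v : ℕ) : ℕ := firstIdx (fun t => T.ord t = v) T.m

theorem pos_spec {v : ℕ} (hv : v < T.m) : T.pos v < T.m ∧ T.ord (T.pos v) = v := by
  have h : T.pos v < T.m := firstIdx_lt_iff.2 (T.exists_ord hv)
  exact ⟨h, firstIdx_spec h⟩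

theorem pos_ord {t : ℕ} (ht : t < T.m) : T.pos (T.ord t) = t :=
  T.inj _ (pos_spec (T.lt t ht)).1 _ ht (pos_spec (T.lt t ht)).2

theorem pos_lt_par {v : ℕ} (hv : v ∈ T.X) (hP : T.P v ≠ T.m) :
    T.P v ∈ T.X ∧ T.pos v < T.pos (T.P v) := by
  obtain ⟨s, hs, rfl⟩ := T.exists_ord (T.X_lt v hv)
  rcases T.par s hs hv with h | ⟨t, h1, h2, h3, h4⟩
  · exact absurd h hP
  · rw [h3, pos_ord hs, pos_ord h2]; exact ⟨h4, h1⟩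

theorem pos_le_fin {v : ℕ} (hv : v ∈ T.X) (h : T.fin K v ≠ T.m) :
    T.pos v ≤ T.pos (T.fin K v) := by
  revert h
  refine induction_down (T := T) (motive := fun v => T.fin K v ≠ T.m →
    T.pos v ≤ T.pos (T.fin K v)) (fun v hv ih h => ?_) v hv
  by_cases hK : v ∈ K
  · rw [fin_of_mem hv hK]
  · rw [fin_par hv hK] at h ⊢
    have hP : T.P v ≠ T.m := fun hP => h (by rw [hP, fin_sink])
    obtain ⟨h1, h2⟩ := pos_lt_par hv hP
    exact h2.le.trans (ih h1 h)

variable (T) in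
open Classical in
/-- The weight of the part of the cut `v`. -/
noncomputable def weight (K : Finset ℕ) (v : ℕ) : ℝ := ∑ y ∈ T.X with T.fin K y = v, T.w y

/-- On both sides, an eliminated vertex without a cut hands everything it owns to its parent, and
one with a cut hands over nothing. -/
theorem krun_open {t v : ℕ} (ht : t ≤ T.m) (hv : T.Rem t v) (hvX : v ∈ T.X ∨ v = T.m) :
    (T.krun μ K t v).2.1 = ∑ y ∈ T.X, if T.own K t y = v then T.w y else 0 := by
  induction t generalizing v with
  | zero =>
    have : (T.krun μ K 0 v).2.1 = T.w v := rfl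
    rw [this, Finset.sum_congr rfl fun y _ =>
      show (if T.own K 0 y = v then T.w y else 0) = if y = v then T.w y else 0 from rfl,
      Finset.sum_ite_eq']
    split_ifs with h
    · rfl
    · rw [hvX.resolve_left h, T.w_sink]
  | succ t ih =>
    have hvne := hv.ne (Nat.lt_succ_self t) (by omega)
    have hv' := hv.mono (Nat.le_succ t)
    by_cases h : T.ord t ∈ T.X
    swap
    · rw [krun_succ_of_notMem h, ih (by omega) hv' hvX]
      simp only [own, h, false_and, and_false, if_false]
    by_cases hp : v = T.P (T.ord t)
    · subst hp
      rw [krun_succ_par h]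
      simp only [Prod.snd_add, Prod.fst_add]
      rw [ih (by omega) hv' hvX]
      by_cases hK : T.ord t ∈ K
      · simp only [kclo, own, hK, if_true, not_true, and_false, if_false, add_zero]
      · simp only [kclo, if_neg hK]
        rw [ih (by omega) (rem_self (by omega)) (Or.inl h), ← Finset.sum_add_distrib]
        refine Finset.sum_congr rfl fun y _ => ?_
        by_cases hy : T.own K t y = T.ord t
        · simp [own, hy, h, hK, hvne.symm]
        · simp [own, hy]
    · rw [krun_succ_ne fun _ => hp, ih (by omega) hv' hvX]
      refine Finset.sum_congr rfl fun y _ => ?_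
      by_cases hy : T.own K t y = T.ord t ∧ T.ord t ∈ T.X ∧ T.ord t ∉ K
      · rw [own, if_pos hy, if_neg (Ne.symm hp), hy.1, if_neg (Ne.symm hvne)]
      · rw [own, if_neg hy]

/-- The part of a cut is complete when the cut is eliminated, because later eliminations cannot add
to it (`own_eq_iff`). -/
theorem krun_eq_weight {v : ℕ} (hv : v ∈ T.X) (hK : v ∈ K) :
    (T.krun μ K (T.pos v) v).2.1 = T.weight K v := by
  obtain ⟨h1, h2⟩ := pos_spec (T.X_lt v hv)
  rw [krun_open h1.le (by simpa [h2] using rem_self h1) (Or.inl hv), weight, Finset.sum_filter]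
  refine Finset.sum_congr rfl fun y _ => ?_
  have := own_eq_iff (K := K) (y := y) h1.le le_rfl h1 (by rwa [h2])
  rw [h2] at this
  simp only [fin, this]

theorem valid_iff : T.Valid μ K T.m ↔ ∀ v ∈ K, v ∈ T.X → μ ≤ T.weight K v := by
  constructor
  · intro h v hK hX
    obtain ⟨h1, h2⟩ := pos_spec (T.X_lt v hX)
    have := h _ h1 (by rwa [h2]) (by rwa [h2])
    rw [h2] at this
    rwa [← krun_eq_weight (μ := μ) hX hK]
  · intro h s hs hX hK
    have := krun_eq_weight (μ := μ) hX hK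
    rw [pos_ord hs] at this
    rw [this]
    exact h _ hK hX

/-- Accumulation of a quantity along the tree. -/
theorem accumulate {Z : ℕ → ℕ → ℕ} {a : ℕ → ℕ} (h0 : ∀ v, Z 0 v = 0)
    (hn : ∀ t < T.m, T.ord t ∉ T.X → ∀ v, Z (t + 1) v = Z t v)
    (hp : ∀ t < T.m, T.ord t ∈ T.X →
      Z (t + 1) (T.P (T.ord t)) = Z t (T.P (T.ord t)) + (Z t (T.ord t) + a t))
    (hne : ∀ t < T.m, ∀ v, v ≠ T.P (T.ord t) → Z (t + 1) v = Z t v) {t v : ℕ} (ht : t ≤ T.m)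
    (hv : T.Rem t v) : Z t v = ∑ s ∈ Finset.range t,
      -- Counters pass through cuts, unlike weights; so they flow as if there were no cuts at all.
      if T.ord s ∈ T.X ∧ T.own ∅ t (T.ord s) = v then a s else 0 := by
  induction t generalizing v with
  | zero => simp [h0]
  | succ t ih =>
    have hvne := hv.ne (Nat.lt_succ_self t) (by omega)
    have hv' := hv.mono (Nat.le_succ t)
    have hself := own_of_rem (K := ∅) (by omega) (rem_self (T := T) (t := t) (by omega))
    rw [Finset.sum_range_succ]
    by_cases h : T.ord t ∈ T.X
    swap
    · rw [hn t (by omega) h, ih (by omega) hv', if_neg fun h' => h h'.1]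
      simp only [own, h, false_and, and_false, if_false, add_zero]
    by_cases hpv : v = T.P (T.ord t)
    · subst hpv
      rw [hp t (by omega) h, ih (by omega) hv', ih (by omega) (rem_self (by omega)), ← add_assoc,
        ← Finset.sum_add_distrib]
      congr 1
      · refine Finset.sum_congr rfl fun s _ => ?_
        by_cases hy : T.own ∅ t (T.ord s) = T.ord t
        · simp [own, hy, h, hvne.symm]
        · simp [own, hy]
      · simp [own, hself, h]
    · rw [hne t (by omega) v hpv, ih (by omega) hv']
      rw [show (if T.ord t ∈ T.X ∧ T.own ∅ (t + 1) (T.ord t) = v then a t else 0) = 0 by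
        simp [own, hself, h, Ne.symm hpv], add_zero]
      refine Finset.sum_congr rfl fun s _ => ?_
      by_cases hy : T.own ∅ t (T.ord s) = T.ord t
      · simp [own, hy, h, hvne.symm, Ne.symm hpv]
      · simp [own, hy]

/-- Without cuts every vertex of `X` ends in the sink, which therefore collects all contributions.
-/
theorem accumulate_sink {Z : ℕ → ℕ → ℕ} {a : ℕ → ℕ} (h0 : ∀ v, Z 0 v = 0)
    (hn : ∀ t < T.m, T.ord t ∉ T.X → ∀ v, Z (t + 1) v = Z t v)
    (hp : ∀ t < T.m, T.ord t ∈ T.X →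
      Z (t + 1) (T.P (T.ord t)) = Z t (T.P (T.ord t)) + (Z t (T.ord t) + a t))
    (hne : ∀ t < T.m, ∀ v, v ≠ T.P (T.ord t) → Z (t + 1) v = Z t v) :
    Z T.m T.m = ∑ v ∈ T.X, a (T.pos v) := by
  rw [accumulate h0 hn hp hne le_rfl (Or.inl rfl), ← Finset.sum_filter]
  refine Finset.sum_bij (fun s _ => T.ord s) ?_ ?_ ?_ ?_
  · intro s hs
    exact (Finset.mem_filter.1 hs).2.1
  · intro s hs t ht h
    exact T.inj _ (Finset.mem_range.1 (Finset.mem_filter.1 hs).1) _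
      (Finset.mem_range.1 (Finset.mem_filter.1 ht).1) h
  · intro v hv
    obtain ⟨h1, h2⟩ := pos_spec (T.X_lt v hv)
    refine ⟨T.pos v, Finset.mem_filter.2 ⟨Finset.mem_range.2 h1, by rwa [h2], ?_⟩, h2⟩
    rw [h2]
    exact (fin_mem (K := ∅) hv).resolve_right fun h => absurd h.1 (Finset.notMem_empty _)
  · intro s hs
    rw [pos_ord (Finset.mem_range.1 (Finset.mem_filter.1 hs).1)]

theorem krun_count (hK : K ⊆ T.X) : (T.krun μ K T.m T.m).1 = K.card := by
  classical
  rw [accumulate_sink (Z := fun t v => (T.krun μ K t v).1)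
    (a := fun t => if T.ord t ∈ K then 1 else 0) (fun v => rfl)
    (fun t _ h v => by rw [krun_succ_of_notMem h]) (fun t _ h => ?_)
    (fun t _ v h => by rw [krun_succ_ne fun _ => h])]
  · rw [Finset.card_eq_sum_ones, ← Finset.sum_filter]
    refine Finset.sum_congr ?_ fun _ _ => rfl
    ext v
    rw [Finset.mem_filter]
    exact ⟨fun h => (pos_spec (T.X_lt v h.1)).2 ▸ h.2,
      fun h => ⟨hK h, by rwa [(pos_spec (T.X_lt v (hK h))).2]⟩⟩
  · rw [krun_succ_par h, kclo]
    split_ifs <;> simp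

theorem krun_losers (hK : K ⊆ T.X) : (T.krun μ K T.m T.m).2.2 =
    (K.filter fun v => T.weight K v = μ).card := by
  classical
  rw [accumulate_sink (Z := fun t v => (T.krun μ K t v).2.2)
    (a := fun t => if T.ord t ∈ K ∧ (T.krun μ K t (T.ord t)).2.1 = μ then 1 else 0) (fun v => rfl)
    (fun t _ h v => by rw [krun_succ_of_notMem h]) (fun t _ h => ?_)
    (fun t _ v h => by rw [krun_succ_ne fun _ => h])]
  · rw [Finset.card_eq_sum_ones, ← Finset.sum_filter]
    refine Finset.sum_congr ?_ fun _ _ => rfl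
    ext v
    rw [Finset.mem_filter, Finset.mem_filter]
    constructor
    · rintro ⟨h1, h2⟩
      rw [(pos_spec (T.X_lt v h1)).2] at h2
      exact ⟨h2.1, by rw [← krun_eq_weight (μ := μ) h1 h2.1]; exact h2.2⟩
    · rintro ⟨h1, h2⟩
      rw [(pos_spec (T.X_lt v (hK h1))).2, krun_eq_weight (hK h1) h1]
      exact ⟨hK h1, h1, h2⟩
  · rw [krun_succ_par h, kclo]
    by_cases hK : T.ord t ∈ K <;> simp [hK]

theorem krun_fst_le {t v : ℕ} (ht : t ≤ T.m) (hv : T.Rem t v) : (T.krun μ K t v).1 ≤ t := by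
  classical
  rw [accumulate (Z := fun t v => (T.krun μ K t v).1)
    (a := fun t => if T.ord t ∈ K then 1 else 0) (fun v => rfl)
    (fun t _ h v => by rw [krun_succ_of_notMem h]) (fun t _ h => ?_)
    (fun t _ v h => by rw [krun_succ_ne fun _ => h]) ht hv]
  · calc _ ≤ ∑ s ∈ Finset.range t, 1 := Finset.sum_le_sum fun s _ => by split_ifs <;> simp
      _ = t := by simp
  · rw [krun_succ_par h, kclo]
    split_ifs <;> simp

/-- The dynamic program bounds every set of cuts. -/
theorem card_le_dp (hKL : K ⊆ L) (hK : K ⊆ T.X) (hval : ∀ v ∈ K, μ ≤ T.weight K v) {l : ℕ}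
    (hl : l < N) (hlos : (K.filter fun v => T.weight K v = μ).card ≤ l) :
    K.card ≤ (T.dp N L μ T.m T.m l).1 := by
  rw [← krun_count (μ := μ) hK]
  exact (krun_le_dp hKL (valid_iff.2 fun v hv _ => hval v hv) _ hl
    (by rwa [krun_losers hK])).fst_le

/-- With `card_le_dp`: at the sink the table holds the maximal number of cuts from `L` whose parts
weigh at least `μ`, with at most `l` light ones. The vertices above all cuts form no part of their
own. -/
theorem exists_card_eq_dp {l : ℕ} (hl : l < N) : ∃ K ⊆ L, K ⊆ T.X ∧
    (∀ v ∈ K, μ ≤ T.weight K v) ∧ (K.filter fun v => T.weight K v = μ).card ≤ l ∧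
    K.card = (T.dp N L μ T.m T.m l).1 := by
  obtain ⟨K, h1, h2, h3⟩ := exists_krun_eq_dp (T := T) (L := L) (μ := μ) le_rfl (fun _ => l)
    fun _ => hl
  have hX : K ⊆ T.X := fun v hv => (h1 v hv).2.1
  obtain ⟨h4, h5⟩ := h3 T.m (Or.inl rfl)
  refine ⟨K, fun v hv => (h1 v hv).1, hX, fun v hv => valid_iff.1 h2 v hv (hX hv), ?_, ?_⟩
  · rwa [← krun_losers hX]
  · rw [← h5]; exact (krun_count hX).symm

theorem dp_fst_le (ht : t ≤ T.m) {v : ℕ} (hv : T.Rem t v) {l : ℕ} (hl : l < N) :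
    (T.dp N L μ t v l).1 ≤ t := by
  obtain ⟨K, -, -, h3⟩ := exists_krun_eq_dp (T := T) (L := L) (μ := μ) ht (fun _ => l)
    fun _ => hl
  rw [← (h3 v hv).2]
  exact krun_fst_le ht hv

theorem dp_fst_mono {L' : Finset ℕ} (h : L ⊆ L') {l : ℕ} (hl : l < N) :
    (T.dp N L μ T.m T.m l).1 ≤ (T.dp N L' μ T.m T.m l).1 := by
  obtain ⟨K, h1, h2, h3, h4, h5⟩ := exists_card_eq_dp (T := T) (L := L) (μ := μ) hl
  rw [← h5]
  exact card_le_dp (h1.trans h) h2 h3 hl h4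

/-- Omitting a cut enlarges the parts of the other cuts. -/
theorem weight_mono {K' : Finset ℕ} (hK : K ⊆ T.X) (h : K' ⊆ K) {v : ℕ} (hv : v ∈ K') :
    T.weight K v ≤ T.weight K' v := by
  classical
  refine Finset.sum_le_sum_of_subset_of_nonneg (fun y hy => ?_) fun _ _ _ => T.w_nonneg _
  rw [Finset.mem_filter] at hy ⊢
  refine ⟨hy.1, ?_⟩
  refine induction_down (T := T) (motive := fun y => T.fin K y = v → T.fin K' y = v)
    (fun y hyX ih hfin => ?_) y hy.1 hy.2
  by_cases hyK : y ∈ K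
  · rw [fin_of_mem hyX hyK] at hfin
    subst hfin
    exact fin_of_mem hyX hv
  · rw [fin_par hyX hyK] at hfin
    rw [fin_par hyX fun h' => hyK (h h')]
    refine ih ?_ hfin
    refine (pos_lt_par hyX fun hP => ?_).1
    rw [hP, fin_sink] at hfin
    exact absurd (T.X_lt _ (hK (h hv))) (by omega)

/-- An inclusion-minimal set of admissible cuts is optimal. -/
theorem minimal_cuts {κ l : ℕ} (hl : l < N) (hLX : L ⊆ T.X)
    (hκ : κ ≤ (T.dp N L μ T.m T.m l).1)
    (hmin : ∀ v ∈ L, (T.dp N (L.erase v) μ T.m T.m l).1 < κ) :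
    L.card = κ ∧ (∀ v ∈ L, μ ≤ T.weight L v) ∧
      (L.filter fun v => T.weight L v = μ).card ≤ l := by
  obtain ⟨K, h1, h2, h3, h4, h5⟩ := exists_card_eq_dp (T := T) (L := L) (μ := μ) hl
  -- An optimal `K` uses all of `L`: a cut outside `K` could be erased from `L` without lowering the
  -- table value.
  have hKL : K = L := by
    refine h1.antisymm fun v hv => ?_
    by_contra hvK
    refine absurd (hmin v hv) (not_lt.2 (hκ.trans ?_))
    rw [← h5]
    exact card_le_dp (fun x hx => Finset.mem_erase.2 ⟨by rintro rfl; exact hvK hx, h1 hx⟩) h2 h3 hl h4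
  subst hKL
  refine ⟨le_antisymm ?_ (h5 ▸ hκ), h3, h4⟩
  -- A surplus cut could be dropped: the other parts only grow, so they stay heavy enough, and those
  -- of weight exactly `μ` were so before.
  by_contra! hlt
  obtain ⟨v, hv⟩ := Finset.card_pos.1 (lt_of_le_of_lt (Nat.zero_le _) hlt)
  have hsub := Finset.erase_subset v K
  refine absurd (hmin v hv) (not_lt.2 (le_trans ?_ (card_le_dp (K := K.erase v) le_rfl
    (hsub.trans h2) (fun x hx => (h3 x (hsub hx)).trans (weight_mono h2 hsub hx)) hl
    (le_trans (Finset.card_le_card fun x hx => ?_) h4))))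
  · rw [Finset.card_erase_of_mem hv]; omega
  · rw [Finset.mem_filter] at hx ⊢
    exact ⟨hsub hx.1, le_antisymm (hx.2 ▸ weight_mono h2 hsub hx.1) (h3 x (hsub hx.1))⟩

/-! ### No parts of weight exactly `μ` -/

theorem clo_zero {al : Prop} {x : ℕ → ℕ × ℝ} (hal : al) :
    clo al μ x 0 = if μ < (x 0).2 then ((x 0).1 + 1, 0) else x 0 := by
  simp [clo, hal]

theorem mergeAt_zero (hN : 0 < N) (x y : ℕ → ℕ × ℝ) : mergeAt N x y 0 = x 0 + y 0 := by
  have := (splitAt_spec hN x y).1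
  rw [mergeAt, Nat.le_zero.1 this]

/-- The same exchange argument as for optimality: whatever closes above `μ'` may close above `μ`,
unless more parts are closed already. The second conjunct compares the summands of `potential`. -/
theorem dp_anti (hN : 0 < N) (hL : T.X ⊆ L) {μ' : ℝ} (h : μ ≤ μ') (t v : ℕ) :
    LexLE (T.dp N L μ' t v 0) (T.dp N L μ t v 0) ∧ (T.ord t ∈ T.X →
    LexLE (clo (T.ord t ∈ L) μ' (T.dp N L μ' t (T.ord t)) 0)
      (clo (T.ord t ∈ L) μ (T.dp N L μ t (T.ord t)) 0)) := by
  have hclo : ∀ t, (∀ v, LexLE (T.dp N L μ' t v 0) (T.dp N L μ t v 0)) → T.ord t ∈ T.X →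
    LexLE (clo (T.ord t ∈ L) μ' (T.dp N L μ' t (T.ord t)) 0)
      (clo (T.ord t ∈ L) μ (T.dp N L μ t (T.ord t)) 0) := by
    intro t ih hX
    have ih := ih (T.ord t)
    rw [clo_zero (hL hX)]
    split_ifs with h1
    · rcases ih with ih | ⟨ih, ih'⟩
      · exact (LexLE.close ih (dp_nonneg _ _ _)).trans (le_clo _ _ _ _)
      · rw [ih]
        exact close_le_clo (hL hX) (h.trans_lt (h1.trans_le ih'))
    · exact ih.trans (le_clo _ _ _ _)
  have main : ∀ v, LexLE (T.dp N L μ' t v 0) (T.dp N L μ t v 0) := by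
    induction t with
    | zero => exact fun v => LexLE.refl _
    | succ t ih =>
      intro v
      by_cases hX : T.ord t ∈ T.X
      swap
      · rw [dp_succ_of_notMem hX, dp_succ_of_notMem hX]; exact ih v
      by_cases hv : v = T.P (T.ord t)
      · rw [hv, dp_succ_par hX, dp_succ_par hX, mergeAt_zero hN, mergeAt_zero hN]
        exact (ih _).add (hclo t ih hX)
      · rw [dp_succ_ne fun _ => hv, dp_succ_ne fun _ => hv]; exact ih v
  exact ⟨main v, hclo t main⟩

/-- Parents are eliminated later than their children, so the entry of a vertex is frozen from its
elimination on and can be read off the final table. -/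
theorem dp_eq_of_le {s t v : ℕ} (hst : s ≤ t) (ht : t ≤ T.m) (hv : v = T.ord s) (hs : s < T.m)
    (l : ℕ) : T.dp N L μ t v l = T.dp N L μ s v l := by
  induction t, hst using Nat.le_induction with
  | base => rfl
  | succ t hst ih =>
    rw [dp_succ_ne, ih (by omega)]
    intro hX
    rw [hv]
    exact ((rem_par (by omega) hX).ne (by omega) hs).symm

theorem dp_final {v : ℕ} (hv : v < T.m) (l : ℕ) :
    T.dp N L μ T.m v l = T.dp N L μ (T.pos v) v l :=
  dp_eq_of_le (pos_spec hv).1.le le_rfl (pos_spec hv).2.symm (pos_spec hv).1 l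

open Classical in
/-- The vertices at which a part is closed if only parts of weight more than `μ` are allowed. -/
noncomputable def greedy (T : Rooted) (N : ℕ) (L : Finset ℕ) (μ : ℝ) : Finset ℕ :=
  T.X.filter fun v => μ < (T.dp N L μ T.m v 0).2

/-- With bound `0` there is nothing to split and nothing to pay with, so the table is the run of one
explicit set of cuts. The threshold `μ'` affects only the third component of `krun` and is
arbitrary. -/
theorem krun_greedy (hN : 0 < N) (hL : T.X ⊆ L) {μ' : ℝ} {t : ℕ} (ht : t ≤ T.m) (v : ℕ) :
    ((T.krun μ' (T.greedy N L μ) t v).1, (T.krun μ' (T.greedy N L μ) t v).2.1) =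
      T.dp N L μ t v 0 := by
  induction t generalizing v with
  | zero => rfl
  | succ t ih =>
    have ih := ih (by omega)
    by_cases hX : T.ord t ∈ T.X
    swap
    · rw [dp_succ_of_notMem hX, krun_succ_of_notMem hX]; exact ih v
    by_cases hv : v = T.P (T.ord t)
    swap
    · rw [dp_succ_ne fun _ => hv, krun_succ_ne fun _ => hv]; exact ih v
    rw [hv, dp_succ_par hX, krun_succ_par hX, mergeAt_zero hN, clo_zero (hL hX), ← ih, ← ih]
    have hmem : T.ord t ∈ T.greedy N L μ ↔ μ < (T.krun μ' (T.greedy N L μ) t (T.ord t)).2.1 := by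
      rw [greedy, Finset.mem_filter, dp_final (T.lt t (by omega)), pos_ord (by omega), ← greedy,
        ← ih]
      simp [hX]
    simp only [kclo, hmem]
    split_ifs <;> rfl

theorem greedy_weight (hN : 0 < N) (hL : T.X ⊆ L) {v : ℕ} (hv : v ∈ T.greedy N L μ) :
    T.weight (T.greedy N L μ) v = (T.dp N L μ T.m v 0).2 := by
  have hX := (Finset.mem_filter.1 hv).1
  rw [← krun_eq_weight (μ := 0) hX hv, dp_final (T.X_lt v hX),
    ← krun_greedy (μ' := 0) hN hL (pos_spec (T.X_lt v hX)).1.le]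

theorem card_greedy (hN : 0 < N) (hL : T.X ⊆ L) :
    (T.greedy N L μ).card = (T.dp N L μ T.m T.m 0).1 := by
  rw [← krun_greedy (μ' := 0) hN hL le_rfl]
  exact (krun_count (Finset.filter_subset _ _)).symm

/-- A potential that decreases along the iteration. -/
noncomputable def potential (T : Rooted) (N : ℕ) (L : Finset ℕ) (μ : ℝ) : ℕ :=
  ∑ t ∈ Finset.range T.m with T.ord t ∈ T.X, (clo (T.ord t ∈ L) μ (T.dp N L μ t (T.ord t)) 0).1

theorem potential_le (hN : 0 < N) (hL : T.X ⊆ L) : T.potential N L μ ≤ T.m * T.m := by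
  classical
  calc T.potential N L μ
      ≤ ∑ t ∈ Finset.range T.m with T.ord t ∈ T.X, T.m := by
        refine Finset.sum_le_sum fun t ht => ?_
        obtain ⟨h1, h2⟩ := Finset.mem_filter.1 ht
        have h1 := Finset.mem_range.1 h1
        have := dp_fst_le (L := L) (μ := μ) h1.le (rem_self h1) hN
        rw [clo_zero (hL h2)]
        split_ifs
        · exact Nat.succ_le_of_lt (this.trans_lt h1)
        · exact this.trans h1.le
    _ ≤ ∑ t ∈ Finset.range T.m, T.m :=
        Finset.sum_le_sum_of_subset (Finset.filter_subset _ _)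
    _ = T.m * T.m := by simp

/-- No summand increases. If all stayed equal, then inductively the two tables would agree, and
every vertex that closes above `μ` would also close above `μ'`. But the open weight at `v` is
exactly `μ'`. -/
theorem potential_lt (hN : 0 < N) (hL : T.X ⊆ L) {v : ℕ} (hv : v ∈ T.X) {μ' : ℝ}
    (hμ : μ < μ') (hμ' : μ' = (T.dp N L μ T.m v 0).2) :
    T.potential N L μ' < T.potential N L μ := by
  classical
  have hle : ∀ t ∈ (Finset.range T.m).filter fun t => T.ord t ∈ T.X,
      (clo (T.ord t ∈ L) μ' (T.dp N L μ' t (T.ord t)) 0).1 ≤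
        (clo (T.ord t ∈ L) μ (T.dp N L μ t (T.ord t)) 0).1 := fun t ht =>
    ((dp_anti hN hL hμ.le t 0).2 (Finset.mem_filter.1 ht).2).fst_le
  refine lt_of_le_of_ne (Finset.sum_le_sum hle) fun heq => ?_
  have heq := (Finset.sum_eq_sum_iff_of_le hle).1 heq
  have hclo : ∀ t < T.m, T.ord t ∈ T.X → (∀ v, T.dp N L μ' t v 0 = T.dp N L μ t v 0) →
      (μ < (T.dp N L μ t (T.ord t) 0).2 → μ' < (T.dp N L μ t (T.ord t) 0).2) ∧
      clo (T.ord t ∈ L) μ' (T.dp N L μ' t (T.ord t)) 0 =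
        clo (T.ord t ∈ L) μ (T.dp N L μ t (T.ord t)) 0 := by
    intro t ht hX h
    have := heq t (Finset.mem_filter.2 ⟨Finset.mem_range.2 ht, hX⟩)
    rw [clo_zero (hL hX), clo_zero (hL hX), h] at this ⊢
    by_cases h1 : μ' < (T.dp N L μ t (T.ord t) 0).2
    · rw [if_pos h1, if_pos (hμ.trans h1)]
      exact ⟨fun _ => h1, rfl⟩
    · by_cases h2 : μ < (T.dp N L μ t (T.ord t) 0).2
      · rw [if_neg h1, if_pos h2] at this
        simp at this
      · rw [if_neg h1, if_neg h2]
        exact ⟨fun h => absurd h h2, rfl⟩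
  have hdp : ∀ t ≤ T.m, ∀ v, T.dp N L μ' t v 0 = T.dp N L μ t v 0 := by
    intro t
    induction t with
    | zero => exact fun _ _ => rfl
    | succ t ih =>
      intro ht v
      have ih := ih (by omega)
      by_cases hX : T.ord t ∈ T.X
      swap
      · rw [dp_succ_of_notMem hX, dp_succ_of_notMem hX]; exact ih v
      by_cases hv : v = T.P (T.ord t)
      · rw [hv, dp_succ_par hX, dp_succ_par hX, mergeAt_zero hN, mergeAt_zero hN, ih,
          (hclo t (by omega) hX ih).2]
      · rw [dp_succ_ne fun _ => hv, dp_succ_ne fun _ => hv]; exact ih v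
  obtain ⟨h1, h2⟩ := pos_spec (T.X_lt v hv)
  have := (hclo _ h1 (by rwa [h2]) (hdp _ h1.le)).1
  rw [h2, ← dp_final (T.X_lt v hv), ← hμ'] at this
  exact lt_irrefl _ (this hμ)

/-- The next threshold: all parts found have at least this weight. -/
theorem le_dp_next (hN : 0 < N) (hL : T.X ⊆ L) {μ' : ℝ} {l : ℕ} (hl : l < N) (hm : T.m ≤ l)
    (hμ' : ∀ v ∈ T.X, μ < (T.dp N L μ T.m v 0).2 → μ' ≤ (T.dp N L μ T.m v 0).2) :
    (T.dp N L μ T.m T.m 0).1 ≤ (T.dp N L μ' T.m T.m l).1 := by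
  classical
  have hsub : T.greedy N L μ ⊆ T.X := Finset.filter_subset _ _
  rw [← card_greedy hN hL]
  refine card_le_dp (hsub.trans hL) hsub (fun v hv => ?_) hl ?_
  · rw [greedy_weight hN hL hv]
    obtain ⟨h1, h2⟩ := Finset.mem_filter.1 hv
    exact hμ' v h1 h2
  -- Since `l` is at least the number of vertices, the bound on light parts is no restriction.
  · calc _ ≤ (Finset.range T.m).card := Finset.card_le_card fun v hv =>
          Finset.mem_range.2 (T.X_lt v (hsub (Finset.mem_filter.1 hv).1))
      _ ≤ l := by simpa using hm

theorem exists_next (hN : 0 < N) (hL : T.X ⊆ L) (h : 0 < (T.dp N L μ T.m T.m 0).1) :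
    ∃ v ∈ T.X, μ < (T.dp N L μ T.m v 0).2 ∧ ∀ y ∈ T.X, μ < (T.dp N L μ T.m y 0).2 →
      (T.dp N L μ T.m v 0).2 ≤ (T.dp N L μ T.m y 0).2 := by
  rw [← card_greedy hN hL, Finset.card_pos] at h
  obtain ⟨v, hv, hmin⟩ := Finset.exists_min_image _ (fun v => (T.dp N L μ T.m v 0).2) h
  obtain ⟨h1, h2⟩ := Finset.mem_filter.1 hv
  exact ⟨v, h1, h2, fun y hy hμ => hmin y (Finset.mem_filter.2 ⟨hy, hμ⟩)⟩

end Rooted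

end FairDivision

/-! ### Allocations of trees as sets of cuts -/

namespace FairDivision

variable {m : ℕ} {G : SimpleGraph (Fin m)} {u : Finset (Fin m) → ℝ} {X : Finset (Fin m)}
  {T : Rooted}

/-- The rooted tree `T` describes the subgraph of `G` induced by `X`, weighted by `u`. -/
structure Describes (G : SimpleGraph (Fin m)) (u : Finset (Fin m) → ℝ) (X : Finset (Fin m))
    (T : Rooted) : Prop where
  size : T.m = m
  mem : ∀ v : Fin m, (v : ℕ) ∈ T.X ↔ v ∈ X
  adj : ∀ v ∈ X, ∀ z ∈ X, G.Adj v z → T.P v = z ∨ T.P z = v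
  par : ∀ v ∈ X, ∀ z : Fin m, T.P v = z → G.Adj v z
  weight : ∀ v ∈ X, T.w v = u {v}

/-- Parents are later in the elimination order, so climbing inside `Y` must end, and it can end only
at `τ`. -/
theorem Describes.connBundle (h : Describes G u X T) {Y : Finset (Fin m)} (hY : Y ⊆ X)
    {τ : Fin m} (hτ : τ ∈ Y) (hp : ∀ y ∈ Y, y ≠ τ → ∃ z ∈ Y, T.P y = z) : ConnBundle G Y := by
  have key : ∀ v ∈ T.X, ∀ y : Fin m, (y : ℕ) = v → ∀ hy : y ∈ (Y : Set (Fin m)),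
      (G.induce (Y : Set (Fin m))).Reachable ⟨y, hy⟩ ⟨τ, hτ⟩ := by
    refine Rooted.induction_down ?_
    rintro _ hv ih y rfl hy
    by_cases hyτ : y = τ
    · subst hyτ; rfl
    · obtain ⟨z, hz, hz'⟩ := hp y hy hyτ
      rw [hz'] at ih
      refine SimpleGraph.Reachable.trans (SimpleGraph.Adj.reachable ?_)
        (ih ((h.mem z).2 (hY hz)) z rfl hz)
      exact h.par y (hY hy) z hz'
  rintro ⟨x, hx⟩ ⟨y, hy⟩
  exact (key _ ((h.mem x).2 (hY hx)) x rfl hx).trans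
    (key _ ((h.mem y).2 (hY hy)) y rfl hy).symm

/-- The top is the last vertex of `Y` in the elimination order. If the parent of another `y` were
outside `Y`, the vertices of `Y` below `y` would be closed under adjacency in `Y`; by connectivity
all of `Y` would lie below `y`, which would make `y` the last one. -/
theorem Describes.exists_top (h : Describes G u X T) {Y : Finset (Fin m)} (hY : Y ⊆ X)
    (hne : Y.Nonempty) (hc : ConnBundle G Y) :
    ∃ τ ∈ Y, (∀ y ∈ Y, T.pos y ≤ T.pos τ) ∧ ∀ y ∈ Y, y ≠ τ → ∃ z ∈ Y, T.P y = z := by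
  classical
  obtain ⟨τ, hτ, hmax⟩ := Finset.exists_max_image Y (fun y => T.pos y) hne
  refine ⟨τ, hτ, hmax, fun y hy hyτ => ?_⟩
  by_contra! hP
  have hmem : ∀ z ∈ Y, (z : ℕ) ∈ T.X := fun z hz => (h.mem z).2 (hY hz)
  have hfy : T.fin {(y : ℕ)} y = y :=
    Rooted.fin_of_mem (hmem y hy) (Finset.mem_singleton_self _)
  have hfin : ∀ z ∈ Y, z ≠ y → T.fin {(y : ℕ)} z = T.fin {(y : ℕ)} (T.P z) := fun z hz hzy =>
    Rooted.fin_par (hmem z hz) (by simpa [Fin.val_inj] using hzy)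
  have hsub : Y ⊆ Y.filter fun z : Fin m => T.fin {(y : ℕ)} z = y := by
    refine hc.subset_of_closed hy (Finset.mem_filter.2 ⟨hy, hfy⟩) fun x hx hx' z hz hadj => ?_
    rw [Finset.mem_filter] at hx' ⊢
    refine ⟨hz, ?_⟩
    rcases h.adj x (hY hx) z (hY hz) hadj with h1 | h1
    · have hxy : x ≠ y := by rintro rfl; exact hP z hz h1
      rw [← h1, ← hfin x hx hxy, hx'.2]
    · by_cases hzy : z = y
      · rw [hzy, hfy]
      · rw [hfin z hz hzy, h1, hx'.2]
  have h1 := (Finset.mem_filter.1 (hsub hτ)).2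
  have h2 := Rooted.pos_le_fin (K := {(y : ℕ)}) (hmem τ hτ) (by rw [h1, h.size]; exact y.2.ne)
  rw [h1] at h2
  have h3 := (Rooted.pos_spec (T.X_lt _ (hmem y hy))).2
  rw [le_antisymm (hmax y hy) h2, (Rooted.pos_spec (T.X_lt _ (hmem τ hτ))).2] at h3
  exact hyτ (Fin.ext h3.symm)

theorem Describes.sum_weight (h : Describes G u X T) (hadd : IsAdditive u) {Y : Finset (Fin m)}
    (hY : Y ⊆ X) : u Y = ∑ v ∈ Y.map Fin.valEmbedding, T.w v := by
  rw [hadd, Finset.sum_map]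
  exact Finset.sum_congr rfl fun v hv => (h.weight v (hY hv)).symm

theorem utility_mono (hu : ∀ X, 0 ≤ u X) (hadd : IsAdditive u) {Y Z : Finset (Fin m)}
    (h : Y ⊆ Z) : u Y ≤ u Z := by
  rw [hadd Y, hadd Z]
  exact Finset.sum_le_sum_of_subset_of_nonneg h fun _ _ _ => hu _

theorem Describes.weight_le (h : Describes G u X T) (hadd : IsAdditive u) (hu : ∀ X, 0 ≤ u X)
    {K : Finset ℕ} {v : ℕ} {Y : Finset (Fin m)} (hY : ∀ y ∈ X, T.fin K y = v → y ∈ Y) :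
    T.weight K v ≤ u Y := by
  classical
  refine le_trans ?_ (utility_mono hu hadd (Y := X.filter fun y : Fin m => T.fin K y = v)
    fun y hy => hY y (Finset.mem_filter.1 hy).1 (Finset.mem_filter.1 hy).2)
  rw [h.sum_weight hadd (Finset.filter_subset _ _)]
  refine (Finset.sum_congr (Finset.ext fun y => ?_) fun _ _ => rfl).le
  simp only [Finset.mem_filter, Finset.mem_map, Fin.valEmbedding_apply]
  constructor
  · rintro ⟨h1, h2⟩
    exact ⟨⟨y, by rw [← h.size]; exact T.X_lt y h1⟩, ⟨(h.mem _).1 h1, h2⟩, rfl⟩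
  · rintro ⟨y, ⟨h1, h2⟩, rfl⟩
    exact ⟨(h.mem y).2 h1, h2⟩

/-- The dynamic program bounds the number of bundles of large utility. -/
theorem Describes.card_le_dp (h : Describes G u X T) (hadd : IsAdditive u)
    {ι : Type*} (I : Finset ι) (B : ι → Finset (Fin m)) (hsub : ∀ i ∈ I, B i ⊆ X)
    (hne : ∀ i ∈ I, (B i).Nonempty) (hc : ∀ i ∈ I, ConnBundle G (B i))
    (hdisj : ∀ i ∈ I, ∀ j ∈ I, i ≠ j → Disjoint (B i) (B j)) {μ : ℝ}
    (hμ : ∀ i ∈ I, μ ≤ u (B i)) {N l : ℕ} (hl : l < N)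
    (hlos : (I.filter fun i => u (B i) = μ).card ≤ l) :
    I.card ≤ (T.dp N T.X μ T.m T.m l).1 := by
  classical
  have htop : ∀ i, ∃ τ : ℕ, i ∈ I → ∃ t : Fin m, (t : ℕ) = τ ∧ t ∈ B i ∧
      ∀ y ∈ B i, y ≠ t → ∃ z ∈ B i, T.P y = z := by
    intro i
    by_cases hi : i ∈ I
    · obtain ⟨t, h1, -, h2⟩ := h.exists_top (hsub i hi) (hne i hi) (hc i hi)
      exact ⟨t, fun _ => ⟨t, rfl, h1, h2⟩⟩
    · exact ⟨0, fun h => absurd h hi⟩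
  choose τ hτ using htop
  have hinj : Set.InjOn τ I := by
    intro i hi j hj hij
    obtain ⟨s, h1, h2, -⟩ := hτ i hi
    obtain ⟨t, h3, h4, -⟩ := hτ j hj
    by_contra hne
    have : s = t := Fin.ext (by omega)
    subst this
    exact Finset.disjoint_left.1 (hdisj i hi j hj hne) h2 h4
  -- Cut every bundle at its top. Climbing inside a bundle meets no top of another bundle, so the
  -- bundle lies in the part of its own top, which weighs at least as much.
  set K := I.image τ with hK
  have hKX : K ⊆ T.X := by
    intro v hv
    obtain ⟨i, hi, rfl⟩ := Finset.mem_image.1 hv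
    obtain ⟨s, h1, h2, -⟩ := hτ i hi
    rw [← h1, h.mem]; exact hsub i hi h2
  have hfin : ∀ i ∈ I, ∀ v ∈ T.X, ∀ y ∈ B i, (y : ℕ) = v → T.fin K y = τ i := by
    intro i hi
    obtain ⟨s, h1, h2, h3⟩ := hτ i hi
    refine Rooted.induction_down ?_
    rintro _ hv ih y hy rfl
    by_cases hyK : (y : ℕ) ∈ K
    · rw [Rooted.fin_of_mem hv hyK]
      obtain ⟨j, hj, hjy⟩ := Finset.mem_image.1 hyK
      obtain ⟨t, h4, h5, -⟩ := hτ j hj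
      have : t = y := Fin.ext (h4.trans hjy)
      subst this
      by_contra hne
      have hij : i ≠ j := by rintro rfl; exact hne hjy.symm
      exact Finset.disjoint_left.1 (hdisj i hi j hj hij) hy h5
    · rw [Rooted.fin_par hv hyK]
      obtain ⟨z, hz, hz'⟩ := h3 y hy (by
        rintro rfl
        exact hyK (h1 ▸ Finset.mem_image_of_mem τ hi))
      rw [hz'] at ih ⊢
      exact ih ((h.mem z).2 (hsub i hi hz)) z hz rfl
  have hw : ∀ i ∈ I, u (B i) ≤ T.weight K (τ i) := by
    intro i hi
    rw [h.sum_weight hadd (hsub i hi), Rooted.weight]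
    refine Finset.sum_le_sum_of_subset_of_nonneg (fun y hy => ?_) fun _ _ _ => T.w_nonneg _
    obtain ⟨y, hy', rfl⟩ := Finset.mem_map.1 hy
    have hyX := (h.mem y).2 (hsub i hi hy')
    exact Finset.mem_filter.2 ⟨hyX, hfin i hi y hyX y hy' rfl⟩
  rw [← Finset.card_image_of_injOn hinj, ← hK]
  refine Rooted.card_le_dp hKX hKX (fun v hv => ?_) hl (le_trans ?_ hlos)
  · obtain ⟨i, hi, rfl⟩ := Finset.mem_image.1 hv
    exact (hμ i hi).trans (hw i hi)
  -- A part of weight exactly `μ` contains a bundle of utility at least `μ`, which is therefore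
  -- light as well.
  · refine (Finset.card_le_card fun v hv => ?_).trans (Finset.card_image_le (f := τ))
    obtain ⟨hv, hv'⟩ := Finset.mem_filter.1 hv
    obtain ⟨i, hi, rfl⟩ := Finset.mem_image.1 hv
    exact Finset.mem_image_of_mem _ (Finset.mem_filter.2
      ⟨hi, le_antisymm (hv' ▸ hw i hi) (hμ i hi)⟩)

/-- The number of cuts after `v`. -/
noncomputable def cutRank (T : Rooted) (L : Finset ℕ) (v : ℕ) : ℕ :=
  rankBelow (fun y => T.m - T.pos y) L (T.m - T.pos v)

theorem bijOn_cutRank {L : Finset ℕ} (hL : L ⊆ T.X) :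
    Set.BijOn (cutRank T L) L (Finset.range L.card) := by
  refine bijOn_rankBelow (key := fun y => T.m - T.pos y) fun x hx y hy hxy => ?_
  obtain ⟨h1, h2⟩ := Rooted.pos_spec (T.X_lt x (hL hx))
  obtain ⟨h3, h4⟩ := Rooted.pos_spec (T.X_lt y (hL hy))
  rw [← h2, ← h4]
  congr 1
  simp only at hxy
  omega

theorem cutRank_eq_zero {L : Finset ℕ} (hL : L ⊆ T.X) {v : ℕ} (h : cutRank T L v = 0) :
    ∀ c ∈ L, T.pos c ≤ T.pos v := by
  intro c hc
  by_contra! hlt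
  have := (Rooted.pos_spec (T.X_lt c (hL hc))).1
  rw [cutRank, rankBelow, Finset.card_eq_zero] at h
  exact Finset.notMem_empty c (h ▸ Finset.mem_filter.2 ⟨hc, show _ < _ by omega⟩)

/-- Labels of the vertices such that the parts of the cuts of `L` get different labels, and the rest
shares the label of the part of the last cut. -/
structure Labels (T : Rooted) (L : Finset ℕ) (lab : ℕ → ℕ) : Prop where
  cut : ∀ v ∈ L, v ∈ T.X → lab v = cutRank T L v
  top : ∀ v ∉ L, v ∈ T.X → T.P v = T.m → lab v = 0
  step : ∀ v ∉ L, v ∈ T.X → T.P v ≠ T.m → lab v = lab (T.P v)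

/-- The label is copied along the climb to the nearest cut or to the sink. -/
theorem Labels.eq {L : Finset ℕ} {lab : ℕ → ℕ} (h : Labels T L lab) :
    ∀ v ∈ T.X, (T.fin L v ≠ T.m → lab v = cutRank T L (T.fin L v)) ∧
      (T.fin L v = T.m → lab v = 0) := by
  refine Rooted.induction_down fun v hv ih => ?_
  by_cases hvL : v ∈ L
  · rw [Rooted.fin_of_mem hv hvL]
    exact ⟨fun _ => h.cut v hvL hv, fun h => absurd (T.X_lt v hv) (by omega)⟩
  · rw [Rooted.fin_par hv hvL]
    by_cases hP : T.P v = T.m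
    · rw [hP, Rooted.fin_sink]
      exact ⟨fun h => absurd rfl h, fun _ => h.top v hvL hv hP⟩
    · rw [h.step v hvL hv hP]
      exact ih (Rooted.pos_lt_par hv hP).1

section

variable {L : Finset ℕ} {lab : ℕ → ℕ}

theorem Labels.lt (h : Labels T L lab) (hL : L ⊆ T.X) {v : ℕ} (hv : v ∈ T.X) {k : ℕ}
    (hk : 0 < k) (hLk : L.card ≤ k) : lab v < k := by
  by_cases hf : T.fin L v = T.m
  · rw [(h.eq v hv).2 hf]; exact hk
  · rw [(h.eq v hv).1 hf]
    have hfL := ((Rooted.fin_mem (K := L) hv).resolve_left hf).1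
    exact (Finset.mem_range.1 ((bijOn_cutRank hL).mapsTo hfL)).trans_le hLk

/-- A positive label belongs to the part of one cut, and climbing leads to that cut. Label `0` joins
the part of the last cut, if there is one, with the vertices above all cuts: the parent of the last
cut is below no other cut, so climbing goes on to the top of `X`. -/
theorem Describes.connBundle_labels (h : Describes G u X T) (hX : ConnBundle G X)
    (hlab : Labels T L lab) (hL : L ⊆ T.X) (i : ℕ) :
    ConnBundle G (X.filter fun v : Fin m => lab v = i) := by
  classical
  set Y := X.filter fun v : Fin m => lab v = i with hY
  have hYX : Y ⊆ X := Finset.filter_subset _ _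
  have hmemY : ∀ v : Fin m, v ∈ Y ↔ (v : ℕ) ∈ T.X ∧ lab v = i := fun v => by
    rw [hY, Finset.mem_filter, h.mem]
  have hval : ∀ z, z ∈ T.X → lab z = i → ∃ z' ∈ Y, z = (z' : Fin m) := fun z hz hi =>
    ⟨⟨z, by rw [← h.size]; exact T.X_lt z hz⟩, (hmemY _).2 ⟨hz, hi⟩, rfl⟩
  rcases Y.eq_empty_or_nonempty with hYe | ⟨y0, hy0⟩
  · rw [hYe]; exact connBundle_empty
  obtain ⟨hy0X, hy0i⟩ := (hmemY y0).1 hy0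
  rcases Nat.eq_zero_or_pos i with hi | hi
  · obtain ⟨τ, h1, h2, h3⟩ := h.exists_top subset_rfl ⟨y0, hYX hy0⟩ hX
    have hτX := (h.mem τ).2 h1
    have hτP : T.P τ = T.m := by
      by_contra hP
      obtain ⟨h4, h5⟩ := Rooted.pos_lt_par hτX hP
      have hlt : T.P τ < m := (T.X_lt _ h4).trans_eq h.size
      have := h2 ⟨T.P τ, hlt⟩ ((h.mem _).1 h4)
      simp only at this
      omega
    have hτY : τ ∈ Y := by
      refine (hmemY τ).2 ⟨hτX, ?_⟩
      by_cases hτL : (τ : ℕ) ∈ L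
      · rw [hlab.cut _ hτL hτX, hi, cutRank, rankBelow, Finset.card_eq_zero,
          Finset.filter_eq_empty_iff]
        intro c hc
        have hlt : c < m := by rw [← h.size]; exact T.X_lt _ (hL hc)
        have := h2 ⟨c, hlt⟩ ((h.mem _).1 (hL hc))
        simp only at this
        omega
      · rw [hlab.top _ hτL hτX hτP, hi]
    refine h.connBundle hYX hτY fun y hy hyτ => ?_
    obtain ⟨z, hz, hz'⟩ := h3 y (hYX hy) hyτ
    obtain ⟨hyX, hyi⟩ := (hmemY y).1 hy
    have hzX := (h.mem z).2 hz
    refine ⟨z, (hmemY z).2 ⟨hzX, ?_⟩, hz'⟩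
    have hPm : T.P y ≠ T.m := by rw [hz', h.size]; exact z.2.ne
    by_cases hyL : (y : ℕ) ∈ L
    · rw [hi]
      refine (hlab.eq z hzX).2 ?_
      by_contra hf
      have hfL := ((Rooted.fin_mem (K := L) hzX).resolve_left hf).1
      rw [hlab.cut _ hyL hyX, hi] at hyi
      have h4 := cutRank_eq_zero hL hyi _ hfL
      have h5 := Rooted.pos_le_fin hzX hf
      have h6 := (Rooted.pos_lt_par hyX hPm).2
      rw [hz'] at h6
      omega
    · rw [← hz', ← hlab.step _ hyL hyX hPm, hyi]
  · have hfin : ∀ y ∈ Y, T.fin L y ∈ L ∧ T.fin L y ∈ T.X ∧ cutRank T L (T.fin L y) = i := by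
      intro y hy
      obtain ⟨hyX, hyi⟩ := (hmemY y).1 hy
      have hf : T.fin L y ≠ T.m := fun hf => by
        rw [(hlab.eq y hyX).2 hf] at hyi; omega
      obtain ⟨h1, h2⟩ := (Rooted.fin_mem (K := L) hyX).resolve_left hf
      exact ⟨h1, h2, by rw [← (hlab.eq y hyX).1 hf, hyi]⟩
    obtain ⟨h1, h2, h3⟩ := hfin y0 hy0
    obtain ⟨c, hc, hc'⟩ := hval _ h2 (by rw [hlab.cut _ h1 h2, h3])
    refine h.connBundle hYX hc fun y hy hyc => ?_
    obtain ⟨h4, h5, h6⟩ := hfin y hy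
    obtain ⟨hyX, hyi⟩ := (hmemY y).1 hy
    have h7 := (bijOn_cutRank hL).injOn h4 h1 (h6.trans h3.symm)
    have hyL : (y : ℕ) ∉ L := fun hyL => by
      rw [Rooted.fin_of_mem hyX hyL, hc'] at h7
      exact hyc (Fin.ext h7)
    have hPm : T.P y ≠ T.m := fun hP => by
      rw [Rooted.fin_par hyX hyL, hP, Rooted.fin_sink] at h4
      exact absurd (T.X_lt _ (hL h4)) (lt_irrefl _)
    exact hval _ (Rooted.pos_lt_par hyX hPm).1 (by rw [← hlab.step _ hyL hyX hPm, hyi])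

open Rooted in
/-- An optimal threshold with an optimal minimal set of cuts gives an SMMS allocation. -/
theorem Describes.isSMMS (h : Describes G u X T) (hadd : IsAdditive u) (hu : ∀ X, 0 ≤ u X)
    (hX : ConnBundle G X) {N k l : ℕ} (hk : 0 < k) (hkN : k < N) (hl : l < N) {μ : ℝ} (hμ : 0 ≤ μ)
    (h0 : (T.dp N T.X μ T.m T.m 0).1 < k)
    (h1 : ∀ a < l, 0 < μ ∧ (T.dp N T.X μ T.m T.m a).1 < k)
    (h2 : 0 < μ → k ≤ (T.dp N T.X μ T.m T.m l).1) (hLX : L ⊆ T.X)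
    (h3 : min k (T.dp N T.X μ T.m T.m l).1 ≤ (T.dp N L μ T.m T.m l).1)
    (h4 : ∀ v ∈ L, (T.dp N (L.erase v) μ T.m T.m l).1 < min k (T.dp N T.X μ T.m T.m l).1)
    (hlab : Labels T L lab) :
    IsSMMS G u X (Finset.univ : Finset (Fin k)) fun i => X.filter fun v : Fin m => lab v = i := by
  classical
  obtain ⟨hcard, hval, hlos⟩ := minimal_cuts hl hLX h3 h4
  set κ := min k (T.dp N T.X μ T.m T.m l).1 with hκ
  have hκk : κ ≤ k := min_le_left _ _
  have hNE : (Finset.univ : Finset (Fin k)).Nonempty := ⟨⟨0, hk⟩, Finset.mem_univ _⟩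
  have huniv : (Finset.univ : Finset (Fin k)).card = k := by simp
  have hempty : u ∅ = 0 := by rw [hadd]; simp
  set A : Fin k → Finset (Fin m) := fun i => X.filter fun v : Fin m => lab v = i with hA
  have halloc : IsConnAlloc G X Finset.univ A := by
    refine ⟨fun i _ => h.connBundle_labels hX hlab hLX i, fun i _ j _ hij => ?_, ?_⟩
    · refine Finset.disjoint_left.2 fun v hi hj => hij (Fin.ext ?_)
      rw [← (Finset.mem_filter.1 hi).2, ← (Finset.mem_filter.1 hj).2]
    · ext v
      simp only [Finset.mem_biUnion, Finset.mem_univ, true_and, hA, Finset.mem_filter]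
      refine ⟨fun ⟨_, h, _⟩ => h, fun hv => ⟨⟨lab v, ?_⟩, hv, rfl⟩⟩
      exact hlab.lt hLX ((h.mem v).2 hv) hk (hcard.le.trans hκk)
  have hcut : ∀ i : Fin k, (i : ℕ) < κ → ∃ c ∈ L, cutRank T L c = i ∧ T.weight L c ≤ u (A i) := by
    intro i hi
    obtain ⟨c, hc, hci⟩ := (bijOn_cutRank hLX).surjOn
      (show (i : ℕ) ∈ ((Finset.range L.card : Finset ℕ) : Set ℕ) by simpa [hcard] using hi)
    refine ⟨c, hc, hci, h.weight_le hadd hu fun y hy hyc => Finset.mem_filter.2 ⟨hy, ?_⟩⟩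
    rw [(hlab.eq y ((h.mem y).2 hy)).1 (by rw [hyc]; exact (T.X_lt c (hLX hc)).ne), hyc]
    exact hci
  -- For positive `μ` there are as many cuts as agents; for `μ = 0` there is nothing to show.
  have hAμ : ∀ i, μ ≤ u (A i) := by
    intro i
    rcases hμ.eq_or_lt with hμ0 | hμ0
    · rw [← hμ0]; exact hu _
    · obtain ⟨c, hc, -, hci⟩ := hcut i (by rw [hκ, min_eq_left (h2 hμ0)]; exact i.2)
      exact (hval c hc).trans hci
  have hbundles : ∀ (B : Fin k → Finset (Fin m)), IsConnAlloc G X Finset.univ B →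
      ∀ I : Finset (Fin k), (∀ i ∈ I, 0 < u (B i)) → (∀ i ∈ I, μ ≤ u (B i)) → ∀ a < N,
      (I.filter fun i => u (B i) = μ).card ≤ a → I.card ≤ (T.dp N T.X μ T.m T.m a).1 := by
    intro B hB I hpos hI a ha hIa
    refine h.card_le_dp hadd I B (fun i _ => hB.subset (Finset.mem_univ i)) (fun i hi => ?_)
      (fun i _ => hB.conn i (Finset.mem_univ i))
      (fun i _ j _ hij => hB.disj i (Finset.mem_univ i) j (Finset.mem_univ j) hij) hI ha hIa
    rw [Finset.nonempty_iff_ne_empty]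
    intro he
    have := hpos i hi
    rw [he, hempty] at this
    exact lt_irrefl _ this
  -- A larger share would give `k` bundles strictly above `μ`, which the table entry at bound `0`
  -- forbids.
  have hshare : maximinShare G u (Finset.univ : Finset (Fin k)).card X = μ := by
    refine le_antisymm ?_ (le_maximinShare halloc hNE fun i _ => hAμ i)
    by_contra! hlt
    obtain ⟨B, hB, hBm⟩ := exists_maximinShare (u := u) hNE ⟨A, halloc⟩
    have hlt' : ∀ i, μ < u (B i) := fun i => hlt.trans_le (hBm i (Finset.mem_univ i))
    have := hbundles B hB Finset.univ (fun i _ => hμ.trans_lt (hlt' i)) (fun i _ => (hlt' i).le) 0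
      (by omega) (by
        rw [Nat.le_zero, Finset.card_eq_zero, Finset.filter_eq_empty_iff]
        exact fun i _ => (hlt' i).ne')
    rw [huniv] at this
    omega
  refine ⟨halloc, fun i _ => hshare ▸ hAμ i, fun B hB hBm => ?_⟩
  -- Among the labels of cuts, a loser comes from a light part; the remaining `k - κ` labels are all
  -- counted as losers.
  have hlosA : (losers G u X Finset.univ A).card ≤ l + (k - κ) := by
    have hsub : losers G u X Finset.univ A ⊆
        (Finset.univ.filter fun i : Fin k => (i : ℕ) < κ ∧ u (A i) = μ) ∪
          Finset.univ.filter fun i : Fin k => κ ≤ (i : ℕ) := by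
      intro i hi
      rw [losers, hshare, Finset.mem_filter] at hi
      rw [Finset.mem_union, Finset.mem_filter, Finset.mem_filter]
      rcases Nat.lt_or_ge i κ with hiκ | hiκ
      · exact Or.inl ⟨Finset.mem_univ _, hiκ, hi.2⟩
      · exact Or.inr ⟨Finset.mem_univ _, hiκ⟩
    refine (Finset.card_le_card hsub).trans ((Finset.card_union_le _ _).trans (add_le_add ?_ ?_))
    · refine le_trans ?_ hlos
      choose! c hc1 hc2 hc3 using hcut
      refine Finset.card_le_card_of_injOn c (fun i hi => ?_) fun i hi j hj hij => ?_
      · obtain ⟨-, h5, h6⟩ := Finset.mem_filter.1 hi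
        exact Finset.mem_filter.2 ⟨hc1 i h5, le_antisymm (h6 ▸ hc3 i h5) (hval _ (hc1 i h5))⟩
      · have h5 := (Finset.mem_filter.1 hi).2.1
        have h6 := (Finset.mem_filter.1 hj).2.1
        refine Fin.ext ?_
        rw [← hc2 i h5, ← hc2 j h6, hij]
    · have : ((Finset.univ.filter fun i : Fin k => κ ≤ (i : ℕ)).map Fin.valEmbedding) ⊆
          Finset.Ico κ k := by
        intro x hx
        obtain ⟨i, hi, rfl⟩ := Finset.mem_map.1 hx
        exact Finset.mem_Ico.2 ⟨(Finset.mem_filter.1 hi).2, i.2⟩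
      simpa using Finset.card_le_card this
  refine hlosA.trans ?_
  have hBμ : ∀ i, μ ≤ u (B i) := fun i => hshare ▸ hBm i (Finset.mem_univ i)
  set b := (losers G u X Finset.univ B).card with hb
  have hlosB : losers G u X Finset.univ B = Finset.univ.filter fun i => u (B i) = μ := by
    rw [losers, hshare]
  have hbk : b ≤ k := by
    rw [hb]; exact (Finset.card_le_univ _).trans (by simp)
  -- If `μ = 0`, then `l = 0`, and `κ` bounds the number of bundles of positive utility, that is, of
  -- non-losers of `B`. If `μ > 0`, then `κ = k`, and the number of losers of `B` is a bound that
  -- admits `k` parts, whereas `l` is the least such bound.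
  rcases hμ.eq_or_lt with hμ0 | hμ0
  · have hl0 : l = 0 := by
      by_contra hl0
      have := (h1 0 (by omega)).1
      rw [← hμ0] at this
      exact lt_irrefl _ this
    have h5 := hbundles B hB (Finset.univ \ losers G u X Finset.univ B) (fun i hi => ?_)
      (fun i _ => hBμ i) 0 (by omega) ?_
    · rw [Finset.card_sdiff_of_subset (Finset.subset_univ _), huniv, ← hb] at h5
      have h6 : κ = (T.dp N T.X μ T.m T.m 0).1 := by
        rw [hκ, hl0]; exact min_eq_right h0.le
      omega
    · refine lt_of_le_of_ne (hu _) fun h5 => ?_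
      rw [hlosB, Finset.mem_sdiff, Finset.mem_filter] at hi
      exact hi.2 ⟨Finset.mem_univ _, by rw [← h5, hμ0]⟩
    · rw [Nat.le_zero, Finset.card_eq_zero, Finset.filter_eq_empty_iff]
      intro i hi h5
      rw [hlosB, Finset.mem_sdiff, Finset.mem_filter] at hi
      exact hi.2 ⟨Finset.mem_univ _, h5⟩
  · have h5 := hbundles B hB Finset.univ (fun i _ => hμ0.trans_le (hBμ i)) (fun i _ => hBμ i) b
      (by omega) (by rw [hb, hlosB])
    rw [huniv] at h5
    have h6 : κ = k := by rw [hκ, min_eq_left (h2 hμ0)]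
    have h7 : l ≤ b := by
      by_contra! hlt
      have := (h1 b hlt).2
      omega
    omega

end

end FairDivision

/-! ### Counted loops -/

namespace RAM

section

variable {Q : Type} {O : Q → Mem → Mem} {N : ℕ}

/-- Execute `c` with the counter in cell `(0, 0)` of array `a` running from `0` to the bound. -/
def Stm.forTo (a : ℕ) (b : NEx) (c : Stm Q) : Stm Q := .seq (.tabN a (.const 0))
  (.rep (.ifte (.nlt (.row a (.const 0)) b) (.seq c (.tabN a (.add (.row a (.const 0)) (.const 1))))
    .skip))

@[simp] theorem Stm.natW_forTo (a : ℕ) (b : NEx) (c : Stm Q) :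
    (Stm.forTo a b c).natW = a :: (c.natW ++ [a] ++ []) := rfl
@[simp] theorem Stm.realW_forTo (a : ℕ) (b : NEx) (c : Stm Q) :
    (Stm.forTo a b c).realW = [] ++ (c.realW ++ [] ++ []) := rfl

/-- The underlying `rep` always makes `N` rounds; those after the `M`-th idle. The invariant must
ignore the counter's array, so that initialising and incrementing the counter preserve it. -/
theorem Stm.forTo_spec (hO : OracleFrame O) {a : ℕ} {b : NEx} {c : Stm Q} (hc : a ∉ c.natW)
    {M : ℕ} (hM : M ≤ N) (hN : 0 < N) (I : ℕ → Mem → Prop)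
    (hI : ∀ t σ σ', (∀ x, x ≠ a → σ'.nat x = σ.nat x) → σ'.real = σ.real → I t σ → I t σ')
    (hb : ∀ t ≤ M, ∀ σ, I t σ → b.val N σ (fun _ => 0) = M)
    (step : ∀ t < M, ∀ σ, σ.nat a 0 0 = t → I t σ → I (t + 1) (c.den O N σ)) {σ : Mem}
    (h0 : I 0 σ) : I M ((Stm.forTo a b c).den O N σ) := by
  have htab : ∀ e : NEx, ∀ t σ, I t σ → I t ((Stm.tabN a e).den O N σ) := fun e t σ h =>
    hI t σ _ (fun x hx => Stm.den_nat hO _ _ _ _ (by simpa using hx)) rfl h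
  rw [Stm.forTo, Stm.den_seq, Stm.den]
  set s := (Stm.tabN a (.const 0)).den O N σ with hs
  have hs0 : s.nat a 0 0 = 0 := by rw [hs, Stm.den_tabN_apply hN hN]; rfl
  have key : ∀ k, ∃ t, (t = k ∨ M ≤ t) ∧ t ≤ M ∧ I t ((Stm.den O N (.ifte
      (.nlt (.row a (.const 0)) b) (.seq c (.tabN a (.add (.row a (.const 0)) (.const 1))))
      .skip))^[k] s) ∧ ((Stm.den O N (.ifte
      (.nlt (.row a (.const 0)) b) (.seq c (.tabN a (.add (.row a (.const 0)) (.const 1))))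
      .skip))^[k] s).nat a 0 0 = t := by
    intro k
    induction k with
    | zero => exact ⟨0, Or.inl rfl, Nat.zero_le _, htab _ _ _ h0, hs0⟩
    | succ k ih =>
      rw [Function.iterate_succ_apply']
      obtain ⟨t, h1, h2, h3, h4⟩ := ih
      set τ := ((Stm.den O N (.ifte
        (.nlt (.row a (.const 0)) b) (.seq c (.tabN a (.add (.row a (.const 0)) (.const 1))))
        .skip))^[k] s)
      rw [Stm.den]
      simp only [BEx.Holds, NEx.val_row, NEx.val, h4, hb t h2 τ h3]
      split_ifs with hlt
      · refine ⟨t + 1, by omega, hlt, htab _ _ _ (step t hlt τ h4 h3), ?_⟩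
        rw [Stm.den_seq, Stm.den_tabN_apply hN hN]
        simp [Stm.den_nat hO N a c τ hc, h4]
      · exact ⟨t, by omega, h2, h3, h4⟩
  obtain ⟨t, h1, h2, h3, -⟩ := key N
  obtain rfl : t = M := by omega
  exact h3

theorem firstIdx_congr {p q : ℕ → Prop} (h : ∀ i < N, (p i ↔ q i)) :
    firstIdx p N = firstIdx q N := by
  have key : ∀ {p q : ℕ → Prop}, (∀ i < N, (p i ↔ q i)) → firstIdx p N ≤ firstIdx q N := by
    intro p q h
    by_contra! hlt
    have hle := firstIdx_le p N
    exact not_of_lt_firstIdx hlt ((h _ (by omega)).2 (firstIdx_spec (by omega)))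
  exact le_antisymm (key h) (key fun i hi => (h i hi).symm)

end

end RAM

/-! ### Eliminating the vertices of a tree -/

namespace FairDivision

open RAM

section

variable {m : ℕ} {G : SimpleGraph (Fin m)}

/-- A neighbour of `v` nearer to `r` extends a shortest path from `r` to a path ending in `v`. In a
tree this path is unique, and the neighbour is its penultimate vertex. -/
theorem eq_of_adj_of_dist_lt (hG : G.IsTree) {r v x y : Fin m} (hx : G.Adj x v) (hy : G.Adj y v)
    (hxd : G.dist r x < G.dist r v) (hyd : G.dist r y < G.dist r v) : x = y := by
  have key : ∀ z, G.Adj z v → G.dist r z < G.dist r v →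
      ∃ p : G.Walk r v, p.IsPath ∧ p.penultimate = z := by
    intro z hz hd
    obtain ⟨p, hp⟩ := hG.connected.exists_walk_length_eq_dist r z
    have hpp := p.isPath_of_length_eq_dist hp
    refine ⟨p.concat hz, hpp.concat (fun hv => ?_) hz, p.penultimate_concat hz⟩
    have h1 := SimpleGraph.dist_le (p.takeUntil v hv)
    have h2 := p.length_takeUntil_le_length hv
    omega
  obtain ⟨p, hp, hpx⟩ := key x hx hxd
  obtain ⟨q, hq, hqy⟩ := key y hy hyd
  rw [← hpx, ← hqy, (hG.existsUnique_path r v).unique hp hq]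

/-- Every non-empty set of vertices of a tree contains a vertex with at most one neighbour in it. -/
theorem exists_leaf (hG : G.IsTree) {R : Finset (Fin m)} (hR : R.Nonempty) :
    ∃ v ∈ R, ∀ x ∈ R, ∀ y ∈ R, G.Adj v x → G.Adj v y → x = y := by
  obtain ⟨r, hr⟩ := hR
  -- Take a vertex of `R` farthest from `r`. Adjacent vertices of a tree have different distances
  -- from `r`, so its neighbours in `R` are strictly nearer.
  obtain ⟨v, hv, hmax⟩ := Finset.exists_max_image R (fun v => G.dist r v) ⟨r, hr⟩
  have hlt : ∀ z ∈ R, G.Adj v z → G.dist r z < G.dist r v := by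
    intro z hz hadj
    have := hmax z hz
    have := hG.dist_eq_dist_add_one_of_adj r hadj
    omega
  exact ⟨v, hv, fun x hx y hy hvx hvy =>
    eq_of_adj_of_dist_lt hG hvx.symm hvy.symm (hlt x hx hvx) (hlt y hy hvy)⟩

/-- The first `t` vertices of an elimination order with the neighbours that remain. -/
structure Elim (G : SimpleGraph (Fin m)) (ord par pos : ℕ → ℕ) (t : ℕ) : Prop where
  lt : ∀ s < t, ord s < m
  inj : ∀ s < t, ∀ s' < t, ord s = ord s' → s = s'
  par_eq : ∀ s < t, ∀ x y : Fin m, ord s = x → G.Adj x y → (∀ s' < s, ord s' ≠ y) →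
    par x = y
  -- A value not below `m`, such as the result of a failed search, means that no neighbour remained.
  par_adj : ∀ s < t, ∀ x : Fin m, ord s = x → par x < m →
    ∃ y : Fin m, par x = y ∧ G.Adj x y ∧ ∀ s' < s, ord s' ≠ y
  pos_eq : ∀ s < t, pos (ord s) = s

theorem Elim.exists_ord {ord par pos : ℕ → ℕ} (h : Elim G ord par pos m) {v : ℕ} (hv : v < m) :
    ∃ t < m, ord t = v := by
  have := Finset.surj_on_of_inj_on_of_card_le (s := Finset.range m) (t := Finset.range m)
    (fun t _ => ord t) (fun t ht => by simpa using h.lt t (by simpa using ht))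
    (fun s t hs ht e => h.inj s (by simpa using hs) t (by simpa using ht) e) le_rfl v (by simpa)
  obtain ⟨t, ht, h⟩ := this
  exact ⟨t, by simpa using ht, h.symm⟩

theorem Elim.par_cases {ord par pos : ℕ → ℕ} (h : Elim G ord par pos m) {t : ℕ} (ht : t < m)
    (hp : par (ord t) < m) : ∃ s, t < s ∧ s < m ∧ par (ord t) = ord s := by
  obtain ⟨y, h1, h2, h3⟩ := h.par_adj t ht ⟨ord t, h.lt t ht⟩ rfl hp
  obtain ⟨s, hs, hsy⟩ := h.exists_ord y.2
  refine ⟨s, ?_, hs, by rw [hsy]; exact h1⟩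
  rcases lt_trichotomy s t with h4 | rfl | h4
  · exact absurd hsy (h3 s h4)
  · have : (⟨ord s, h.lt s ht⟩ : Fin m) = y := Fin.ext hsy
    rw [this] at h2
    exact absurd h2 G.irrefl
  · exact h4

open Classical in
/-- The subgraph induced by `X` as a rooted tree. -/
noncomputable def Elim.rooted {ord par pos : ℕ → ℕ} (h : Elim G ord par pos m)
    (u : Finset (Fin m) → ℝ) (hu : ∀ X, 0 ≤ u X) (X : Finset (Fin m)) : Rooted where
  m := m
  ord := ord
  X := X.map Fin.valEmbedding
  -- Parents outside `X` are replaced by the sink, so an elimination order of the whole tree serves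
  -- for every `X`.
  P v := if par v ∈ X.map Fin.valEmbedding then par v else m
  w v := if h : v < m then u {⟨v, h⟩} else 0
  lt := h.lt
  inj := h.inj
  par t ht hX := by
    split_ifs with hp
    · obtain ⟨y, -, hy⟩ := Finset.mem_map.1 hp
      obtain ⟨s, h1, h2, h3⟩ := h.par_cases ht (by rw [← hy]; exact y.2)
      exact Or.inr ⟨s, h1, h2, h3, by rwa [← h3]⟩
    · exact Or.inl rfl
  X_lt v hv := by
    obtain ⟨y, -, rfl⟩ := Finset.mem_map.1 hv
    exact y.2
  w_nonneg v := by
    split_ifs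
    · exact hu _
    · exact le_rfl
  w_sink := by simp

theorem mem_map_val {X : Finset (Fin m)} {v : ℕ} :
    v ∈ X.map Fin.valEmbedding ↔ ∃ y ∈ X, (y : ℕ) = v := by simp [Finset.mem_map]

theorem Elim.describes {ord par pos : ℕ → ℕ} (h : Elim G ord par pos m)
    {u : Finset (Fin m) → ℝ} (hu : ∀ X, 0 ≤ u X) (X : Finset (Fin m)) :
    Describes G u X (h.rooted u hu X) := by
  have hmem : ∀ v : Fin m, (v : ℕ) ∈ X.map Fin.valEmbedding ↔ v ∈ X := fun v => by
    rw [mem_map_val]; simp [Fin.val_inj]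
  refine ⟨rfl, hmem, fun v hv z hz hadj => ?_, fun v hv z hvz => ?_, fun v _ => ?_⟩
  · obtain ⟨s, hs, hsv⟩ := h.exists_ord v.2
    obtain ⟨t, ht, htz⟩ := h.exists_ord z.2
    have key : ∀ s t : ℕ, s < t → t < m → ∀ v z : Fin m, ord s = v → ord t = z → z ∈ X →
        G.Adj v z → (h.rooted u hu X).P v = z := by
      intro s t hst ht v z hs htz hz hadj
      have := h.par_eq s (by omega) v z hs hadj fun s' hs' he => by
        have := h.inj s' (by omega) t ht (he.trans htz.symm)
        omega
      change (if _ then _ else _) = _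
      rw [this, if_pos ((hmem z).2 hz)]
    rcases lt_trichotomy s t with hst | rfl | hst
    · exact Or.inl (key s t hst ht v z hsv htz hz hadj)
    · have : v = z := Fin.ext (hsv.symm.trans htz)
      subst this
      exact absurd hadj G.irrefl
    · exact Or.inr (key t s hst hs z v htz hsv hv hadj.symm)
  · change (if _ then _ else _) = _ at hvz
    split_ifs at hvz with hp
    · obtain ⟨s, hs, hsv⟩ := h.exists_ord v.2
      obtain ⟨y, h1, h2, -⟩ := h.par_adj s hs v hsv (by rw [hvz]; exact z.2)
      have : y = z := Fin.ext (h1.symm.trans hvz)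
      exact this ▸ h2
    · exact absurd hvz z.2.ne'
  · change (if h : (v : ℕ) < m then u {⟨v, h⟩} else 0) = _
    rw [dif_pos v.2]

theorem Elim.pos {ord par pos : ℕ → ℕ} (h : Elim G ord par pos m) {u : Finset (Fin m) → ℝ}
    (hu : ∀ X, 0 ≤ u X) (X : Finset (Fin m)) {v : ℕ} (hv : v < m) :
    (h.rooted u hu X).pos v = pos v := by
  obtain ⟨t, ht, rfl⟩ := h.exists_ord hv
  rw [h.pos_eq t ht]
  exact Rooted.pos_ord (T := h.rooted u hu X) ht

end

/-- `e` is a vertex that is not yet eliminated. -/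
def remB (e : NEx) : BEx := .and (.nlt e nV) (.eq (.row 20 e) (.const 0))
def adjB (e f : NEx) : BEx := .eq (.cell 1 e f) (.const 1)

/-- `e` has at most one remaining neighbour. -/
def leafB (e : NEx) : BEx := .all 3 (.all 4 (.imp (remB (.var 3)) (.imp (remB (.var 4))
  (.imp (adjB e (.var 3)) (.imp (adjB e (.var 4)) (.eq (.var 3) (.var 4)))))))

/-- Eliminate a vertex with at most one remaining neighbour. -/
def elimStep : Stm Empty :=
  .seq (.tabN 16 (.first 2 (.and (remB (.var 2)) (leafB (.var 2)))))
  (.seq (.tabN 21 (.ite (.eq (.var 1) (.row 23 (.const 0))) (.row 16 (.const 0)) (.row 21 (.var 1))))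
  (.seq (.tabN 19 (.ite (.eq (.var 1) (.row 16 (.const 0))) (.row 23 (.const 0)) (.row 19 (.var 1))))
  (.seq (.tabN 22 (.ite (.eq (.var 1) (.row 16 (.const 0)))
    (.first 2 (.and (remB (.var 2)) (adjB (.var 1) (.var 2)))) (.row 22 (.var 1))))
  (.tabN 20 (.ite (.eq (.var 1) (.row 16 (.const 0))) (.const 1) (.row 20 (.var 1)))))))

@[simp] theorem natW_elimStep : elimStep.natW = [16, 21, 19, 22, 20] := rfl
@[simp] theorem realW_elimStep : elimStep.realW = [] := rfl

/-- Arrays: `16` the chosen vertex, `19` the positions, `20` the flags of eliminated vertices, `21`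
the order, `22` the parents in the whole tree, `23` the time. -/
def elimStm : Stm Empty := .seq (.tabN 20 (.const 0)) (.forTo 23 nV elimStep)

@[simp] theorem natW_elimStm : elimStm.natW = [20, 23, 16, 21, 19, 22, 20, 23] := rfl
@[simp] theorem realW_elimStm : elimStm.realW = [] := rfl

section

variable {m n N : ℕ} {G : SimpleGraph (Fin m)} {w : Fin m → ℝ}

/-- Oracles of programs without oracles. -/
abbrev noOracle : Empty → Mem → Mem := fun q => q.elim

theorem holds_remB {σ : Mem} {ε : ℕ → ℕ} {e : NEx} (h : HasInput G n w σ) :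
    (remB e).Holds N σ ε ↔ e.val N σ ε < m ∧ σ.nat 20 0 (e.val N σ ε) = 0 := by
  simp [remB, nV, h.m_eq]

theorem holds_adjB {σ : Mem} {ε : ℕ → ℕ} {e f : NEx} (h : HasInput G n w σ) :
    (adjB e f).Holds N σ ε ↔
      ∃ x y : Fin m, (x : ℕ) = e.val N σ ε ∧ (y : ℕ) = f.val N σ ε ∧ G.Adj x y := by
  simp only [adjB, BEx.holds_eq, NEx.val, h.adj_eq]

theorem elimStm_spec (hG : G.IsTree) (hN : m < N) {σ : Mem} (h : HasInput G n w σ) {σ' : Mem}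
    (hσ' : σ' = elimStm.den noOracle N σ) :
    Elim G (σ'.nat 21 0) (σ'.nat 22 0) (σ'.nat 19 0) m := by
  have hO := oracleFrame_elim
  let I : ℕ → Mem → Prop := fun t τ => HasInput G n w τ ∧
    (∀ v < m, τ.nat 20 0 v = 0 ↔ ∀ s < t, τ.nat 21 0 s ≠ v) ∧
    Elim G (τ.nat 21 0) (τ.nat 22 0) (τ.nat 19 0) t
  suffices I m σ' from this.2.2
  rw [hσ', elimStm, Stm.den_seq]
  refine Stm.forTo_spec hO (by simp) hN.le (by omega) I ?_ (fun t _ τ hI => ?_) ?_ ?_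
  · rintro t τ τ' h1 h2 ⟨h3, h4, h5⟩
    refine ⟨h3.congr (h1 0 (by decide)) (h1 1 (by decide)) (by rw [h2]), ?_, ?_⟩
    · rw [h1 20 (by decide), h1 21 (by decide)]; exact h4
    · rw [h1 21 (by decide), h1 22 (by decide), h1 19 (by decide)]; exact h5
  · simp [nV, hI.1.m_eq]
  · rintro t ht τ hc ⟨hin, hfl, hel⟩
    set p : ℕ → Prop := fun i => (.and (remB (.var 2)) (leafB (.var 2)) : BEx).Holds N τ
      (Function.update (ij 0 0) 2 i) with hp
    have hpi : ∀ i, p i ↔ (i < m ∧ τ.nat 20 0 i = 0) ∧ ∀ a < N, ∀ b < N,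
        (a < m ∧ τ.nat 20 0 a = 0) → (b < m ∧ τ.nat 20 0 b = 0) →
        (∃ x y : Fin m, (x : ℕ) = i ∧ (y : ℕ) = a ∧ G.Adj x y) →
        (∃ x y : Fin m, (x : ℕ) = i ∧ (y : ℕ) = b ∧ G.Adj x y) → a = b := by
      intro i
      simp [hp, leafB, holds_remB hin, holds_adjB hin]
    set c := firstIdx p N with hcdef
    have hcN : c < N := by
      -- Fewer than `m` vertices have been eliminated, so one remains, and `exists_leaf` makes the
      -- search succeed.
      obtain ⟨v0, hv0, hne0⟩ : ∃ v < m, ∀ s < t, τ.nat 21 0 s ≠ v := by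
        by_contra! hall
        choose! g hg1 hg2 using hall
        have := Finset.card_le_card_of_injOn (s := Finset.range m) (t := Finset.range t) g
          (fun v hv => by simpa using hg1 v (by simpa using hv))
          (fun v hv v' hv' e => by
            rw [← hg2 v (by simpa using hv), ← hg2 v' (by simpa using hv'), e])
        simp at this
        omega
      classical
      obtain ⟨v, hv, hleaf⟩ := exists_leaf hG
        (R := Finset.univ.filter fun v : Fin m => τ.nat 20 0 v = 0)
        ⟨⟨v0, hv0⟩, by simpa using (hfl v0 hv0).2 hne0⟩
      refine firstIdx_lt_iff.2 ⟨v, by omega, (hpi v).2 ⟨⟨v.2, by simpa using hv⟩, ?_⟩⟩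
      rintro a - b - ⟨ha1, ha2⟩ ⟨hb1, hb2⟩ ⟨x, y, hx, rfl, hxy⟩ ⟨x', z, hx', rfl, hxz⟩
      obtain rfl : x = v := Fin.ext hx
      obtain rfl : x' = x := Fin.ext hx'
      rw [hleaf y (by simpa using ha2) z (by simpa using hb2) hxy hxz]
    obtain ⟨⟨hcm, hc0⟩, hleaf⟩ := (hpi c).1 (firstIdx_spec hcN)
    have hcne := (hfl c hcm).1 hc0
    rw [elimStep]
    simp only [Stm.den_seq]
    set τ1 := Stm.den _ N _ τ with e1
    set τ2 := Stm.den _ N _ τ1 with e2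
    set τ3 := Stm.den _ N _ τ2 with e3
    set τ4 := Stm.den _ N _ τ3 with e4
    set τ5 := Stm.den _ N _ τ4 with e5
    have g1 : ∀ a, a ≠ 16 → τ1.nat a = τ.nat a := fun a ha =>
      Stm.den_nat hO _ _ _ _ (by simpa using ha)
    have g2 : ∀ a, a ≠ 21 → τ2.nat a = τ1.nat a := fun a ha =>
      Stm.den_nat hO _ _ _ _ (by simpa using ha)
    have g3 : ∀ a, a ≠ 19 → τ3.nat a = τ2.nat a := fun a ha =>
      Stm.den_nat hO _ _ _ _ (by simpa using ha)
    have g4 : ∀ a, a ≠ 22 → τ4.nat a = τ3.nat a := fun a ha =>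
      Stm.den_nat hO _ _ _ _ (by simpa using ha)
    have g5 : ∀ a, a ≠ 20 → τ5.nat a = τ4.nat a := fun a ha =>
      Stm.den_nat hO _ _ _ _ (by simpa using ha)
    have h16 : τ1.nat 16 0 0 = c := Stm.den_tabN_apply (by omega) (by omega)
    have h21 : ∀ s < N, τ5.nat 21 0 s = if s = t then c else τ.nat 21 0 s := by
      intro s hs
      rw [g5 _ (by decide), g4 _ (by decide), g3 _ (by decide), e2,
        Stm.den_tabN_apply (by omega) hs]
      simp [g1, h16, hc]
    have h19 : ∀ s < N, τ5.nat 19 0 s = if s = c then t else τ.nat 19 0 s := by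
      intro s hs
      rw [g5 _ (by decide), g4 _ (by decide), e3, Stm.den_tabN_apply (by omega) hs]
      simp [g1, g2, h16, hc]
    have hin3 : HasInput G n w τ3 := hin.congr (by simp [g1, g2, g3]) (by simp [g1, g2, g3]) rfl
    have h22 : ∀ s < N, τ5.nat 22 0 s = if s = c then firstIdx (fun i =>
        (i < m ∧ τ.nat 20 0 i = 0) ∧ ∃ x y : Fin m, (x : ℕ) = s ∧ (y : ℕ) = i ∧ G.Adj x y) N
        else τ.nat 22 0 s := by
      intro s hs
      rw [g5 _ (by decide), e4, Stm.den_tabN_apply (by omega) hs]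
      simp [g1, g2, g3, h16, holds_remB hin3, holds_adjB hin3]
    have h20 : ∀ s < N, τ5.nat 20 0 s = if s = c then 1 else τ.nat 20 0 s := by
      intro s hs
      rw [e5, Stm.den_tabN_apply (by omega) hs]
      simp [g1, g2, g3, g4, h16]
    have hold : ∀ s < t, τ5.nat 21 0 s = τ.nat 21 0 s := fun s hs => by
      rw [h21 s (by omega), if_neg hs.ne]
    have hnew : τ5.nat 21 0 t = c := by rw [h21 t (by omega), if_pos rfl]
    refine ⟨hin3.congr (by simp [g4, g5]) (by simp [g4, g5]) rfl, fun v hv => ?_,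
      ⟨fun s hs => ?_, fun s hs s' hs' he => ?_, fun s hs x y hx hxy hne => ?_,
        fun s hs x hx hp => ?_, fun s hs => ?_⟩⟩
    · rw [h20 v (by omega)]
      by_cases hvc : v = c
      · rw [if_pos hvc, hvc]
        simp only [one_ne_zero, false_iff, not_forall, not_not]
        exact ⟨t, Nat.lt_succ_self t, hnew⟩
      · rw [if_neg hvc, hfl v hv]
        constructor
        · intro h' s hs
          rcases Nat.lt_succ_iff_lt_or_eq.1 hs with hs | rfl
          · rw [hold s hs]; exact h' s hs
          · rw [hnew]; exact Ne.symm hvc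
        · intro h' s hs
          rw [← hold s hs]; exact h' s (by omega)
    · rcases Nat.lt_succ_iff_lt_or_eq.1 hs with hs | rfl
      · rw [hold s hs]; exact hel.lt s hs
      · rw [hnew]; exact hcm
    · rcases Nat.lt_succ_iff_lt_or_eq.1 hs with hs | rfl <;>
        rcases Nat.lt_succ_iff_lt_or_eq.1 hs' with hs' | rfl
      · rw [hold s hs, hold s' hs'] at he; exact hel.inj s hs s' hs' he
      · rw [hold s hs, hnew] at he; exact absurd he (hcne s hs)
      · rw [hold s' hs', hnew] at he; exact absurd he.symm (hcne s' hs')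
      · rfl
    · rcases Nat.lt_succ_iff_lt_or_eq.1 hs with hs | rfl
      · rw [hold s hs] at hx
        rw [h22 x (by omega), if_neg fun hxc => hcne s hs (hx.trans hxc)]
        exact hel.par_eq s hs x y hx hxy fun s' hs' => by rw [← hold s' (by omega)]; exact hne s' hs'
      · rw [hnew] at hx
        rw [h22 x (by omega), if_pos hx.symm]
        set q : ℕ → Prop := fun i =>
          (i < m ∧ τ.nat 20 0 i = 0) ∧ ∃ x' y : Fin m, (x' : ℕ) = x ∧ (y : ℕ) = i ∧ G.Adj x' y
        have hyq : y < m ∧ τ.nat 20 0 y = 0 := ⟨y.2, (hfl y y.2).2 fun s' hs' => by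
          rw [← hold s' hs']; exact hne s' hs'⟩
        have hqN : firstIdx q N < N :=
          firstIdx_lt_iff.2 ⟨y, by omega, hyq, x, y, rfl, rfl, hxy⟩
        obtain ⟨hq1, hq2⟩ := firstIdx_spec hqN
        exact hleaf _ hqN y (by omega) hq1 hyq (by rw [hx]; exact hq2)
          ⟨x, y, hx.symm, rfl, hxy⟩
    · rcases Nat.lt_succ_iff_lt_or_eq.1 hs with hs | rfl
      · rw [hold s hs] at hx
        rw [h22 x (by omega), if_neg fun hxc => hcne s hs (hx.trans hxc)] at hp ⊢
        obtain ⟨y, h1, h2, h3⟩ := hel.par_adj s hs x hx hp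
        exact ⟨y, h1, h2, fun s' hs' => by rw [hold s' (by omega)]; exact h3 s' hs'⟩
      · rw [hnew] at hx
        rw [h22 x (by omega), if_pos hx.symm] at hp ⊢
        obtain ⟨⟨-, hq1⟩, x', y, hx', hy, hxy⟩ := firstIdx_spec (hp.trans hN)
        obtain rfl : x' = x := Fin.ext hx'
        refine ⟨y, hy.symm, hxy, fun s' hs' => ?_⟩
        rw [hold s' hs']
        rw [← hy] at hq1
        exact (hfl y y.2).1 hq1 s' hs'
    · rcases Nat.lt_succ_iff_lt_or_eq.1 hs with hs | rfl
      · rw [hold s hs, h19 _ (by have := hel.lt s hs; omega), if_neg (hcne s hs)]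
        exact hel.pos_eq s hs
      · rw [hnew, h19 _ (by omega), if_pos rfl]
  · refine ⟨h.congr (Stm.den_nat hO _ _ _ _ (by simp)) (Stm.den_nat hO _ _ _ _ (by simp)) rfl,
      fun v hv => ?_, ⟨?_, ?_, ?_, ?_, ?_⟩⟩
    · rw [Stm.den_tabN_apply (by omega) (by omega)]; simp
    all_goals intro s hs; omega

end

end FairDivision

/-! ### The dynamic program as a program -/

namespace FairDivision

open RAM

/-- The vertex of the current step. -/
def curE : NEx := .row 21 (.row 30 (.const 0))
-- Arrays of the dynamic program: `15` the vertex set, `17` the parents inside it, `18` the allowed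
-- cuts, `24` the table in two halves (natural and real), real `25` the threshold, `27` the splits,
-- `28` the child's entries after `clo`, `30` the time.
def parE : NEx := .row 17 curE
def closeB : BEx := .and (.eq (.row 18 curE) (.const 1))
  (.rlt (.row 25 (.const 0)) (.cell 24 curE (.var 1)))
def prevE : NEx := .sub (.var 1) (.const 1)
-- The first condition in `clo`: closing at the cost of one unit of the bound.
def loseB : BEx := .and (.eq (.row 18 curE) (.const 1)) (.and (.nlt (.const 0) (.var 1))
  (.and (.not (.rlt (.cell 24 curE prevE) (.row 25 (.const 0))))
    (.nlt (.ite closeB (.add (.cell 24 curE (.var 1)) (.const 1)) (.cell 24 curE (.var 1)))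
      (.add (.cell 24 curE prevE) (.const 1)))))
def sumN (e : NEx) : NEx := .add (.cell 24 parE e) (.row 28 (.sub (.var 1) e))
def sumR (e : NEx) : REx := .add (.cell 24 parE e) (.row 28 (.sub (.var 1) e))
def lexB (e f : NEx) : BEx := .or (.nlt (sumN e) (sumN f))
  (.and (.eq (sumN e) (sumN f)) (.not (.rlt (sumR f) (sumR e))))
def splitB : BEx := .and (.not (.nlt (.var 1) (.var 2)))
  (.all 3 (.imp (.not (.nlt (.var 1) (.var 3))) (lexB (.var 3) (.var 2))))

def closeStm : Stm Empty := .seq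
  (.tabN 28 (.ite loseB (.add (.cell 24 curE prevE) (.const 1))
    (.ite closeB (.add (.cell 24 curE (.var 1)) (.const 1)) (.cell 24 curE (.var 1)))))
  (.tabR 28 (.ite loseB .zero (.ite closeB .zero (.cell 24 curE (.var 1)))))

/-- The splits are stored before either half of the table `24` changes, because `lexB` compares both
halves. -/
def mergeStm : Stm Empty := .seq (.tabN 27 (.first 2 splitB)) (.seq
  (.tabR 24 (.ite (.eq (.var 0) parE) (sumR (.row 27 (.var 1))) (.cell 24 (.var 0) (.var 1))))
  (.tabN 24 (.ite (.eq (.var 0) parE) (sumN (.row 27 (.var 1))) (.cell 24 (.var 0) (.var 1)))))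

def dpStep : Stm Empty := .ifte (.eq (.row 15 curE) (.const 1)) (.seq closeStm mergeStm) .skip

/-- Compute the table of the dynamic program in the arrays `24`. -/
def dpStm : Stm Empty := .seq (.tabN 24 (.const 0)) (.seq (.tabR 24 (.row 0 (.var 0)))
  (.forTo 30 nV dpStep))

@[simp] theorem natW_closeStm : closeStm.natW = [28] := rfl
@[simp] theorem realW_closeStm : closeStm.realW = [28] := rfl
@[simp] theorem natW_mergeStm : mergeStm.natW = [27, 24] := rfl
@[simp] theorem realW_mergeStm : mergeStm.realW = [24] := rfl
@[simp] theorem natW_dpStep : dpStep.natW = [28, 27, 24] := rfl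
@[simp] theorem realW_dpStep : dpStep.realW = [28, 24] := rfl
@[simp] theorem natW_dpStm : dpStm.natW = [24, 30, 28, 27, 24, 30] := rfl
@[simp] theorem realW_dpStm : dpStm.realW = [24, 28, 24] := rfl

/-- The memory describes the rooted tree `T`. -/
structure HasTree {m : ℕ} (N : ℕ) (G : SimpleGraph (Fin m)) (n : ℕ) (w : Fin m → ℝ) (T : Rooted)
    (σ : Mem) : Prop where
  input : HasInput G n w σ
  size : T.m = m
  ord : ∀ t < m, σ.nat 21 0 t = T.ord t
  par : ∀ v ∈ T.X, σ.nat 17 0 v = T.P v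
  mem : ∀ v < N, σ.nat 15 0 v = 1 ↔ v ∈ T.X
  weight : ∀ v < N, σ.real 0 0 v = T.w v

/-- The set of allowed cuts and the threshold. -/
structure HasCuts (N : ℕ) (L : Finset ℕ) (μ : ℝ) (σ : Mem) : Prop where
  mem : ∀ v < N, σ.nat 18 0 v = 1 ↔ v ∈ L
  threshold : σ.real 25 0 0 = μ

theorem HasTree.congr {m N n : ℕ} {G : SimpleGraph (Fin m)} {w : Fin m → ℝ} {T : Rooted}
    {σ σ' : Mem} (h : HasTree N G n w T σ)
    (h1 : ∀ a ∈ [0, 1, 15, 17, 21], σ'.nat a = σ.nat a) (h2 : σ'.real 0 = σ.real 0) :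
    HasTree N G n w T σ' where
  input := h.input.congr (h1 0 (by simp)) (h1 1 (by simp)) h2
  size := h.size
  ord t ht := by rw [h1 21 (by simp)]; exact h.ord t ht
  par v hv := by rw [h1 17 (by simp)]; exact h.par v hv
  mem v hv := by rw [h1 15 (by simp)]; exact h.mem v hv
  weight v hv := by rw [h2]; exact h.weight v hv

theorem HasCuts.congr {N : ℕ} {L : Finset ℕ} {μ : ℝ} {σ σ' : Mem} (h : HasCuts N L μ σ)
    (h1 : σ'.nat 18 = σ.nat 18) (h2 : σ'.real 25 = σ.real 25) : HasCuts N L μ σ' :=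
  ⟨fun v hv => by rw [h1]; exact h.mem v hv, by rw [h2]; exact h.threshold⟩

/-- The table stored in the memory. -/
def table (σ : Mem) (v l : ℕ) : ℕ × ℝ := (σ.nat 24 v l, σ.real 24 v l)

section

variable {m n N : ℕ} {G : SimpleGraph (Fin m)} {w : Fin m → ℝ} {T : Rooted} {L : Finset ℕ} {μ : ℝ}

open Classical in
theorem closeStm_spec {σ : Mem} (hN : 0 < N) {v : ℕ} (hv : ∀ ε, curE.val N σ ε = v)
    (hvN : v < N) (hL : HasCuts N L μ σ) {al : Prop}
    (hal : v ∈ L ↔ al) {x : ℕ → ℕ × ℝ} (hx : ∀ l < N, table σ v l = x l) {σ' : Mem}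
    (hσ' : σ' = closeStm.den noOracle N σ) {l : ℕ} (hl : l < N) :
    (σ'.nat 28 0 l, σ'.real 28 0 l) = clo al μ x l := by
  have hO := oracleFrame_elim
  rw [closeStm, Stm.den_seq] at hσ'
  set σ1 := Stm.den _ N _ σ with e1
  have hx1 : ∀ l < N, σ.nat 24 v l = (x l).1 := fun l hl => by rw [← hx l hl]; rfl
  have hx2 : ∀ l < N, σ.real 24 v l = (x l).2 := fun l hl => by rw [← hx l hl]; rfl
  -- The conditions are evaluated twice, before and after the natural half of array `28` is written;
  -- they do not read that array.
  have key : ∀ τ : Mem, (∀ ε, curE.val N τ ε = v) → HasCuts N L μ τ → τ.nat 24 = σ.nat 24 →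
      τ.real 24 = σ.real 24 →
      (closeB.Holds N τ (ij 0 l) ↔ al ∧ μ < (x l).2) ∧
      (loseB.Holds N τ (ij 0 l) ↔ al ∧ 0 < l ∧ μ ≤ (x (l - 1)).2 ∧
        (if al ∧ μ < (x l).2 then (x l).1 + 1 else (x l).1) < (x (l - 1)).1 + 1) := by
    intro τ hcur hcuts h24 h24'
    have hc : closeB.Holds N τ (ij 0 l) ↔ al ∧ μ < (x l).2 := by
      simp only [closeB, BEx.Holds, BEx.holds_eq, NEx.val_row, NEx.val, REx.val_row, REx.val, hcur,
        ij_one, h24', hx2 l hl, (hcuts.mem v hvN).trans hal, hcuts.threshold]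
    refine ⟨hc, ?_⟩
    simp only [loseB, BEx.Holds, BEx.holds_eq, NEx.val_row, NEx.val, REx.val_row, REx.val, hcur,
        ij_one, h24, h24', hc, prevE, hx1 l hl, hx1 (l - 1) (by omega), hx2 (l - 1) (by omega),
        (hcuts.mem v hvN).trans hal, hcuts.threshold, not_lt]
  obtain ⟨k1, k2⟩ := key σ hv hL rfl rfl
  have h1n : ∀ a, a ≠ 28 → σ1.nat a = σ.nat a := fun a ha =>
    Stm.den_nat hO _ _ _ _ (by simpa using ha)
  have hv1 : ∀ ε, curE.val N σ1 ε = v := fun ε => by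
    rw [← hv ε]; simp [curE, h1n]
  obtain ⟨k3, k4⟩ := key σ1 hv1 (hL.congr (h1n _ (by decide)) rfl) (h1n _ (by decide)) rfl
  have hn : σ'.nat 28 0 l = (if al ∧ 0 < l ∧ μ ≤ (x (l - 1)).2 ∧
        (if al ∧ μ < (x l).2 then (x l).1 + 1 else (x l).1) < (x (l - 1)).1 + 1 then
        (x (l - 1)).1 + 1 else if al ∧ μ < (x l).2 then (x l).1 + 1 else (x l).1) := by
    rw [hσ', Stm.den_nat hO _ _ _ _ (by simp), e1, Stm.den_tabN_apply hN hl]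
    simp only [NEx.val, k1, k2, hv, ij_one, prevE, hx1 l hl, hx1 (l - 1) (by omega)]
  have hr : σ'.real 28 0 l = (if al ∧ 0 < l ∧ μ ≤ (x (l - 1)).2 ∧
        (if al ∧ μ < (x l).2 then (x l).1 + 1 else (x l).1) < (x (l - 1)).1 + 1 then
        0 else if al ∧ μ < (x l).2 then 0 else (x l).2) := by
    rw [hσ', Stm.den_tabR_apply hN hl]
    have : σ1.real = σ.real := rfl
    simp only [REx.val, NEx.val, k3, k4, hv1, ij_one, this, hx2 l hl]
  rw [hn, hr, clo]
  by_cases c2 : al ∧ 0 < l ∧ μ ≤ (x (l - 1)).2 ∧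
        (if al ∧ μ < (x l).2 then (x l).1 + 1 else (x l).1) < (x (l - 1)).1 + 1
  · rw [if_pos c2, if_pos c2, if_pos c2]
  · rw [if_neg c2, if_neg c2, if_neg c2]
    by_cases c1 : al ∧ μ < (x l).2
    · rw [if_pos c1, if_pos c1, if_pos c1]
    · rw [if_neg c1, if_neg c1, if_neg c1]

theorem mergeStm_spec {σ : Mem} (hN : 0 < N) {p : ℕ} (hp : ∀ ε, parE.val N σ ε = p)
    {x y : ℕ → ℕ × ℝ} (hx : ∀ l < N, table σ p l = x l)
    (hy : ∀ l < N, (σ.nat 28 0 l, σ.real 28 0 l) = y l) {σ' : Mem}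
    (hσ' : σ' = mergeStm.den noOracle N σ) {v l : ℕ} (hv : v < N) (hl : l < N) :
    table σ' v l = if v = p then mergeAt N x y l else table σ v l := by
  have hO := oracleFrame_elim
  rw [mergeStm, Stm.den_seq, Stm.den_seq] at hσ'
  set σ1 := Stm.den _ N _ σ with e1
  set σ2 := Stm.den _ N _ σ1 with e2
  have hx1 : ∀ l < N, σ.nat 24 p l = (x l).1 := fun l hl => by rw [← hx l hl]; rfl
  have hx2 : ∀ l < N, σ.real 24 p l = (x l).2 := fun l hl => by rw [← hx l hl]; rfl
  have hy1 : ∀ l < N, σ.nat 28 0 l = (y l).1 := fun l hl => by rw [← hy l hl]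
  have hy2 : ∀ l < N, σ.real 28 0 l = (y l).2 := fun l hl => by rw [← hy l hl]
  have h1n : ∀ a, a ≠ 27 → σ1.nat a = σ.nat a := fun a ha =>
    Stm.den_nat hO _ _ _ _ (by simpa using ha)
  have hp1 : ∀ ε, parE.val N σ1 ε = p := fun ε => by
    rw [← hp ε]; simp [parE, curE, h1n]
  have hp2 : ∀ ε, parE.val N σ2 ε = p := fun ε => by
    rw [← hp1 ε]; simp [parE, curE, show σ2.nat = σ1.nat from rfl]
  have hs : σ1.nat 27 0 l = splitAt N x y l := by
    rw [e1, Stm.den_tabN_apply hN hl, NEx.val, splitAt]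
    refine firstIdx_congr fun a ha => ?_
    have hvar : ∀ b, Function.update (Function.update (ij 0 l) 2 a) 3 b 1 = l ∧
        Function.update (Function.update (ij 0 l) 2 a) 3 b 2 = a ∧
        Function.update (Function.update (ij 0 l) 2 a) 3 b 3 = b := fun b => by simp
    have hvar' : Function.update (ij 0 l) 2 a 1 = l ∧ Function.update (ij 0 l) 2 a 2 = a := by simp
    simp only [splitB, BEx.Holds, NEx.val, hvar'.1, hvar'.2, BEx.holds_all, BEx.holds_imp, lexB,
      BEx.holds_or, BEx.holds_eq, sumN, sumR, NEx.val_row, REx.val, REx.val_row, hp, (hvar _).1,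
      (hvar _).2.1, (hvar _).2.2, not_lt]
    refine and_congr_right fun hal => forall₂_congr fun b hb => imp_congr_right fun hbl => ?_
    rw [hx1 a ha, hx2 a ha, hx1 b hb, hx2 b hb, hy1 _ (by omega), hy2 _ (by omega),
      hy1 _ (by omega), hy2 _ (by omega)]
    rfl
  have hsl := (splitAt_spec hl x y).1
  have hr : σ'.real 24 v l = if v = p then (mergeAt N x y l).2 else σ.real 24 v l := by
    rw [hσ', Stm.den_real hO _ _ _ _ (by simp), e2, Stm.den_tabR_apply hv hl]
    have : σ1.real = σ.real := rfl
    simp only [REx.val, BEx.holds_eq, NEx.val, ij_zero, ij_one, hp1, sumR, NEx.val_row,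
      REx.val_row, hs, this]
    rw [hx2 _ (by omega), hy2 _ (by omega)]
    rfl
  have hn : σ'.nat 24 v l = if v = p then (mergeAt N x y l).1 else σ.nat 24 v l := by
    have : σ2.nat = σ1.nat := rfl
    rw [hσ', Stm.den_tabN_apply hv hl]
    simp only [BEx.holds_eq, NEx.val, ij_zero, ij_one, hp2, sumN, NEx.val_row, this, hs,
      h1n 24 (by decide), h1n 28 (by decide)]
    rw [hx1 _ (by omega), hy1 _ (by omega)]
    rfl
  rw [table, hn, hr]
  split_ifs <;> rfl

theorem dpStm_spec (hN : m < N) {σ : Mem} (h : HasTree N G n w T σ) (hL : HasCuts N L μ σ)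
    {σ' : Mem} (hσ' : σ' = dpStm.den noOracle N σ) {v l : ℕ} (hv : v ≤ m) (hl : l < N) :
    table σ' v l = T.dp N L μ m v l := by
  have hO := oracleFrame_elim
  let I : ℕ → Mem → Prop := fun t τ => HasTree N G n w T τ ∧ HasCuts N L μ τ ∧
    ∀ v ≤ m, ∀ l < N, table τ v l = T.dp N L μ t v l
  suffices I m σ' from this.2.2 v hv l hl
  rw [hσ', dpStm, Stm.den_seq, Stm.den_seq]
  refine Stm.forTo_spec hO (by simp) hN.le (by omega) I ?_ (fun t _ τ hI => ?_) ?_ ?_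
  · rintro t τ τ' h1 h2 ⟨h3, h4, h5⟩
    refine ⟨h3.congr (fun a ha => h1 a ?_) (by rw [h2]), h4.congr (h1 _ (by decide)) (by rw [h2]),
      fun v hv l hl => ?_⟩
    · rintro rfl; simp at ha
    · rw [← h5 v hv l hl, table, table, h1 24 (by decide), h2]
  · simp [nV, hI.1.input.m_eq]
  · rintro t ht τ hc ⟨hT, hcut, htab⟩
    have hO' := Stm.den_nat hO N (c := dpStep) (σ := τ)
    refine ⟨hT.congr (fun a ha => hO' a ?_) (Stm.den_real hO _ _ _ _ (by simp)),
      hcut.congr (hO' _ (by simp)) (Stm.den_real hO _ _ _ _ (by simp)), fun v hv l hl => ?_⟩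
    · simp only [List.mem_cons, List.not_mem_nil, or_false] at ha
      simp only [natW_dpStep, List.mem_cons, List.not_mem_nil, or_false]
      omega
    have hcur : ∀ s : Mem, s.nat 30 = τ.nat 30 → s.nat 21 = τ.nat 21 →
        ∀ ε, curE.val N s ε = T.ord t := fun s h1 h2 ε => by
      simp [curE, h1, h2, hc, hT.ord t ht]
    have hlt : T.ord t < m := (T.lt t (by rw [hT.size]; exact ht)).trans_eq hT.size
    rw [dpStep, Stm.den]
    simp only [BEx.holds_eq, NEx.val_row, hcur τ rfl rfl, NEx.val, hT.mem _ (hlt.trans hN)]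
    by_cases hX : T.ord t ∈ T.X
    swap
    · rw [if_neg hX, Rooted.dp_succ_of_notMem hX]; exact htab v hv l hl
    rw [if_pos hX, Stm.den_seq]
    set τ1 := closeStm.den noOracle N τ with e1
    have h1n : ∀ a, a ≠ 28 → τ1.nat a = τ.nat a := fun a ha =>
      Stm.den_nat hO _ _ _ _ (by simpa using ha)
    have hpm : T.P (T.ord t) ≤ m := by
      by_cases hP : T.P (T.ord t) = T.m
      · rw [hP, hT.size]
      · exact ((T.X_lt _ (Rooted.pos_lt_par hX hP).1).trans_eq hT.size).le
    have h24 : ∀ v l, table τ1 v l = table τ v l := fun v l => by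
      rw [table, table, h1n 24 (by decide), e1, Stm.den_real hO _ _ _ _ (by simp)]
    rw [mergeStm_spec (σ := τ1) (by omega) (p := T.P (T.ord t)) ?_
      (x := T.dp N L μ t (T.P (T.ord t))) (y := clo (T.ord t ∈ L) μ (T.dp N L μ t (T.ord t)))
      (fun l hl => ?_) (fun l hl => ?_) rfl (by omega) hl]
    · split_ifs with hvp
      · rw [hvp, Rooted.dp_succ_par hX]
      · rw [h24, htab v hv l hl, Rooted.dp_succ_ne fun _ => hvp]
    · intro ε
      simp [parE, hcur τ1 (h1n _ (by decide)) (h1n _ (by decide)), h1n, hT.par _ hX]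
    · rw [h24, htab _ hpm l hl]
    · exact closeStm_spec (by omega) (hcur τ rfl rfl) (hlt.trans hN) hcut Iff.rfl
        (fun l hl => htab _ hlt.le l hl) e1 hl
  · have hn : ∀ a, a ≠ 24 → ((Stm.tabR 24 (.row 0 (.var 0))).den noOracle N
        ((Stm.tabN 24 (.const 0)).den noOracle N σ)).nat a = σ.nat a := fun a ha => by
      rw [Stm.den_nat hO _ _ _ _ (by simp), Stm.den_nat hO _ _ _ _ (by simpa using ha)]
    have hr : ∀ a, a ≠ 24 → ((Stm.tabR 24 (.row 0 (.var 0))).den noOracle N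
        ((Stm.tabN 24 (.const 0)).den noOracle N σ)).real a = σ.real a := fun a ha => by
      rw [Stm.den_real hO _ _ _ _ (by simpa using ha), Stm.den_real hO _ _ _ _ (by simp)]
    refine ⟨h.congr (fun a ha => hn a ?_) (hr 0 (by decide)), hL.congr (hn _ (by decide))
      (hr _ (by decide)), fun v hv l hl => ?_⟩
    · rintro rfl; simp at ha
    · rw [table, Stm.den_tabR_apply (by omega) hl, Stm.den_nat hO _ _ _ _ (by simp),
        Stm.den_tabN_apply (by omega) hl]
      simp only [REx.val_row, NEx.val, ij_zero]
      rw [Stm.den_real hO _ _ _ _ (by simp), h.weight v (by omega)]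
      rfl

end

end FairDivision

/-! ### The subroutine for trees -/

namespace FairDivision

open RAM

/-- The number of agents of the query. -/
def kE : NEx := .row 4 (.const 0)

/-- Eliminate the vertices and restrict the tree to the query set. -/
def setupStm : Stm Empty := .seq (.tabN 15 (.row 3 (.var 1))) (.seq elimStm (.seq
  (.tabN 17 (.ite (.and (.nlt (.row 22 (.var 1)) nV) (.eq (.row 15 (.row 22 (.var 1))) (.const 1)))
    (.row 22 (.var 1)) nV))
  (.seq (.tabN 18 (.row 15 (.var 1))) (.tabR 25 .zero))))

/-- A part of weight more than the threshold is closed at `e`. -/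
def heavyB (e : NEx) : BEx := .and (.eq (.row 15 e) (.const 1))
  (.rlt (.row 25 (.const 0)) (.cell 24 e (.const 0)))
def nextB : BEx := .and (heavyB (.var 2)) (.all 3 (.imp (heavyB (.var 3))
  (.not (.rlt (.cell 24 (.var 3) (.const 0)) (.cell 24 (.var 2) (.const 0))))))

/-- Raise the threshold to the weight of the lightest part. -/
def raiseStm : Stm Empty := .seq dpStm (.ifte (.not (.nlt (.cell 24 nV (.const 0)) kE))
  -- The sink's entry at bound `0` counts parts strictly heavier than the threshold; while there are
  -- enough of them, the threshold is too low.
  (.tabR 25 (.cell 24 (.first 2 nextB) (.const 0))) .skip)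

/-- Compute the bound on the number of light parts and the number of cuts. -/
def budgetStm : Stm Empty := .seq dpStm (.seq
  (.tabN 32 (.first 2 (.imp (.rlt .zero (.row 25 (.const 0))) (.not (.nlt (.cell 24 nV (.var 2)) kE)))))
  (.tabN 33 (.ite (.nlt kE (.cell 24 nV (.row 32 (.const 0)))) kE
    (.cell 24 nV (.row 32 (.const 0))))))

/-- Try to forbid a cut at the current vertex. -/
def forbidStm : Stm Empty := .seq (.tabN 34 (.row 18 (.row 31 (.const 0)))) (.seq
  (.tabN 18 (.ite (.eq (.var 1) (.row 31 (.const 0))) (.const 0) (.row 18 (.var 1)))) (.seq dpStm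
  (.ifte (.nlt (.cell 24 nV (.row 32 (.const 0))) (.row 33 (.const 0)))
    -- Too few parts without this cut: restore its flag.
    (.tabN 18 (.ite (.eq (.var 1) (.row 31 (.const 0))) (.row 34 (.const 0)) (.row 18 (.var 1))))
    .skip)))

/-- One parallel pass: cuts compute their rank, and other vertices copy the label of their parent.
Repetition lets the labels travel from the root downwards. -/
def labelStm : Stm Empty := .tabN 5 (.ite (.eq (.row 18 (.var 1)) (.const 1))
  (.sum 2 (BEx.toNat (.and (.eq (.row 18 (.var 2)) (.const 1))
    (.nlt (.row 19 (.var 1)) (.row 19 (.var 2))))))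
  (.ite (.eq (.row 17 (.var 1)) nV) (.const 0) (.row 5 (.row 17 (.var 1)))))

def weightStm : Stm Empty := .tabR 10 (.sum 2 (.ite (.and (.eq (.row 15 (.var 2)) (.const 1))
  (.eq (.row 5 (.var 2)) (.var 1))) (.row 0 (.var 2)) .zero))

/-- Find an SMMS allocation of a subtree. -/
def treeStm : Stm Empty := .seq setupStm (.seq (.rep (.rep raiseStm)) (.seq budgetStm
  (.seq (.forTo 31 nV forbidStm) (.seq (.rep labelStm) weightStm))))

@[simp] theorem natW_setupStm :
    setupStm.natW = [15, 20, 23, 16, 21, 19, 22, 20, 23, 17, 18] := rfl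
@[simp] theorem realW_setupStm : setupStm.realW = [25] := rfl
@[simp] theorem natW_raiseStm : raiseStm.natW = [24, 30, 28, 27, 24, 30] := rfl
@[simp] theorem realW_raiseStm : raiseStm.realW = [24, 28, 24, 25] := rfl
@[simp] theorem natW_budgetStm : budgetStm.natW = [24, 30, 28, 27, 24, 30, 32, 33] := rfl
@[simp] theorem realW_budgetStm : budgetStm.realW = [24, 28, 24] := rfl
@[simp] theorem natW_forbidStm :
    forbidStm.natW = [34, 18, 24, 30, 28, 27, 24, 30, 18] := rfl
@[simp] theorem realW_forbidStm : forbidStm.realW = [24, 28, 24] := rfl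
@[simp] theorem natW_labelStm : labelStm.natW = [5] := rfl
@[simp] theorem realW_labelStm : labelStm.realW = [] := rfl
@[simp] theorem natW_weightStm : weightStm.natW = [] := rfl
@[simp] theorem realW_weightStm : weightStm.realW = [10] := rfl

section

variable {m n N k : ℕ} {G : SimpleGraph (Fin m)} {w : Fin m → ℝ} {T : Rooted} {L : Finset ℕ} {μ : ℝ}

theorem HasTree.den (h : HasTree N G n w T σ) {c : Stm Empty}
    (h1 : ∀ a ∈ [0, 1, 15, 17, 21], a ∉ c.natW) (h2 : 0 ∉ c.realW) :
    HasTree N G n w T (c.den noOracle N σ) :=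
  h.congr (fun a ha => Stm.den_nat oracleFrame_elim _ _ _ _ (h1 a ha))
    (Stm.den_real oracleFrame_elim _ _ _ _ h2)

theorem HasCuts.den (h : HasCuts N L μ σ) {c : Stm Empty} (h1 : 18 ∉ c.natW) (h2 : 25 ∉ c.realW) :
    HasCuts N L μ (c.den noOracle N σ) :=
  h.congr (Stm.den_nat oracleFrame_elim _ _ _ _ h1) (Stm.den_real oracleFrame_elim _ _ _ _ h2)

theorem setupStm_spec (hG : G.IsTree) (hN : m < N) {u : Finset (Fin m) → ℝ} (hu : ∀ X, 0 ≤ u X)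
    {X : Finset (Fin m)} {σ : Mem} (h : HasInput G n (fun v => u {v}) σ)
    (hX : Ind N (σ.nat 3 0) X) {σ' : Mem} (hσ' : σ' = setupStm.den noOracle N σ) :
    ∃ T, Describes G u X T ∧ HasTree N G n (fun v => u {v}) T σ' ∧ HasCuts N T.X 0 σ' ∧
      ∀ v < m, σ'.nat 19 0 v = T.pos v := by
  have hO := oracleFrame_elim
  rw [setupStm, Stm.den_seq, Stm.den_seq, Stm.den_seq, Stm.den_seq] at hσ'
  set σ1 := Stm.den _ N _ σ with e1
  set σ2 := Stm.den _ N _ σ1 with e2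
  set σ3 := Stm.den _ N _ σ2 with e3
  set σ4 := Stm.den _ N _ σ3 with e4
  have hin1 : HasInput G n (fun v => u {v}) σ1 := h.congr (Stm.den_nat hO _ _ _ _ (by simp))
    (Stm.den_nat hO _ _ _ _ (by simp)) rfl
  have hin2 : HasInput G n (fun v => u {v}) σ2 := hin1.congr (Stm.den_nat hO _ _ _ _ (by simp))
    (Stm.den_nat hO _ _ _ _ (by simp)) (Stm.den_real hO _ _ _ _ (by simp))
  have hel := elimStm_spec hG hN hin1 e2
  have h3 : ∀ a, a ≠ 17 → σ3.nat a = σ2.nat a := fun a ha =>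
    Stm.den_nat hO _ _ _ _ (by simpa using ha)
  have h4 : ∀ a, a ≠ 18 → σ4.nat a = σ3.nat a := fun a ha =>
    Stm.den_nat hO _ _ _ _ (by simpa using ha)
  have h5 : σ'.nat = σ4.nat := by rw [hσ']; rfl
  have h15 : ∀ v < N, σ2.nat 15 0 v = 1 ↔ v ∈ X.map Fin.valEmbedding := by
    intro v hv
    rw [e2, Stm.den_nat hO _ _ _ _ (by simp), e1, Stm.den_tabN_apply (by omega) hv, mem_map_val]
    simp only [NEx.val_row, NEx.val, ij_one, hX v hv]
    split_ifs with h' <;> simp [h']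
  have hsmall : ∀ v ∈ X.map Fin.valEmbedding, v < m := by
    intro v hv
    obtain ⟨y, -, rfl⟩ := mem_map_val.1 hv
    exact y.2
  refine ⟨hel.rooted u hu X, hel.describes hu X, ⟨?_, rfl, fun t ht => ?_, fun v hv => ?_,
    fun v hv => ?_, fun v hv => ?_⟩, ⟨fun v hv => ?_, ?_⟩, fun v hv => ?_⟩
  · refine hin2.congr ?_ ?_ ?_
    · rw [h5, h4 _ (by decide), h3 _ (by decide)]
    · rw [h5, h4 _ (by decide), h3 _ (by decide)]
    · rw [hσ']; exact Stm.den_real hO _ _ _ _ (by simp)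
  · rw [h5, h4 _ (by decide), h3 _ (by decide)]
    rfl
  · rw [h5, h4 _ (by decide), e3, Stm.den_tabN_apply (by omega) ((hsmall v hv).trans hN)]
    simp only [NEx.val, BEx.Holds, BEx.holds_eq, NEx.val_row, nV, hin2.m_eq, ij_one]
    change _ = if _ then _ else _
    refine if_congr ⟨fun h' => ?_, fun h' => ?_⟩ rfl rfl
    · exact (h15 _ (h'.1.trans hN)).1 h'.2
    · exact ⟨hsmall _ h', (h15 _ ((hsmall _ h').trans hN)).2 h'⟩
  · rw [h5, h4 _ (by decide), h3 _ (by decide)]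
    exact h15 v hv
  · rw [hσ', Stm.den_real hO _ _ _ _ (by simp)]
    change σ2.real 0 0 v = if h : v < m then u {⟨v, h⟩} else 0
    rw [hin2.weight]
    simp [inputMem]
  · rw [h5, e4, Stm.den_tabN_apply (by omega) hv]
    simp only [NEx.val_row, NEx.val, ij_one, h3 15 (by decide)]
    exact h15 v hv
  · rw [hσ', Stm.den_tabR_apply (by omega) (by omega)]
    rfl
  · rw [h5, h4 _ (by decide), h3 _ (by decide), hel.pos hu X hv]

/-- The new threshold is the least open weight above the old one. The greedy parts then still weigh
at least as much, so the threshold never overshoots the share. -/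
theorem raiseStm_spec (hN : T.m < N) {G : SimpleGraph (Fin T.m)} {w : Fin T.m → ℝ} {σ : Mem}
    (h : HasTree N G n w T σ) (hL : HasCuts N T.X μ σ) (hk : σ.nat 4 0 0 = k) (hk0 : 0 < k)
    {σ' : Mem} (hσ' : σ' = raiseStm.den noOracle N σ) :
    ((T.dp N T.X μ T.m T.m 0).1 < k ∧ HasCuts N T.X μ σ') ∨
    ∃ μ', μ < μ' ∧ HasCuts N T.X μ' σ' ∧ (∃ l < N, k ≤ (T.dp N T.X μ' T.m T.m l).1) ∧
      T.potential N T.X μ' < T.potential N T.X μ := by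
  have hO := oracleFrame_elim
  rw [raiseStm, Stm.den_seq, Stm.den] at hσ'
  set σ1 := dpStm.den noOracle N σ with e1
  have hin : HasTree N G n w T σ1 := h.den (by simp) (by simp)
  have hL1 : HasCuts N T.X μ σ1 := hL.den (by simp) (by simp)
  have htab : ∀ v ≤ T.m, ∀ l < N, table σ1 v l = T.dp N T.X μ T.m v l := fun v hv l hl =>
    dpStm_spec hN h hL e1 hv hl
  have hk1 : σ1.nat 4 0 0 = k := by rw [e1, Stm.den_nat hO _ _ _ _ (by simp), hk]
  have hc : σ1.nat 24 T.m 0 = (T.dp N T.X μ T.m T.m 0).1 := by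
    rw [← htab _ le_rfl 0 (by omega)]; rfl
  have hr : ∀ v ∈ T.X, σ1.real 24 v 0 = (T.dp N T.X μ T.m v 0).2 := fun v hv => by
    rw [← htab _ (T.X_lt v hv).le 0 (by omega)]; rfl
  simp only [BEx.Holds, NEx.val, nV, kE, NEx.val_row, hin.input.m_eq, hk1, hc] at hσ'
  split_ifs at hσ' with hlt
  · exact Or.inl ⟨hlt, hσ' ▸ hL1⟩
  right
  set p : ℕ → Prop := fun v => nextB.Holds N σ1 (Function.update (ij 0 0) 2 v) with hp
  have hpv : ∀ v < N, p v ↔ (v ∈ T.X ∧ μ < (T.dp N T.X μ T.m v 0).2) ∧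
      ∀ y < N, (y ∈ T.X ∧ μ < (T.dp N T.X μ T.m y 0).2) →
        (T.dp N T.X μ T.m v 0).2 ≤ (T.dp N T.X μ T.m y 0).2 := by
    intro v hv
    have hheavy : ∀ y < N, (σ1.nat 15 0 y = 1 ∧ μ < σ1.real 24 y 0 ↔
        y ∈ T.X ∧ μ < (T.dp N T.X μ T.m y 0).2) := fun y hy => by
      rw [hin.mem y hy]
      exact and_congr_right fun hyX => by rw [hr y hyX]
    have hvar : ∀ y, Function.update (Function.update (ij 0 0) 2 v) 3 y 2 = v ∧
        Function.update (Function.update (ij 0 0) 2 v) 3 y 3 = y := fun y => by simp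
    simp only [hp, nextB, heavyB, BEx.Holds, BEx.holds_eq, NEx.val_row, NEx.val, REx.val,
      REx.val_row, BEx.holds_all, BEx.holds_imp, Function.update_self, hL1.threshold, hvar,
      hheavy v hv, not_lt]
    refine and_congr_right fun hvX => forall₂_congr fun y hy => ?_
    rw [hheavy y hy]
    exact imp_congr_right fun hyX => by rw [hr _ hvX.1, hr _ hyX.1]
  have hex := Rooted.exists_next (T := T) (N := N) (L := T.X) (μ := μ) (by omega) le_rfl
    (hk0.trans_le (not_lt.1 hlt))
  obtain ⟨v0, h1, h2, h3⟩ := hex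
  have hpN : firstIdx p N < N := firstIdx_lt_iff.2
    ⟨v0, (T.X_lt v0 h1).trans hN, (hpv v0 ((T.X_lt v0 h1).trans hN)).2
      ⟨⟨h1, h2⟩, fun y _ hy => h3 y hy.1 hy.2⟩⟩
  obtain ⟨⟨h4, h5⟩, h6⟩ := (hpv _ hpN).1 (firstIdx_spec hpN)
  refine ⟨(T.dp N T.X μ T.m (firstIdx p N) 0).2, h5, ⟨fun v hv => ?_, ?_⟩,
    ⟨T.m, hN, (not_lt.1 hlt).trans (Rooted.le_dp_next (by omega) le_rfl hN le_rfl
      fun y hy hyμ => h6 y ((T.X_lt y hy).trans hN) ⟨hy, hyμ⟩)⟩,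
    Rooted.potential_lt (by omega) le_rfl h4 h5 rfl⟩
  · rw [hσ']; exact hL1.mem v hv
  · rw [hσ', Stm.den_tabR_apply (by omega) (by omega), ← hr _ h4]
    rfl

/-- Every raise lowers the potential, which is at most `T.m * T.m`, and the nested repetition makes
`N * N` attempts. Once fewer than `k` strictly heavier parts exist, this remains so by `dp_anti`. -/
theorem rep_raiseStm_spec (hN : T.m < N) {G : SimpleGraph (Fin T.m)} {w : Fin T.m → ℝ} {σ : Mem}
    (h : HasTree N G n w T σ) (hL : HasCuts N T.X 0 σ) (hk : σ.nat 4 0 0 = k) (hk0 : 0 < k)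
    {σ' : Mem} (hσ' : σ' = (Stm.rep (Stm.rep raiseStm)).den noOracle N σ) :
    ∃ μ, 0 ≤ μ ∧ HasCuts N T.X μ σ' ∧ (T.dp N T.X μ T.m T.m 0).1 < k ∧
      (μ = 0 ∨ ∃ l < N, k ≤ (T.dp N T.X μ T.m T.m l).1) := by
  have hO := oracleFrame_elim
  have key : ∀ t, ∃ μ, 0 ≤ μ ∧ HasTree N G n w T ((raiseStm.den noOracle N)^[t] σ) ∧
      HasCuts N T.X μ ((raiseStm.den noOracle N)^[t] σ) ∧
      ((raiseStm.den noOracle N)^[t] σ).nat 4 0 0 = k ∧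
      (μ = 0 ∨ ∃ l < N, k ≤ (T.dp N T.X μ T.m T.m l).1) ∧
      ((T.dp N T.X μ T.m T.m 0).1 < k ∨ T.potential N T.X μ + t ≤ T.m * T.m) := by
    intro t
    induction t with
    | zero => exact ⟨0, le_rfl, h, hL, hk, Or.inl rfl, Or.inr (Rooted.potential_le (by omega) le_rfl)⟩
    | succ t ih =>
      obtain ⟨μ, h1, h2, h3, h4, h5, h6⟩ := ih
      rw [Function.iterate_succ_apply']
      set τ := (raiseStm.den noOracle N)^[t] σ
      have h7 : HasTree N G n w T (raiseStm.den noOracle N τ) := h2.den (by simp) (by simp)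
      have h8 : (raiseStm.den noOracle N τ).nat 4 0 0 = k := by
        rw [Stm.den_nat hO _ _ _ _ (by simp), h4]
      rcases raiseStm_spec hN h2 h3 h4 hk0 rfl with ⟨h9, h10⟩ | ⟨μ', h9, h10, h11, h12⟩
      · exact ⟨μ, h1, h7, h10, h8, h5, Or.inl h9⟩
      · refine ⟨μ', h1.trans h9.le, h7, h10, h8, Or.inr h11, ?_⟩
        rcases h6 with h6 | h6
        · exact Or.inl ((Rooted.dp_anti (by omega) le_rfl h9.le T.m T.m).1.fst_le.trans_lt h6)
        · right; omega
  obtain ⟨μ, h1, -, h3, -, h5, h6⟩ := key (N * N)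
  have he : σ' = (raiseStm.den noOracle N)^[N * N] σ := by
    rw [hσ', Stm.den, Function.iterate_mul]
    congr 1
  rw [← he] at h3
  refine ⟨μ, h1, h3, h6.resolve_right fun h6 => ?_, h5⟩
  have := Nat.mul_lt_mul'' hN hN
  omega

/-- For `μ = 0` the condition is void and the search returns `0`: parts of weight zero need not be
cut out, since agents may stay empty-handed. -/
theorem budgetStm_spec (hN : T.m < N) {G : SimpleGraph (Fin T.m)} {w : Fin T.m → ℝ} {σ : Mem}
    (h : HasTree N G n w T σ) (hL : HasCuts N T.X μ σ) (hk : σ.nat 4 0 0 = k)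
    (hμk : μ = 0 ∨ ∃ l < N, k ≤ (T.dp N T.X μ T.m T.m l).1) {σ' : Mem}
    (hσ' : σ' = budgetStm.den noOracle N σ) :
    ∃ l < N, (∀ a < l, 0 < μ ∧ (T.dp N T.X μ T.m T.m a).1 < k) ∧
      (0 < μ → k ≤ (T.dp N T.X μ T.m T.m l).1) ∧ σ'.nat 32 0 0 = l ∧
      σ'.nat 33 0 0 = min k (T.dp N T.X μ T.m T.m l).1 := by
  have hO := oracleFrame_elim
  rw [budgetStm, Stm.den_seq, Stm.den_seq] at hσ'
  set σ1 := dpStm.den noOracle N σ with e1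
  set σ2 := Stm.den _ N _ σ1 with e2
  have hin : HasTree N G n w T σ1 := h.den (by simp) (by simp)
  have hL1 : HasCuts N T.X μ σ1 := hL.den (by simp) (by simp)
  have hk1 : σ1.nat 4 0 0 = k := by rw [e1, Stm.den_nat hO _ _ _ _ (by simp), hk]
  have hc : ∀ l < N, σ1.nat 24 T.m l = (T.dp N T.X μ T.m T.m l).1 := fun l hl => by
    rw [← dpStm_spec hN h hL e1 le_rfl hl]; rfl
  set p : ℕ → Prop := fun l => 0 < μ → k ≤ (T.dp N T.X μ T.m T.m l).1 with hp
  have h32 : σ2.nat 32 0 0 = firstIdx p N := by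
    rw [e2, Stm.den_tabN_apply (by omega) (by omega), NEx.val]
    refine firstIdx_congr fun l hl => ?_
    simp only [BEx.holds_imp, BEx.Holds, REx.val, REx.val_row, NEx.val, nV, kE, NEx.val_row,
      hin.input.m_eq, hk1, Function.update_self, hc l hl, hL1.threshold, not_lt, hp]
  have hpN : firstIdx p N < N := by
    rcases hμk with hμ0 | ⟨l, hl, hkl⟩
    · exact firstIdx_lt_iff.2 ⟨0, by omega, fun h => absurd h (by rw [hμ0]; exact lt_irrefl _)⟩
    · exact firstIdx_lt_iff.2 ⟨l, hl, fun _ => hkl⟩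
  have h2n : ∀ a, a ≠ 32 → σ2.nat a = σ1.nat a := fun a ha =>
    Stm.den_nat hO _ _ _ _ (by simpa using ha)
  refine ⟨_, hpN, fun a ha => ?_, firstIdx_spec hpN, ?_, ?_⟩
  · have := not_of_lt_firstIdx ha
    simp only [hp, not_forall, not_le] at this
    obtain ⟨h1, h2⟩ := this
    exact ⟨h1, h2⟩
  · rw [hσ', Stm.den_nat hO _ _ _ _ (by simp), h32]
  · rw [hσ', Stm.den_tabN_apply (by omega) (by omega)]
    simp only [NEx.val, BEx.Holds, kE, nV, NEx.val_row, h32, h2n 0 (by decide), h2n 4 (by decide),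
      h2n 24 (by decide), hin.input.m_eq, hk1, hc _ hpN]
    split_ifs with h'
    · rw [min_eq_left h'.le]
    · rw [min_eq_right (not_lt.1 h')]

/-- One pass suffices for inclusion-minimality: the table is monotone in the set of allowed cuts, so
a cut that was indispensable remains so when further cuts are forbidden. -/
theorem forbidStm_spec (hN : T.m < N) {G : SimpleGraph (Fin T.m)} {w : Fin T.m → ℝ} {σ : Mem}
    (h : HasTree N G n w T σ) (hL : HasCuts N T.X μ σ) {l κ : ℕ} (hl : l < N)
    (hσl : σ.nat 32 0 0 = l) (hσκ : σ.nat 33 0 0 = κ) (hκ : κ ≤ (T.dp N T.X μ T.m T.m l).1)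
    {σ' : Mem} (hσ' : σ' = (Stm.forTo 31 nV forbidStm).den noOracle N σ) :
    ∃ L ⊆ T.X, HasCuts N L μ σ' ∧ κ ≤ (T.dp N L μ T.m T.m l).1 ∧
      ∀ v ∈ L, (T.dp N (L.erase v) μ T.m T.m l).1 < κ := by
  have hO := oracleFrame_elim
  let I : ℕ → Mem → Prop := fun t τ => HasTree N G n w T τ ∧ τ.nat 32 0 0 = l ∧ τ.nat 33 0 0 = κ ∧
    ∃ L ⊆ T.X, HasCuts N L μ τ ∧ κ ≤ (T.dp N L μ T.m T.m l).1 ∧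
      ∀ v ∈ L, v < t → (T.dp N (L.erase v) μ T.m T.m l).1 < κ
  suffices I T.m σ' by
    obtain ⟨-, -, -, L, h1, h2, h3, h4⟩ := this
    exact ⟨L, h1, h2, h3, fun v hv => h4 v hv (T.X_lt v (h1 hv))⟩
  rw [hσ']
  refine Stm.forTo_spec hO (by simp) hN.le (by omega) I ?_ (fun t _ τ hI => ?_) ?_
    ⟨h, hσl, hσκ, T.X, le_rfl, hL, hκ, fun v _ hv => by omega⟩
  · rintro t τ τ' h1 h2 ⟨h3, h4, h5, L, h6, h7, h8⟩
    refine ⟨h3.congr (fun a ha => h1 a ?_) (by rw [h2]), by rw [h1 _ (by decide), h4],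
      by rw [h1 _ (by decide), h5], L, h6, h7.congr (h1 _ (by decide)) (by rw [h2]), h8⟩
    rintro rfl; simp at ha
  · simp [nV, hI.1.input.m_eq]
  rintro t ht τ hc ⟨hT, h32, h33, L, hLX, hcut, hκL, hmin⟩
  have hT' : HasTree N G n w T (forbidStm.den noOracle N τ) := hT.den (by simp) (by simp)
  refine ⟨hT', by rw [Stm.den_nat hO _ _ _ _ (by simp), h32],
    by rw [Stm.den_nat hO _ _ _ _ (by simp), h33], ?_⟩
  rw [forbidStm, Stm.den_seq, Stm.den_seq, Stm.den_seq]
  set τ1 := Stm.den _ N _ τ with e1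
  set τ2 := Stm.den _ N _ τ1 with e2
  set τ3 := Stm.den _ N _ τ2 with e3
  have h1n : ∀ a, a ≠ 34 → τ1.nat a = τ.nat a := fun a ha =>
    Stm.den_nat hO _ _ _ _ (by simpa using ha)
  have h2n : ∀ a, a ≠ 18 → τ2.nat a = τ1.nat a := fun a ha =>
    Stm.den_nat hO _ _ _ _ (by simpa using ha)
  have h3n : ∀ a, a ∉ [24, 30, 28, 27] → τ3.nat a = τ2.nat a := fun a ha =>
    Stm.den_nat hO _ _ _ _ (by
      simp only [List.mem_cons, List.not_mem_nil, or_false] at ha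
      simp only [natW_dpStm, List.mem_cons, List.not_mem_nil, or_false]
      omega)
  have h3r : τ3.real 25 = τ.real 25 := Stm.den_real hO _ _ _ _ (by simp)
  have hcut2 : HasCuts N (L.erase t) μ τ2 := by
    refine ⟨fun v hv => ?_, hcut.threshold⟩
    rw [e2, Stm.den_tabN_apply (by omega) hv]
    simp only [NEx.val, BEx.holds_eq, ij_one, NEx.val_row, h1n 31 (by decide), h1n 18 (by decide),
      hc]
    by_cases hvt : v = t
    · simp [hvt]
    · simp [hvt, hcut.mem v hv]
  have hT2 : HasTree N G n w T τ2 := by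
    refine hT.congr (fun a ha => ?_) rfl
    simp only [List.mem_cons, List.not_mem_nil, or_false] at ha
    rw [h2n _ (by omega), h1n _ (by omega)]
  have hT3 : HasTree N G n w T τ3 := hT2.den (by simp) (by simp)
  have htab : τ3.nat 24 T.m l = (T.dp N (L.erase t) μ T.m T.m l).1 := by
    rw [← dpStm_spec hN hT2 hcut2 e3 le_rfl hl]; rfl
  have h3' : ∀ a ∉ [18, 34, 24, 30, 28, 27], τ3.nat a = τ.nat a := fun a ha => by
    simp only [List.mem_cons, List.not_mem_nil, or_false] at ha
    rw [h3n _ (by simp only [List.mem_cons, List.not_mem_nil, or_false]; omega),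
      h2n _ (by omega), h1n _ (by omega)]
  rw [Stm.den]
  simp only [BEx.Holds, NEx.val, nV, NEx.val_row, hT3.input.m_eq, h3' 32 (by decide),
    h3' 33 (by decide), h32, h33, htab]
  split_ifs with hlt
  · refine ⟨L, hLX, ⟨fun v hv => ?_, ?_⟩, hκL, fun v hv hvt => ?_⟩
    · rw [Stm.den_tabN_apply (by omega) hv]
      simp only [NEx.val, BEx.holds_eq, ij_one, NEx.val_row, h3' 31 (by decide), hc]
      by_cases hvt : v = t
      · rw [if_pos hvt, h3n _ (by decide), h2n _ (by decide), e1,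
          Stm.den_tabN_apply (by omega) (by omega)]
        simp only [NEx.val_row, NEx.val, hc]
        rw [hvt]
        exact hcut.mem t (by omega)
      · rw [if_neg hvt, h3n _ (by decide), hcut2.mem v hv, Finset.mem_erase]
        exact ⟨fun h => h.2, fun h => ⟨hvt, h⟩⟩
    · rw [Stm.den_real hO _ _ _ _ (by simp), h3r, hcut.threshold]
    · rcases Nat.lt_succ_iff_lt_or_eq.1 hvt with hvt | rfl
      · exact hmin v hv hvt
      · exact hlt
  · refine ⟨L.erase t, (Finset.erase_subset _ _).trans hLX, hcut2.congr (h3n _ (by decide))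
      h3r, not_lt.1 hlt, fun v hv hvt => ?_⟩
    obtain ⟨hv1, hv2⟩ := Finset.mem_erase.1 hv
    refine lt_of_le_of_lt (Rooted.dp_fst_mono ?_ hl) (hmin v hv2 (by omega))
    exact Finset.erase_subset_erase _ (Finset.erase_subset _ _)

theorem labelStm_spec (hN : T.m < N) {G : SimpleGraph (Fin T.m)} {w : Fin T.m → ℝ} {σ : Mem}
    (h : HasTree N G n w T σ) (hL : HasCuts N L μ σ) (hLX : L ⊆ T.X)
    (hpos : ∀ v < T.m, σ.nat 19 0 v = T.pos v) {σ' : Mem}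
    (hσ' : σ' = (Stm.rep labelStm).den noOracle N σ) : Labels T L (σ'.nat 5 0) := by
  classical
  have hO := oracleFrame_elim
  let lab : ℕ → ℕ → ℕ := fun t v => ((labelStm.den noOracle N)^[t] σ).nat 5 0 v
  have hstate : ∀ t, HasTree N G n w T ((labelStm.den noOracle N)^[t] σ) ∧
      HasCuts N L μ ((labelStm.den noOracle N)^[t] σ) ∧
      ((labelStm.den noOracle N)^[t] σ).nat 19 = σ.nat 19 := by
    intro t
    induction t with
    | zero => exact ⟨h, hL, rfl⟩
    | succ t ih =>
      rw [Function.iterate_succ_apply']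
      exact ⟨ih.1.den (by simp) (by simp), ih.2.1.den (by simp) (by simp),
        (Stm.den_nat hO _ _ _ _ (by simp)).trans ih.2.2⟩
  have hsucc : ∀ t, ∀ v ∈ T.X, lab (t + 1) v = if v ∈ L then cutRank T L v else
      if T.P v = T.m then 0 else lab t (T.P v) := by
    intro t v hv
    have hvm := T.X_lt v hv
    obtain ⟨hT, hc, h19⟩ := hstate t
    simp only [lab, Function.iterate_succ_apply']
    set τ := (labelStm.den noOracle N)^[t] σ
    rw [labelStm, Stm.den_tabN_apply (by omega) (by omega)]
    simp only [NEx.val, BEx.holds_eq, NEx.val_row, ij_one, hc.mem v (by omega), hT.par v hv, nV,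
      hT.input.m_eq]
    refine if_congr Iff.rfl ?_ rfl
    simp only [BEx.val_toNat, BEx.Holds, BEx.holds_eq, NEx.val_row, NEx.val, Function.update_self,
      h19]
    rw [cutRank, rankBelow, Finset.card_filter, ← Finset.sum_filter, ← Finset.sum_filter,
      Finset.sum_congr ?_ fun _ _ => rfl]
    ext y
    have hvar : Function.update (ij 0 v) 2 y 1 = v := by simp
    rw [Finset.mem_filter, Finset.mem_filter, Finset.mem_range, hvar, hpos v hvm]
    constructor
    · rintro ⟨hy, hy1, hy2⟩
      have hyL := (hc.mem y hy).1 hy1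
      have hym := T.X_lt y (hLX hyL)
      rw [hpos y hym] at hy2
      have := (Rooted.pos_spec hym).1
      exact ⟨hyL, by omega⟩
    · rintro ⟨hyL, hy2⟩
      have hym := T.X_lt y (hLX hyL)
      rw [hpos y hym]
      exact ⟨by omega, (hc.mem y (by omega)).2 hyL, by omega⟩
  -- The label of `v` is final after `T.m - T.pos v` passes, because its parent has a larger
  -- position and settles earlier. Hence `N > T.m` passes reach a fixed point.
  have hstable : ∀ v ∈ T.X, ∀ t, T.m ≤ t + T.pos v → lab t v = lab T.m v := by
    refine Rooted.induction_down fun v hv ih t ht => ?_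
    have hpv := (Rooted.pos_spec (T.X_lt v hv)).1
    obtain ⟨t, rfl⟩ : ∃ t', t = t' + 1 := ⟨t - 1, by omega⟩
    obtain ⟨s, hs⟩ : ∃ s, T.m = s + 1 := ⟨T.m - 1, by omega⟩
    rw [hsucc t v hv, show lab T.m v = lab (s + 1) v by rw [hs], hsucc s v hv]
    split_ifs with h1 h2
    · rfl
    · rfl
    · obtain ⟨h3, h4⟩ := Rooted.pos_lt_par hv h2
      rw [ih h3 t (by omega), ih h3 s (by omega)]
  have hfinal : σ'.nat 5 0 = lab N := by rw [hσ']; rfl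
  obtain ⟨s, hs⟩ : ∃ s, N = s + 1 := ⟨N - 1, by omega⟩
  rw [hfinal]
  have hval : ∀ v ∈ T.X, lab N v = if v ∈ L then cutRank T L v else
      if T.P v = T.m then 0 else lab N (T.P v) := by
    intro v hv
    have : lab N v = lab (s + 1) v := by rw [hs]
    rw [this, hsucc s v hv]
    refine if_congr Iff.rfl rfl ?_
    by_cases h2 : T.P v = T.m
    · rw [if_pos h2, if_pos h2]
    · obtain ⟨h3, h4⟩ := Rooted.pos_lt_par hv h2
      rw [if_neg h2, if_neg h2, hstable _ h3 s (by omega), hstable _ h3 N (by omega)]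
  refine ⟨fun v hvL hv => ?_, fun v hvL hv hP => ?_, fun v hvL hv hP => ?_⟩
  · rw [hval v hv, if_pos hvL]
  · rw [hval v hv, if_neg hvL, if_pos hP]
  · rw [hval v hv, if_neg hvL, if_neg hP]

/-- The subroutine for trees and additive utilities. -/
theorem solvesQueries_treeStm (hG : G.IsTree) {u : Finset (Fin m) → ℝ} (hu : ∀ X, 0 ≤ u X)
    (hadd : IsAdditive u) : SolvesQueries noOracle G n (fun v => u {v}) u treeStm where
  natW := by decide
  realW := by decide
  spec := by
    classical
    intro σ X k hin _ hXc hk hkn hX hσk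
    have hO := oracleFrame_elim
    set N := m + n + 1 with hN
    rw [treeStm, Stm.den_seq, Stm.den_seq, Stm.den_seq, Stm.den_seq, Stm.den_seq]
    set σ1 := Stm.den _ N _ σ with e1
    set σ2 := Stm.den _ N _ σ1 with e2
    set σ3 := Stm.den _ N _ σ2 with e3
    set σ4 := Stm.den _ N _ σ3 with e4
    set σ5 := Stm.den _ N _ σ4 with e5
    obtain ⟨T, hD, hT1, hC1, hpos1⟩ := setupStm_spec hG (N := N) (by omega) hu hin hX e1
    have hm := hD.size
    subst hm
    have hk1 : σ1.nat 4 0 0 = k := by rw [e1, Stm.den_nat hO _ _ _ _ (by simp), hσk]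
    have hmN : T.m < N := by omega
    obtain ⟨μ, hμ, hC2, h0, hμk⟩ := rep_raiseStm_spec hmN hT1 hC1 hk1 hk e2
    have hT2 : HasTree N G n _ T σ2 := hT1.den (by simp) (by simp)
    have hk2 : σ2.nat 4 0 0 = k := by rw [e2, Stm.den_nat hO _ _ _ _ (by simp), hk1]
    obtain ⟨l, hl, hl1, hl2, h32, h33⟩ := budgetStm_spec hmN hT2 hC2 hk2 hμk e3
    have hT3 : HasTree N G n _ T σ3 := hT2.den (by simp) (by simp)
    have hC3 : HasCuts N T.X μ σ3 := hC2.den (by simp) (by simp)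
    obtain ⟨L, hLX, hC4, hL1, hL2⟩ := forbidStm_spec hmN hT3 hC3 hl h32 h33 (min_le_right _ _) e4
    have hT4 : HasTree N G n _ T σ4 := hT3.den (by simp) (by simp)
    have hpos4 : ∀ v < T.m, σ4.nat 19 0 v = T.pos v := fun v hv => by
      rw [e4, Stm.den_nat hO _ _ _ _ (by simp), e3, Stm.den_nat hO _ _ _ _ (by simp), e2,
        Stm.den_nat hO _ _ _ _ (by simp), hpos1 v hv]
    have hlab := labelStm_spec hmN hT4 hC4 hLX hpos4 e5
    have hT5 : HasTree N G n _ T σ5 := hT4.den (by simp) (by simp)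
    rw [Stm.den_nat hO _ _ _ _ (by simp)]
    refine ⟨hD.isSMMS hadd hu hXc hk (by omega) hl hμ h0 hl1 hl2 hLX hL1 hL2 hlab, fun i => ?_⟩
    rw [weightStm, Stm.den_tabR_apply (by omega) (by omega)]
    simp only [REx.val, BEx.Holds, BEx.holds_eq, NEx.val_row, REx.val_row, NEx.val,
      Function.update_self]
    rw [hD.sum_weight hadd (Finset.filter_subset _ _), ← Finset.sum_filter]
    refine Finset.sum_congr (Finset.ext fun y => ?_) fun y hy => ?_
    · have hvar : Function.update (ij 0 (i : ℕ)) 2 y 1 = i := by simp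
      rw [Finset.mem_filter, Finset.mem_range, hvar, mem_map_val]
      constructor
      · rintro ⟨h1, h2, h3⟩
        have hyX := (hT5.mem y h1).1 h2
        exact ⟨⟨y, T.X_lt y hyX⟩, Finset.mem_filter.2 ⟨(hD.mem _).1 hyX, h3⟩, rfl⟩
      · rintro ⟨z, hz, rfl⟩
        obtain ⟨h1, h2⟩ := Finset.mem_filter.1 hz
        have hzN : (z : ℕ) < N := by omega
        exact ⟨hzN, (hT5.mem z hzN).2 ((hD.mem z).2 h1), h2⟩
    · obtain ⟨z, -, rfl⟩ := mem_map_val.1 hy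
      exact hT5.weight z (by omega)

end

end FairDivision

/-! ### The main theorem -/

namespace FairDivision

theorem LoserRecursion.fair {V : Type*} [Fintype V] [DecidableEq V] {G : SimpleGraph V} {n : ℕ}
    {u : Finset V → ℝ} (hn : 0 < n) (h0 : ∀ X, 0 ≤ u X) (hu : ∀ X, u ∅ ≤ u X)
    {A : Fin n → Finset V} (hA : LoserRecursion G u Finset.univ Finset.univ A) :
    IsConnAlloc G Finset.univ Finset.univ A ∧ IsPMMS G u Finset.univ A ∧
      IsSMMS G u Finset.univ Finset.univ A ∧ IsMMS G u Finset.univ Finset.univ A :=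
  have h := hA.correct h0 hu ⟨⟨0, hn⟩, Finset.mem_univ _⟩
  ⟨h.1.alloc, h.2, h.1, h.1.mms⟩

end FairDivision

theorem mainTheorem7 :
    -- correctness of the recursive algorithm: connected graphs, identical utilities
    (∀ (V : Type*) [Fintype V] [DecidableEq V] (G : SimpleGraph V) (n : ℕ) (u : Finset V → ℝ),
      G.Connected → 0 < n → (∀ X, 0 ≤ u X) → (∀ X, u ∅ ≤ u X) →
      (∃ A : Fin n → Finset V,
        FairDivision.LoserRecursion G u Finset.univ Finset.univ A) ∧
      ∀ A : Fin n → Finset V,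
        FairDivision.LoserRecursion G u Finset.univ Finset.univ A →
        FairDivision.IsConnAlloc G Finset.univ Finset.univ A ∧
        FairDivision.IsPMMS G u Finset.univ A ∧
        FairDivision.IsSMMS G u Finset.univ Finset.univ A ∧
        FairDivision.IsMMS G u Finset.univ Finset.univ A) ∧
    -- its running time, relative to oracles for the utility and for SMMS allocations
    (∃ (P : RAM.Program FairDivision.OracleName) (p : Polynomial ℕ),
      ∀ (m n : ℕ) (G : SimpleGraph (Fin m)) (u : Finset (Fin m) → ℝ)
        (f : Finset (Fin m) → ℕ → Fin m → ℕ),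
        G.Connected → 0 < n → (∀ X, 0 ≤ u X) → (∀ X, u ∅ ≤ u X) →
        FairDivision.SolvesSMMS G u f →
        ∃ (t : ℕ) (s : RAM.Mem) (A : Fin n → Finset (Fin m)),
          RAM.Runs (FairDivision.oracles u f) P (FairDivision.inputMem G n fun _ => 0) t s ∧
          t ≤ p.eval (m + n) ∧
          FairDivision.OutputsAlloc s A ∧
          FairDivision.LoserRecursion G u Finset.univ Finset.univ A) ∧
    -- trees and identical additive utilities: polynomial time without oracles
    (∃ (P : RAM.Program Empty) (p : Polynomial ℕ),
      ∀ (m n : ℕ) (G : SimpleGraph (Fin m)) (u : Finset (Fin m) → ℝ),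
        G.IsTree → 0 < n → (∀ X, 0 ≤ u X) → FairDivision.IsAdditive u →
        ∃ (t : ℕ) (s : RAM.Mem) (A : Fin n → Finset (Fin m)),
          RAM.Runs (fun q => q.elim) P (FairDivision.inputMem G n fun v => u {v}) t s ∧
          t ≤ p.eval (m + n) ∧
          FairDivision.OutputsAlloc s A ∧
          FairDivision.LoserRecursion G u Finset.univ Finset.univ A ∧
          FairDivision.IsConnAlloc G Finset.univ Finset.univ A ∧
          FairDivision.IsPMMS G u Finset.univ A ∧
          FairDivision.IsSMMS G u Finset.univ Finset.univ A ∧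
          FairDivision.IsMMS G u Finset.univ Finset.univ A) := by
  refine ⟨fun V _ _ G n u hG hn h0 hu => ⟨?_, fun A hA => hA.fair hn h0 hu⟩, ?_, ?_⟩
  · exact FairDivision.exists_loserRecursion _ _ (FairDivision.connBundle_univ hG)
      ⟨⟨0, hn⟩, Finset.mem_univ _⟩ hu
  · obtain ⟨P, p, hP⟩ := FairDivision.exists_program
      (RAM.Stm.rep (FairDivision.roundStm FairDivision.oracleStm))
    refine ⟨P, p, fun m n G u f hG hn _ hu hf => ?_⟩
    obtain ⟨t, s, hr, ht, hs⟩ := hP _ (FairDivision.oracleOK_oracles u f) m n G fun _ => 0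
    obtain ⟨A, hA1, hA2⟩ := FairDivision.rep_roundStm_spec hu
      (FairDivision.oracleFrame_oracles u f) hG hn (FairDivision.solvesQueries_oracleStm hf) hs
    exact ⟨t, s, A, hr, ht, hA1, hA2⟩
  · obtain ⟨P, p, hP⟩ := FairDivision.exists_program
      (RAM.Stm.rep (FairDivision.roundStm FairDivision.treeStm))
    refine ⟨P, p, fun m n G u hG hn h0 hadd => ?_⟩
    have hu : ∀ X, u ∅ ≤ u X := fun X => by
      rw [hadd ∅, Finset.sum_empty]; exact h0 X
    obtain ⟨t, s, hr, ht, hs⟩ := hP _ FairDivision.oracleOK_elim m n G fun v => u {v}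
    obtain ⟨A, hA1, hA2⟩ := FairDivision.rep_roundStm_spec hu FairDivision.oracleFrame_elim
      hG.connected hn (FairDivision.solvesQueries_treeStm hG h0 hadd) hs
    exact ⟨t, s, A, hr, ht, hA1, hA2, hA2.fair hn h0 hu⟩
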